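/- Let $r\ge 1$ be an integer and let $a,b,\iota\ge 0$ be real. Let $\Sigma$ be the root system on $\mathfrak a=\mathbb R^r$ with roots $\pm\xi_i^*\pm\xi_j^*$ ($i\neq j$), $\pm\xi_j^*$, $\pm2\xi_j^*$ of multiplicities $a$, $2b$, $\iota$ respectively, where $\xi_j^*(t)=t_j$ and where roots of multiplicity zero do not occur. Let $W$ be its Weyl group, generated by the reflections in the roots that occur. Put $\operatorname{SH}(t)=\prod_{j=1}^r\sinh t_j$, $$d\mu(t)=\prod_{j=1}^r|2\sinh 2t_j|^{\iota}\,|2\sinh t_j|^{2b}\prod_{1\le i<j\le r}|2\sinh(t_i-t_j)|^a\,|2\sinh(t_i+t_j)|^a\,dt,\qquad \rho_j=\iota+b+a(r-j),$$ and let $$\begin{aligned}D_j=\partial_j&-a\sum_{i<j}\frac{1-s_{ij}}{1-e^{-2(t_i-t_j)}}+a\sum_{k>j}\frac{1-s_{jk}}{1-e^{-2(t_j-t_k)}}+a\sum_{k\ne j}\frac{1-\sigma_{jk}}{1-e^{-2(t_j+t_k)}}\\&+2\iota\frac{1-\sigma_j}{1-e^{-4t_j}}+2b\frac{1-\sigma_j}{1-e^{-2t_j}}-\rho_j\end{aligned}$$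 be the Cherednik operators, where $s_{ij}$ interchanges $t_i$ and $t_j$, $\sigma_{ij}$ sends $(t_i,t_j)$ to $(-t_j,-t_i)$, and $\sigma_j$ changes the sign of $t_j$. For $\delta\in\mathbb C$ let $$\mathcal M_\delta=\prod_{j=1}^r\big(D_j^2-(\delta+\rho_1)^2\big),\qquad z_\delta=\Gamma_a\Big(\frac\delta2+\frac a2(r-1)+1\Big)\,\Gamma_a\Big(\frac{\delta-1+\iota+2b}2+\frac a2(r-1)+1\Big),$$ where $\Gamma_a(\lambda)=\prod_{j=1}^r\Gamma\big(\lambda-\frac a2(j-1)\big)$ is the Gindikin Gamma function; $1/z_\delta$ is read as an entire function of $\delta$. Let $C_0^\infty(\mathbb R^r)^W$ be the space of complex-valued $W$-invariant smooth functions with compact support, with the topology induced by the usual topology of $C_0^\infty(\mathbb R^r)$; a distribution on it is a continuous linear functional. Then $\mathcal M_\delta$ defines a continuous linear operator on $C_0^\infty(\mathbb R^r)^W$ (given by the formula above off the hyperplanes $t_j=0$, $t_i=\pm t_j$), and it is symmetric: $\int(\mathcal M_\delta f)\,g\,d\mu=\int f\,(\mathcal M_\delta g)\,d\mu$. It therefore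 acts on distributions $u$ by $(\mathcal M_\delta u)(f)=u(\mathcal M_\delta f)$. For $\operatorname{Re}\delta>-1-\iota-2b$ the integral $$\zeta_\delta(f)=\frac1{z_\delta}\int_{\mathbb R^r}|\operatorname{SH}(t)|^\delta f(t)\,d\mu(t),\qquad f\in C_0^\infty(\mathbb R^r)^W,$$ converges absolutely and defines a distribution on $C_0^\infty(\mathbb R^r)^W$. The family $\zeta_\delta$ extends analytically to all $\delta\in\mathbb C$: there are distributions $\zeta_\delta$, $\delta\in\mathbb C$, given by this formula for $\operatorname{Re}\delta>-1-\iota-2b$, such that $\delta\mapsto\zeta_\delta(f)$ is entire for every $f$. Moreover, for all $\delta\in\mathbb C$, $$\mathcal M_\delta\zeta_\delta=2^{2r}\zeta_{\delta-2}.$$ -/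

import Mathlib

open MeasureTheory TopologicalSpace

noncomputable section

namespace SinhZeta

/-- The reflection `s_{ij}` of `ℝ^r`: it interchanges the coordinates `i` and `j`. -/
def reflSwap {r : ℕ} (i j : Fin r) (t : Fin r → ℝ) : Fin r → ℝ :=
  fun k => t (Equiv.swap i j k)

/-- The reflection `σ_i` of `ℝ^r`: it changes the sign of the coordinate `i`. -/
def reflSign {r : ℕ} (i : Fin r) (t : Fin r → ℝ) : Fin r → ℝ :=
  fun k => if k = i then -t k else t k

/-- The reflection `σ_{ij}` of `ℝ^r` (`i ≠ j`): it sends the basis vector `ξ_i` to `-ξ_j` and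
`ξ_j` to `-ξ_i`, and it fixes the other basis vectors. -/
def reflSignedSwap {r : ℕ} (i j : Fin r) (t : Fin r → ℝ) : Fin r → ℝ :=
  fun k => if k = i then -t j else if k = j then -t i else t k

theorem reflSwap_involutive {r : ℕ} (i j : Fin r) :
    Function.Involutive (reflSwap (r := r) i j) := by
  intro t
  funext k
  simp [reflSwap]

theorem reflSign_involutive {r : ℕ} (i : Fin r) :
    Function.Involutive (reflSign (r := r) i) := by
  intro t
  funext k
  by_cases h : k = i <;> simp [reflSign, h]

theorem reflSignedSwap_involutive {r : ℕ} (i j : Fin r) :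
    Function.Involutive (reflSignedSwap (r := r) i j) := by
  intro t
  funext k
  by_cases h : k = i
  · by_cases h' : j = i <;> simp [reflSignedSwap, h, h']
  · by_cases h' : k = j
    · subst h'
      simp [reflSignedSwap, h]
    · simp [reflSignedSwap, h, h']

/-- The Weyl group of the root system `{±ξ_i^* ± ξ_j^* (i ≠ j)} ∪ {±ξ_i^*} ∪ {±2ξ_i^*}` with
respective multiplicities `a`, `2b`, `ι`, where roots of multiplicity zero do not occur: the group
generated by the reflections in the roots that do occur. It is the group of all signed
permutations when `a ≠ 0` and `(b, ι) ≠ (0, 0)` (types `B`, `BC`), and the group of permutations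
with an even number of sign changes when `a ≠ 0` and `b = ι = 0` (type `D`). -/
def weylGroup (r : ℕ) (a b ι : ℝ) : Subgroup (Equiv.Perm (Fin r → ℝ)) :=
  Subgroup.closure
    ({w | a ≠ 0 ∧ ∃ i j : Fin r, i ≠ j ∧ w = (reflSwap_involutive i j).toPerm} ∪
      {w | a ≠ 0 ∧ ∃ i j : Fin r, i ≠ j ∧ w = (reflSignedSwap_involutive i j).toPerm} ∪
      {w | (b ≠ 0 ∨ ι ≠ 0) ∧ ∃ i : Fin r, w = (reflSign_involutive i).toPerm})

/-- The space `C_0^∞(ℝ^r)^W` of complex valued, `W`-invariant, smooth functions with compact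
support, as a subspace of the space of test functions with its canonical LF topology. -/
def invariantTestFunctions (r : ℕ) (a b ι : ℝ) :
    Submodule ℂ (TestFunction (⊤ : Opens (Fin r → ℝ)) ℂ (⊤ : ℕ∞)) where
  carrier := {f | ∀ w ∈ weylGroup r a b ι, ∀ t : Fin r → ℝ, f (w t) = f t}
  zero_mem' := fun _ _ _ => rfl
  add_mem' := by
    intro f g hf hg w hw t
    change f (w t) + g (w t) = f t + g t
    rw [hf w hw t, hg w hw t]
  smul_mem' := by
    intro c f hf w hw t
    change c • f (w t) = c • f t
    rw [hf w hw t]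

/-- `SH(t) = ∏ sinh t_j`. -/
def SH {r : ℕ} (t : Fin r → ℝ) : ℝ := ∏ j, Real.sinh (t j)

/-- The density `∏_{α > 0} |2 sinh α(t)|^{k_α}` of `dμ`. -/
def density (r : ℕ) (a b ι : ℝ) (t : Fin r → ℝ) : ℝ :=
  (∏ j, |2 * Real.sinh (2 * t j)| ^ ι * |2 * Real.sinh (t j)| ^ (2 * b)) *
    ∏ i, ∏ j ∈ Finset.Ioi i,
      |2 * Real.sinh (t i - t j)| ^ a * |2 * Real.sinh (t i + t j)| ^ a

/-- The measure `dμ(t)` on `ℝ^r`. -/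
def mu (r : ℕ) (a b ι : ℝ) : Measure (Fin r → ℝ) :=
  volume.withDensity fun t => ENNReal.ofReal (density r a b ι t)

/-- The complement of the reflecting hyperplanes `t_i = 0` and `t_i = ± t_j`. -/
def regularSet (r : ℕ) : Set (Fin r → ℝ) :=
  {t | (∀ i, t i ≠ 0) ∧ ∀ i j, i ≠ j → t i ≠ t j ∧ t i ≠ -t j}

/-- The coordinates `ρ_j = ι + b + a (r - j)` (`1 ≤ j ≤ r`) of the half sum of positive roots;
here the index `j` runs from `0` to `r - 1`. -/
def rho (r : ℕ) (a b ι : ℝ) (j : Fin r) : ℝ := ι + b + a * ((r : ℝ) - 1 - (j : ℝ))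

/-- The Cherednik operator `D_j`, at the points of the regular set. -/
def cherednik (r : ℕ) (a b ι : ℝ) (j : Fin r) (f : (Fin r → ℝ) → ℂ) (t : Fin r → ℝ) : ℂ :=
  fderiv ℝ f t (Pi.single j 1)
    - a * ∑ i ∈ Finset.Iio j,
        ((1 / (1 - Real.exp (-2 * (t i - t j))) : ℝ) : ℂ) * (f t - f (reflSwap i j t))
    + a * ∑ k ∈ Finset.Ioi j,
        ((1 / (1 - Real.exp (-2 * (t j - t k))) : ℝ) : ℂ) * (f t - f (reflSwap j k t))
    + a * ∑ k ∈ Finset.univ.erase j,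
        ((1 / (1 - Real.exp (-2 * (t j + t k))) : ℝ) : ℂ) * (f t - f (reflSignedSwap j k t))
    + 2 * ι * ((1 / (1 - Real.exp (-4 * t j)) : ℝ) : ℂ) * (f t - f (reflSign j t))
    + 2 * b * ((1 / (1 - Real.exp (-2 * t j)) : ℝ) : ℂ) * (f t - f (reflSign j t))
    - rho r a b ι j * f t

/-- The operator `D_j ^ 2 - (δ + ρ_1) ^ 2`, where `ρ_1 = ι + b + a (r - 1)`. -/
def opFactor (r : ℕ) (a b ι : ℝ) (δ : ℂ) (j : Fin r) (f : (Fin r → ℝ) → ℂ) :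
    (Fin r → ℝ) → ℂ :=
  fun t => cherednik r a b ι j (cherednik r a b ι j f) t
    - (δ + ((ι + b + a * ((r : ℝ) - 1) : ℝ) : ℂ)) ^ 2 * f t

/-- The operator `𝓜_δ = ∏_j (D_j ^ 2 - (δ + ρ_1) ^ 2)`, at the points of the regular set (which is
open and stable under all the reflections, so that values off this set do not matter). The
composition is taken in the order of the indices; the Cherednik operators commute. -/
def opM (r : ℕ) (a b ι : ℝ) (δ : ℂ) (f : (Fin r → ℝ) → ℂ) : (Fin r → ℝ) → ℂ :=
  (List.finRange r).foldr (fun j g => opFactor r a b ι δ j g) f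

/-- The Gindikin Gamma function `Γ_a(s) = ∏_{j=1}^r Γ(s - (a/2)(j - 1))`. -/
def gindikinGamma (r : ℕ) (a : ℝ) (s : ℂ) : ℂ :=
  ∏ j : Fin r, Complex.Gamma (s - (a : ℂ) / 2 * ((j : ℕ) : ℂ))

/-- The normalizing factor `z_δ`. At a pole of one of the Gamma factors the value is `0` by
convention, so that `(zNorm r a b ι δ)⁻¹` is the value `0` of the entire function `1 / z_δ`. -/
def zNorm (r : ℕ) (a b ι : ℝ) (δ : ℂ) : ℂ :=
  gindikinGamma r a (δ / 2 + (a : ℂ) / 2 * ((r : ℂ) - 1) + 1) *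
    gindikinGamma r a ((δ - 1 + ι + 2 * b) / 2 + (a : ℂ) / 2 * ((r : ℂ) - 1) + 1)

end SinhZeta

end

/-!
The Cherednik operators are made into continuous operators on the space `TF r` of all test
functions on `ℝ^r`. A term `c(α(t)) (f(t) - f(s_α t))` of such an operator is, by the fundamental
theorem of calculus, a smooth function times an average of a directional derivative of `f`
(`divDiff`), hence smooth across the hyperplane `α = 0`, with bounds that make it continuous for
the LF topology. Identities between such operators need only be checked at regular points
(`op_ext`).

The operators commute (`commute_cherOp`). The brackets of their parts cancel by relations that
involve root systems of rank two (`rank_two_short`, `rank_two_long`) or three (`rank_three`), and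
these reduce to the addition law of `coth`. Together with the graded Hecke relations between `D_j`
and the adjacent transpositions (`swap_mul_cherOp_fst`) and the last sign change
(`sign_mul_cherOp`) this shows that `𝓜_δ = ∏_j (D_j² - c²)`, `c = δ + ρ_1`, commutes with all
signed permutations. So it preserves invariance under the Weyl group (`invOp`), and it commutes
with `t ↦ -t`.

Integration by parts with respect to `dμ` is possible as `coth α` is locally integrable for `dμ`
for every root `α` of positive multiplicity (`isAdj_cherOp`). The transpose of `D_j` on test
functions is its conjugate by `t ↦ -t` (`isAdj_cherOp_test`), so `𝓜_δ` is symmetric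
(`isAdj_prodOp`).

The heart of the functional equation is the factorization `𝓜_δ = (D_0 + c) ⋯ (D_{r-1} + c)
(D_{r-1} - c) ⋯ (D_0 - c)`. For `Re δ > 2` the transposes of the first `r` factors act on `|SH| ^
δ` by turning the functions `|sinh t_j| ^ δ` into `|sinh t_j| ^ δ (1 - coth t_j)`, one coordinate
after the other and up to the constants `δ + a j` (`isAdj_mixedPow_add`). The transposes of the
other `r` factors turn these into `|sinh t_j| ^ δ (coth² t_j - 1) = |sinh t_j| ^ (δ - 2)`, in the
opposite order and up to the constants `δ - 1 + ι + 2b + a (r - 1 - j)` (`isAdj_mixedPow_sub`).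
Thus `𝓜_δ |SH| ^ δ` is an explicit polynomial `bFactor` in `δ` times `|SH| ^ (δ - 2)`
(`integral_prodOp`), and the recursion of the Gamma function turns this into `𝓜_δ ζ_δ = 2 ^ (2r)
ζ_{δ-2}` (`bFactor_mul_inv_zNorm`).

Both sides are analytic where the integrals converge, so the functional equation holds for `Re δ >
1 - ι - 2b`. Used as a definition of `ζ_{δ-2}` it extends the family `ζ_δ` to the left, two units
at a time (`zetaExt`), and it remains true for the extended family (`zetaDist_opMTest`). The
extension is analytic because `𝓜_δ f` is a polynomial in `δ` with coefficients in the test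
functions (`exists_prodOp_eq_sum`).
-/

noncomputable section

namespace SinhZeta

open scoped ContDiff Distributions

/-! ### Averages of smooth functions along linear maps -/

section Average

variable {E : Type} [NormedAddCommGroup E] [NormedSpace ℝ E]
  {G G' : Type} [NormedAddCommGroup G] [NormedSpace ℝ G] [NormedAddCommGroup G'] [NormedSpace ℝ G']

/-- The average `t ↦ ∫₀¹ L_s (f (A_s t)) ds` of a function along a family of linear maps. -/
def avg (L : ℝ → G →L[ℝ] G') (A : ℝ → E →L[ℝ] E) (f : E → G) (t : E) : G' :=
  ∫ s in (0 : ℝ)..1, L s (f (A s t))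

/-- The family acting on derivatives that describes the derivative of an average. -/
def avgDeriv (L : ℝ → G →L[ℝ] G') (A : ℝ → E →L[ℝ] E) (s : ℝ) :
    (E →L[ℝ] G) →L[ℝ] (E →L[ℝ] G') :=
  (ContinuousLinearMap.compL ℝ E E G').flip (A s) ∘L ContinuousLinearMap.compL ℝ E G G' (L s)

theorem avgDeriv_apply (L : ℝ → G →L[ℝ] G') (A : ℝ → E →L[ℝ] E) (s : ℝ) (X : E →L[ℝ] G) :
    avgDeriv L A s X = (L s ∘L X) ∘L A s := rfl

theorem continuous_avgDeriv {L : ℝ → G →L[ℝ] G'} {A : ℝ → E →L[ℝ] E} (hL : Continuous L)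
    (hA : Continuous A) : Continuous (avgDeriv L A) := by
  unfold avgDeriv
  fun_prop

theorem norm_avgDeriv_le {L : ℝ → G →L[ℝ] G'} {A : ℝ → E →L[ℝ] E} (s : ℝ) :
    ‖avgDeriv L A s‖ ≤ ‖L s‖ * ‖A s‖ := by
  refine ContinuousLinearMap.opNorm_le_bound _ (by positivity) fun X => ?_
  rw [avgDeriv_apply]
  calc ‖(L s ∘L X) ∘L A s‖ ≤ ‖L s ∘L X‖ * ‖A s‖ := ContinuousLinearMap.opNorm_comp_le _ _
    _ ≤ (‖L s‖ * ‖X‖) * ‖A s‖ := by gcongr; exact ContinuousLinearMap.opNorm_comp_le _ _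
    _ = _ := by ring

theorem hasFDerivAt_avg [FiniteDimensional ℝ E] [CompleteSpace G']
    {L : ℝ → G →L[ℝ] G'} {A : ℝ → E →L[ℝ] E}
    (hL : Continuous L) (hA : Continuous A) {f : E → G} (hf : ContDiff ℝ 1 f) (t : E) :
    HasFDerivAt (avg L A f) (avg (avgDeriv L A) A (fderiv ℝ f) t) t := by
  have hfd : Continuous (fderiv ℝ f) := hf.continuous_fderiv (by norm_num)
  have hc1 : Continuous fun p : ℝ × E => L p.1 (f (A p.1 p.2)) := by
    have := hf.continuous
    fun_prop
  have hc2 : Continuous fun p : ℝ × E => avgDeriv L A p.1 (fderiv ℝ f (A p.1 p.2)) := by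
    have := continuous_avgDeriv hL hA
    fun_prop
  have : ProperSpace E := FiniteDimensional.proper ℝ E
  obtain ⟨C, hC⟩ := ((isCompact_Icc (a := (0:ℝ)) (b := 1)).prod
    (isCompact_closedBall t 1)).exists_bound_of_continuousOn hc2.continuousOn
  refine intervalIntegral.hasFDerivAt_integral_of_dominated_of_fderiv_le
    (F := fun x s => L s (f (A s x)))
    (F' := fun x s => avgDeriv L A s (fderiv ℝ f (A s x)))
    (bound := fun _ => C) (Metric.ball_mem_nhds t one_pos) ?_ ?_ ?_ ?_ ?_ ?_
  · exact Filter.Eventually.of_forall fun x =>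
      (hc1.comp (by fun_prop : Continuous fun s : ℝ => (s, x))).aestronglyMeasurable
  · exact (hc1.comp (by fun_prop : Continuous fun s : ℝ => (s, t))).intervalIntegrable _ _
  · exact (hc2.comp (by fun_prop : Continuous fun s : ℝ => (s, t))).aestronglyMeasurable
  · refine Filter.Eventually.of_forall fun s hs x hx =>
      hC (s, x) ⟨?_, Metric.ball_subset_closedBall hx⟩
    rw [Set.uIoc_of_le zero_le_one] at hs
    exact ⟨hs.1.le, hs.2⟩
  · exact intervalIntegrable_const
  · refine Filter.Eventually.of_forall fun s _ x _ => ?_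
    have h1 : HasFDerivAt f (fderiv ℝ f (A s x)) (A s x) :=
      (hf.differentiable (by norm_num) _).hasFDerivAt
    exact (L s).hasFDerivAt.comp x (h1.comp x (A s).hasFDerivAt)

theorem continuous_avg [FiniteDimensional ℝ E]
    {L : ℝ → G →L[ℝ] G'} {A : ℝ → E →L[ℝ] E}
    (hL : Continuous L) (hA : Continuous A) {f : E → G} (hf : Continuous f) :
    Continuous (avg L A f) := by
  have : ProperSpace E := FiniteDimensional.proper ℝ E
  exact intervalIntegral.continuous_parametric_intervalIntegral_of_continuous'
    (f := fun x s => L s (f (A s x))) (by unfold Function.uncurry; fun_prop) _ _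

/-- The codomain varies in the induction, because the derivative of an average is an average of
linear maps. -/
theorem contDiff_avg_nat [FiniteDimensional ℝ E] (n : ℕ) :
    ∀ {G G' : Type} [NormedAddCommGroup G] [NormedSpace ℝ G] [NormedAddCommGroup G']
      [NormedSpace ℝ G'] [CompleteSpace G'] {L : ℝ → G →L[ℝ] G'} {A : ℝ → E →L[ℝ] E}
      (_ : Continuous L) (_ : Continuous A) {f : E → G} (_ : ContDiff ℝ n f),
      ContDiff ℝ n (avg L A f) := by
  induction n with
  | zero =>
    intro G G' _ _ _ _ _ L A hL hA f hf
    simp only [Nat.cast_zero, contDiff_zero] at hf ⊢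
    exact continuous_avg hL hA hf
  | succ n ih =>
    intro G G' _ _ _ _ _ L A hL hA f hf
    have h1 : ContDiff ℝ 1 f := hf.of_le (by norm_cast; omega)
    have key := hasFDerivAt_avg hL hA h1
    push_cast
    rw [contDiff_succ_iff_hasFDerivAt]
    refine ⟨avg (avgDeriv L A) A (fderiv ℝ f), ?_, key⟩
    exact ih (continuous_avgDeriv hL hA) hA (hf.fderiv_right (by norm_cast))

theorem contDiff_avg [FiniteDimensional ℝ E] [CompleteSpace G'] {L : ℝ → G →L[ℝ] G'}
    {A : ℝ → E →L[ℝ] E} (hL : Continuous L) (hA : Continuous A) {f : E → G}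
    (hf : ContDiff ℝ ∞ f) : ContDiff ℝ ∞ (avg L A f) :=
  contDiff_infty.2 fun n => contDiff_avg_nat n hL hA (contDiff_infty.1 hf n)

/-- The `n`-th derivatives of an average are bounded by those of the function; this is what makes
the divided difference operators continuous for the LF topology. -/
theorem norm_iteratedFDeriv_avg_le [FiniteDimensional ℝ E] (n : ℕ) :
    ∀ {G G' : Type} [NormedAddCommGroup G] [NormedSpace ℝ G] [NormedAddCommGroup G']
      [NormedSpace ℝ G'] [CompleteSpace G'] {L : ℝ → G →L[ℝ] G'} {A : ℝ → E →L[ℝ] E}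
      (_ : Continuous L) (_ : Continuous A) {f : E → G} (_ : ContDiff ℝ ∞ f) {c M B : ℝ}
      (_ : ∀ s ∈ Set.Icc (0 : ℝ) 1, ‖L s‖ ≤ c) (_ : ∀ s ∈ Set.Icc (0 : ℝ) 1, ‖A s‖ ≤ M)
      (_ : ∀ x, ‖iteratedFDeriv ℝ n f x‖ ≤ B) (t : E),
      ‖iteratedFDeriv ℝ n (avg L A f) t‖ ≤ c * M ^ n * B := by
  induction n with
  | zero =>
    intro G G' _ _ _ _ _ L A hL hA f hf c M B hc hM hB t
    have hc0 : 0 ≤ c := (norm_nonneg _).trans (hc 0 (by simp))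
    simp only [norm_iteratedFDeriv_zero, pow_zero, mul_one] at hB ⊢
    have := intervalIntegral.norm_integral_le_of_norm_le_const (a := 0) (b := 1)
      (f := fun s => L s (f (A s t))) (C := c * B) (fun s hs => ?_)
    · simpa [avg] using this
    · rw [Set.uIoc_of_le zero_le_one] at hs
      refine ((L s).le_opNorm _).trans ?_
      gcongr
      · exact hc s ⟨hs.1.le, hs.2⟩
      · exact hB _
  | succ n ih =>
    intro G G' _ _ _ _ _ L A hL hA f hf c M B hc hM hB t
    have hM0 : 0 ≤ M := (norm_nonneg _).trans (hM 0 (by simp))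
    have hc0 : 0 ≤ c := (norm_nonneg _).trans (hc 0 (by simp))
    have h1 : ContDiff ℝ 1 f := hf.of_le (by norm_cast)
    have key : fderiv ℝ (avg L A f) = avg (avgDeriv L A) A (fderiv ℝ f) :=
      funext fun t => (hasFDerivAt_avg hL hA h1 t).fderiv
    rw [← norm_iteratedFDeriv_fderiv, key]
    have := ih (continuous_avgDeriv hL hA) hA (f := fderiv ℝ f) (hf.fderiv_right (by norm_cast))
      (c := c * M) (M := M) (B := B) (fun s hs => (norm_avgDeriv_le s).trans
        (mul_le_mul (hc s hs) (hM s hs) (norm_nonneg _) hc0)) hM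
      (fun x => by rw [norm_iteratedFDeriv_fderiv]; exact hB x) t
    refine this.trans (le_of_eq (by ring))

end Average

/-! ### Continuous operators on test functions -/

/-- The space of all test functions on `ℝ^r`. -/
abbrev TF (r : ℕ) : Type := TestFunction (⊤ : Opens (Fin r → ℝ)) ℂ (⊤ : ℕ∞)

/-- Multiplication by a complex scalar is continuous for the LF topology. -/
instance (r : ℕ) : ContinuousConstSMul ℂ (TF r) where
  continuous_const_smul c := by
    have h : (fun f : TF r => c • f) =
        TestFunction.postcompCLM (𝕜 := ℂ) (c • ContinuousLinearMap.id ℂ ℂ) := by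
      funext f
      ext t
      simp
    rw [h]
    exact ContinuousLinearMap.continuous _

section Mk

variable {r : ℕ}

theorem contDiff_of_TF (f : TF r) : ContDiff ℝ ∞ f := f.contDiff

/-- A linear operator on functions on `ℝ^r` that preserves smoothness, enlarges supports in a
controlled way and satisfies bounds on the derivatives defines a continuous linear operator on
test functions. -/
def mkOp (A : ((Fin r → ℝ) → ℂ) → (Fin r → ℝ) → ℂ)
    (hadd : ∀ f g : (Fin r → ℝ) → ℂ, ContDiff ℝ ∞ f → ContDiff ℝ ∞ g →
      ∀ x, A (f + g) x = A f x + A g x)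
    (hsmul : ∀ (c : ℂ) (f : (Fin r → ℝ) → ℂ), ContDiff ℝ ∞ f → ∀ x, A (c • f) x = c • A f x)
    (hsmooth : ∀ f : (Fin r → ℝ) → ℂ, ContDiff ℝ ∞ f → ContDiff ℝ ∞ (A f))
    (K' : Compacts (Fin r → ℝ) → Compacts (Fin r → ℝ))
    (hsupp : ∀ (K : Compacts (Fin r → ℝ)) (f : (Fin r → ℝ) → ℂ), ContDiff ℝ ∞ f →
      Set.EqOn f 0 (K : Set (Fin r → ℝ))ᶜ → Set.EqOn (A f) 0 (K' K : Set (Fin r → ℝ))ᶜ)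
    (hbound : ∀ (K : Compacts (Fin r → ℝ)) (i : ℕ), ∃ (m : ℕ) (c : ℝ), 0 ≤ c ∧
      ∀ f : (Fin r → ℝ) → ℂ, ContDiff ℝ ∞ f → ∀ B : ℝ,
        (∀ j ≤ m, ∀ x, ‖iteratedFDeriv ℝ j f x‖ ≤ B) →
        ∀ x ∈ K, ‖iteratedFDeriv ℝ i (A f) x‖ ≤ c * B) :
    TF r →L[ℂ] TF r :=
  TestFunction.limitCLM ℂ
    (fun f => ⟨A f, hsmooth f f.contDiff,
      HasCompactSupport.intro (K' ⟨tsupport f, f.hasCompactSupport⟩).isCompact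
        (hsupp ⟨tsupport f, f.hasCompactSupport⟩ f f.contDiff
          (fun _ hx => image_eq_zero_of_notMem_tsupport hx)),
      Set.subset_univ _⟩)
    (fun K _ => TestFunction.ofSupportedInCLM ℂ (Set.subset_univ (K' K : Set (Fin r → ℝ))) ∘L
      ContDiffMapSupportedIn.mkCLM ℂ (fun f => A f)
        (fun f g x => hadd f g f.contDiff g.contDiff x)
        (fun c f x => hsmul c f f.contDiff x)
        (fun f => hsmooth f f.contDiff)
        (fun f => hsupp K f f.contDiff f.zero_on_compl)
        (fun i _ => by
          obtain ⟨m, c, hc, h⟩ := hbound (K' K) i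
          refine ⟨Finset.range (m + 1), c, hc, fun f x hx => ?_⟩
          refine h f f.contDiff _ (fun j hj x => ?_) x hx
          refine (ContDiffMapSupportedIn.norm_iteratedFDeriv_apply_le_seminorm ℂ
            (by exact le_top)).trans ?_
          exact Seminorm.le_def.1 (Finset.le_sup (f := fun j =>
            ContDiffMapSupportedIn.seminorm ℂ (Fin r → ℝ) ℂ ⊤ K j)
            (Finset.mem_range.2 (Nat.lt_succ_of_le hj))) f))
    (fun _ _ _ => rfl)

end Mk

/-! ### The coefficient function `1 / (1 - e^{-2x})` -/

/-- The coefficient `C(x) = 1 / (1 - e^{-2x}) = (1 + coth x) / 2` of the Cherednik operators. -/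
def coef (x : ℝ) : ℝ := 1 / (1 - Real.exp (-2 * x))

theorem one_sub_exp_ne_zero {x : ℝ} (hx : x ≠ 0) : 1 - Real.exp (-2 * x) ≠ 0 := by
  intro h
  have : Real.exp (-2 * x) = 1 := by linarith
  rw [Real.exp_eq_one_iff] at this
  exact hx (by linarith)

theorem coef_neg {x : ℝ} (hx : x ≠ 0) : coef (-x) = 1 - coef x := by
  have h1 := one_sub_exp_ne_zero hx
  have h2 := one_sub_exp_ne_zero (neg_ne_zero.2 hx)
  have h3 : Real.exp (-2 * -x) = (Real.exp (-2 * x))⁻¹ := by rw [← Real.exp_neg]; ring_nf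
  unfold coef
  rw [h3] at h2 ⊢
  have h4 := Real.exp_ne_zero (-2 * x)
  generalize Real.exp (-2 * x) = X at *
  have h5 : X - 1 ≠ 0 := fun h => h1 (by linarith)
  field_simp
  ring

/-- The addition law of `(1 + coth) / 2`. -/
theorem coef_add {x y : ℝ} (hx : x ≠ 0) (hy : y ≠ 0) (hxy : x + y ≠ 0) :
    coef (x + y) * (coef x + coef y - 1) = coef x * coef y := by
  have h1 := one_sub_exp_ne_zero hx
  have h2 := one_sub_exp_ne_zero hy
  have h3 := one_sub_exp_ne_zero hxy
  have h4 : Real.exp (-2 * (x + y)) = Real.exp (-2 * x) * Real.exp (-2 * y) := by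
    rw [← Real.exp_add]; ring_nf
  unfold coef
  rw [h4] at h3 ⊢
  generalize Real.exp (-2 * x) = X at *
  generalize Real.exp (-2 * y) = Y at *
  field_simp
  ring

theorem coef_eq_coth {x : ℝ} (hx : x ≠ 0) : 2 * coef x = 1 + Real.cosh x / Real.sinh x := by
  have h1 := one_sub_exp_ne_zero hx
  have h2 : Real.sinh x ≠ 0 := by simpa using hx
  have h4 : Real.exp (-2 * x) = Real.exp (-x) * Real.exp (-x) := by
    rw [← Real.exp_add]; ring_nf
  have h5 : Real.exp x * Real.exp (-x) = 1 := by rw [← Real.exp_add]; simp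
  unfold coef
  rw [h4] at h1 ⊢
  rw [Real.sinh_eq] at h2 ⊢
  rw [Real.cosh_eq]
  have h6 : Real.exp x - Real.exp (-x) ≠ 0 := fun h => h2 (by rw [h]; simp)
  generalize Real.exp x = X at *
  generalize Real.exp (-x) = Y at *
  rw [← sq] at h1 ⊢
  field_simp
  linear_combination 2 * Y * h5

theorem hasDerivAt_coef {x : ℝ} (hx : x ≠ 0) :
    HasDerivAt coef (2 * coef x * (1 - coef x)) x := by
  have h1 := one_sub_exp_ne_zero hx
  have h2 : HasDerivAt (fun x : ℝ => 1 - Real.exp (-2 * x)) (2 * Real.exp (-2 * x)) x := by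
    have := ((hasDerivAt_id x).const_mul (-2)).exp.const_sub 1
    refine this.congr_deriv ?_
    simp only [id]; ring
  have h3 := h2.inv h1
  have h4 : coef = fun x : ℝ => (1 - Real.exp (-2 * x))⁻¹ := by
    funext x; simp [coef]
  have h5 : coef x = (1 - Real.exp (-2 * x))⁻¹ := by rw [h4]
  rw [h5, h4]
  refine h3.congr_deriv ?_
  generalize Real.exp (-2 * x) = X at *
  field_simp
  ring

/-- `(1 - e^{-2x}) / x` written as an average of exponentials; it has no zeros. -/
def invPsi (x : ℝ) : ℝ :=
  avg (fun _ => ContinuousLinearMap.id ℝ ℝ) (fun s => s • ContinuousLinearMap.id ℝ ℝ)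
    (fun x => 2 * Real.exp (-2 * x)) x

theorem invPsi_eq (x : ℝ) : invPsi x = ∫ s in (0 : ℝ)..1, 2 * Real.exp (-2 * (s * x)) := rfl

theorem contDiff_invPsi : ContDiff ℝ ∞ invPsi :=
  contDiff_avg (L := fun _ => ContinuousLinearMap.id ℝ ℝ)
    (A := fun s => s • ContinuousLinearMap.id ℝ ℝ) (f := fun x => 2 * Real.exp (-2 * x))
    (by fun_prop) (by fun_prop) (by fun_prop)

theorem invPsi_pos (x : ℝ) : 0 < invPsi x := by
  rw [invPsi_eq]
  exact intervalIntegral.intervalIntegral_pos_of_pos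
    (Continuous.intervalIntegrable (by fun_prop) _ _) (fun s => by positivity) one_pos

theorem mul_invPsi (x : ℝ) : x * invPsi x = 1 - Real.exp (-2 * x) := by
  rw [invPsi_eq, ← intervalIntegral.integral_const_mul]
  have h : ∀ s ∈ Set.uIcc (0 : ℝ) 1, HasDerivAt (fun s => -Real.exp (-2 * (s * x)))
      (x * (2 * Real.exp (-2 * (s * x)))) s := by
    intro s _
    have := (((hasDerivAt_id s).mul_const x).const_mul (-2)).exp.neg
    refine this.congr_deriv ?_
    simp only [id]; ring
  rw [intervalIntegral.integral_eq_sub_of_hasDerivAt h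
    (Continuous.intervalIntegrable (by fun_prop) _ _)]
  simp; ring

/-- The smooth function `x / (1 - e^{-2x})`. -/
def psi (x : ℝ) : ℝ := (invPsi x)⁻¹

theorem contDiff_psi : ContDiff ℝ ∞ psi :=
  contDiff_invPsi.inv fun x => (invPsi_pos x).ne'

theorem psi_eq {x : ℝ} (hx : x ≠ 0) : psi x = x * coef x := by
  unfold psi coef
  rw [← mul_invPsi]
  have := (invPsi_pos x).ne'
  field_simp

/-! ### Divided differences along a reflection -/

section Delta

variable {r : ℕ}

/-- The reflection `t ↦ t - ℓ(t) v`. -/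
def refl (l : (Fin r → ℝ) →L[ℝ] ℝ) (v : Fin r → ℝ) : (Fin r → ℝ) →L[ℝ] (Fin r → ℝ) :=
  ContinuousLinearMap.id ℝ _ - l.smulRight v

theorem refl_apply (l : (Fin r → ℝ) →L[ℝ] ℝ) (v t : Fin r → ℝ) :
    refl l v t = t - l t • v := by simp [refl]

theorem map_refl {l : (Fin r → ℝ) →L[ℝ] ℝ} {v : Fin r → ℝ} (h : l v = 2) (t : Fin r → ℝ) :
    l (refl l v t) = - l t := by
  rw [refl_apply, map_sub, map_smul, h, smul_eq_mul]; ring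

theorem refl_refl {l : (Fin r → ℝ) →L[ℝ] ℝ} {v : Fin r → ℝ} (h : l v = 2) (t : Fin r → ℝ) :
    refl l v (refl l v t) = t := by
  rw [refl_apply, map_refl h, refl_apply]; simp

/-- The family of linear maps joining the identity with the reflection. -/
def reflPath (l : (Fin r → ℝ) →L[ℝ] ℝ) (v : Fin r → ℝ) (s : ℝ) :
    (Fin r → ℝ) →L[ℝ] (Fin r → ℝ) :=
  ContinuousLinearMap.id ℝ _ - s • l.smulRight v

/-- The divided difference `C(ℓ(t)) (f(t) - f(t - ℓ(t) v))`, written in the form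
`ψ(ℓ(t)) ∫₀¹ (∂_v f)(t - s ℓ(t) v) ds` that makes sense and is smooth on the hyperplane `ℓ = 0`
as well. -/
def divDiffFun (l : (Fin r → ℝ) →L[ℝ] ℝ) (v : Fin r → ℝ) (f : (Fin r → ℝ) → ℂ)
    (t : Fin r → ℝ) : ℂ :=
  (psi (l t) : ℂ) * avg (fun _ => ContinuousLinearMap.apply ℝ ℂ v) (reflPath l v) (fderiv ℝ f) t

/-- The fundamental theorem of calculus along the segment from `t` to its reflection. -/
theorem avg_reflPath_mul (l : (Fin r → ℝ) →L[ℝ] ℝ) (v : Fin r → ℝ) {f : (Fin r → ℝ) → ℂ}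
    (hf : ContDiff ℝ 1 f) (t : Fin r → ℝ) :
    (l t : ℂ) * avg (fun _ => ContinuousLinearMap.apply ℝ ℂ v) (reflPath l v) (fderiv ℝ f) t =
      f t - f (refl l v t) := by
  unfold avg
  rw [← intervalIntegral.integral_const_mul]
  have hfd : Continuous (fderiv ℝ f) := hf.continuous_fderiv (by norm_num)
  have h : ∀ s ∈ Set.uIcc (0 : ℝ) 1, HasDerivAt (fun s => - f (reflPath l v s t))
      ((l t : ℂ) * (ContinuousLinearMap.apply ℝ ℂ v) (fderiv ℝ f (reflPath l v s t))) s := by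
    intro s _
    have h1 : HasDerivAt (fun s => reflPath l v s t) (-(l t • v)) s := by
      have h2 : (fun s => reflPath l v s t) = fun s => t - s • (l t • v) := by
        funext s; simp [reflPath]
      rw [h2]
      have := ((hasDerivAt_id s).smul_const (l t • v)).const_sub t
      simpa using this
    have h3 : HasFDerivAt f (fderiv ℝ f (reflPath l v s t)) (reflPath l v s t) :=
      (hf.differentiable (by norm_num) _).hasFDerivAt
    refine (h3.comp_hasDerivAt s h1).neg.congr_deriv ?_
    simp
  rw [intervalIntegral.integral_eq_sub_of_hasDerivAt h
    (Continuous.intervalIntegrable (by unfold reflPath; fun_prop) _ _)]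
  simp [reflPath, refl]
  ring

theorem divDiffFun_apply {l : (Fin r → ℝ) →L[ℝ] ℝ} (v : Fin r → ℝ) {f : (Fin r → ℝ) → ℂ}
    (hf : ContDiff ℝ 1 f) {t : Fin r → ℝ} (ht : l t ≠ 0) :
    divDiffFun l v f t = (coef (l t) : ℂ) * (f t - f (refl l v t)) := by
  rw [divDiffFun, psi_eq ht, ← avg_reflPath_mul l v hf]
  push_cast
  ring

theorem contDiff_divDiffFun (l : (Fin r → ℝ) →L[ℝ] ℝ) (v : Fin r → ℝ) {f : (Fin r → ℝ) → ℂ}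
    (hf : ContDiff ℝ ∞ f) : ContDiff ℝ ∞ (divDiffFun l v f) := by
  have h1 : ContDiff ℝ ∞ fun t => (psi (l t) : ℂ) :=
    Complex.ofRealCLM.contDiff.comp (contDiff_psi.comp l.contDiff)
  exact h1.mul (contDiff_avg (by fun_prop) (by unfold reflPath; fun_prop)
    (hf.fderiv_right (by norm_cast)))

theorem exists_bound_divDiffFun (l : (Fin r → ℝ) →L[ℝ] ℝ) (v : Fin r → ℝ)
    (K : Compacts (Fin r → ℝ)) (i : ℕ) : ∃ (m : ℕ) (c : ℝ), 0 ≤ c ∧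
      ∀ f : (Fin r → ℝ) → ℂ, ContDiff ℝ ∞ f → ∀ B : ℝ,
        (∀ j ≤ m, ∀ x, ‖iteratedFDeriv ℝ j f x‖ ≤ B) →
        ∀ x ∈ K, ‖iteratedFDeriv ℝ i (divDiffFun l v f) x‖ ≤ c * B := by
  have h1 : ContDiff ℝ ∞ fun t => (psi (l t) : ℂ) :=
    Complex.ofRealCLM.contDiff.comp (contDiff_psi.comp l.contDiff)
  have h2 : ∀ j : ℕ, ∃ C, 0 ≤ C ∧ ∀ x ∈ K,
      ‖iteratedFDeriv ℝ j (fun t => (psi (l t) : ℂ)) x‖ ≤ C := by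
    intro j
    obtain ⟨C, hC⟩ := K.isCompact.exists_bound_of_continuousOn
      (h1.continuous_iteratedFDeriv (m := j) (by exact_mod_cast le_top)).continuousOn
    exact ⟨max C 0, le_max_right _ _, fun x hx => (hC x hx).trans (le_max_left _ _)⟩
  choose C hC0 hC using h2
  set M : ℝ := ‖ContinuousLinearMap.id ℝ (Fin r → ℝ)‖ + ‖l.smulRight v‖ with hM
  have hM0 : 0 ≤ M := by positivity
  have hA : ∀ s ∈ Set.Icc (0 : ℝ) 1, ‖reflPath l v s‖ ≤ M := by
    intro s hs
    refine (norm_sub_le _ _).trans ?_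
    rw [hM]
    refine add_le_add le_rfl ?_
    rw [norm_smul, Real.norm_of_nonneg hs.1]
    exact mul_le_of_le_one_left (norm_nonneg _) hs.2
  set N : ℝ := ‖(ContinuousLinearMap.apply ℝ ℂ v : ((Fin r → ℝ) →L[ℝ] ℂ) →L[ℝ] ℂ)‖ with hN
  have hN0 : 0 ≤ N := by rw [hN]; positivity
  refine ⟨i + 1, ∑ j ∈ Finset.range (i + 1), (i.choose j : ℝ) * C j * (N * M ^ (i - j)),
    Finset.sum_nonneg fun j _ => by have := hC0 j; positivity, fun f hf B hB x hx => ?_⟩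
  have h3 : ContDiff ℝ ∞ (avg (fun _ => ContinuousLinearMap.apply ℝ ℂ v) (reflPath l v)
      (fderiv ℝ f)) :=
    contDiff_avg (by fun_prop) (by unfold reflPath; fun_prop) (hf.fderiv_right (by norm_cast))
  have h4 := norm_iteratedFDeriv_mul_le (n := i) (N := ∞) h1 h3 x (by exact_mod_cast le_top)
  refine h4.trans ?_
  rw [Finset.sum_mul]
  refine Finset.sum_le_sum fun j hj => ?_
  have hj' : j ≤ i := Nat.lt_succ_iff.1 (Finset.mem_range.1 hj)
  have h5 := norm_iteratedFDeriv_avg_le (i - j)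
    (L := fun _ => ContinuousLinearMap.apply ℝ ℂ v) (A := reflPath l v) (f := fderiv ℝ f)
    (by fun_prop) (by unfold reflPath; fun_prop) (hf.fderiv_right (by norm_cast)) (c := N) (M := M)
    (B := B) (fun _ _ => le_rfl) hA
    (fun x => by rw [norm_iteratedFDeriv_fderiv]; exact hB _ (by omega) x) x
  have h6 := hC j x hx
  have := hC0 j
  calc _ ≤ (i.choose j : ℝ) * C j * (N * M ^ (i - j) * B) := by gcongr
    _ = _ := by ring

/-- The divided difference operator attached to a linear form `ℓ` and a vector `v` with
`ℓ(v) = 2`, as a continuous operator on test functions. -/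
def divDiff (l : (Fin r → ℝ) →L[ℝ] ℝ) (v : Fin r → ℝ) (h : l v = 2) : TF r →L[ℂ] TF r :=
  mkOp (divDiffFun l v)
    (fun f g hf hg x => by
      have hd : fderiv ℝ (f + g) = fun x => fderiv ℝ f x + fderiv ℝ g x := by
        funext y
        exact fderiv_add (hf.differentiable (by norm_num) y) (hg.differentiable (by norm_num) y)
      have h1 : Continuous (fderiv ℝ f) := hf.continuous_fderiv (by norm_num)
      have h2 : Continuous (fderiv ℝ g) := hg.continuous_fderiv (by norm_num)
      unfold divDiffFun avg
      rw [hd, ← mul_add, ← intervalIntegral.integral_add]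
      · simp
      · exact Continuous.intervalIntegrable (by unfold reflPath; fun_prop) _ _
      · exact Continuous.intervalIntegrable (by unfold reflPath; fun_prop) _ _)
    (fun c f hf x => by
      have hd : fderiv ℝ (c • f) = fun x => c • fderiv ℝ f x := by
        funext y
        exact fderiv_const_smul (hf.differentiable (by norm_num) y) c
      unfold divDiffFun avg
      rw [hd, smul_eq_mul, mul_left_comm, ← intervalIntegral.integral_const_mul]
      simp)
    (fun f hf => contDiff_divDiffFun l v hf)
    (fun K => K ⊔ K.map (refl l v) (refl l v).continuous)
    (fun K f hf hK x hx => by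
      have hx1 : x ∉ K := fun h' => hx (Or.inl h')
      have hx2 : refl l v x ∉ K := fun h' => hx (Or.inr ⟨_, h', refl_refl h x⟩)
      have hf1 : ContDiff ℝ 1 f := hf.of_le (by norm_cast)
      by_cases hl : l x = 0
      -- at a fixed point of the reflection, the average is the derivative at the point
      · have h0 : fderiv ℝ f x = 0 := by
          have : f =ᶠ[nhds x] fun _ => 0 := by
            filter_upwards [K.isCompact.isClosed.isOpen_compl.mem_nhds hx1] with y hy
            exact hK hy
          rw [this.fderiv_eq]
          simp
        have h2 : ∀ s, reflPath l v s x = x := fun s => by simp [reflPath, hl]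
        simp [divDiffFun, avg, h2, h0]
      · rw [divDiffFun_apply v hf1 hl, hK hx1, hK hx2]
        simp)
    (fun K i => exists_bound_divDiffFun l v K i)

theorem divDiff_apply {l : (Fin r → ℝ) →L[ℝ] ℝ} {v : Fin r → ℝ} (h : l v = 2) (f : TF r)
    {t : Fin r → ℝ} (ht : l t ≠ 0) :
    divDiff l v h f t = (coef (l t) : ℂ) * (f t - f (refl l v t)) :=
  divDiffFun_apply v (f.contDiff.of_le (by norm_cast)) ht

/-- Composition with a linear automorphism, as a continuous operator on test functions. -/
def compOp (w : (Fin r → ℝ) ≃L[ℝ] (Fin r → ℝ)) : TF r →L[ℂ] TF r :=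
  mkOp (fun f => f ∘ w) (fun _ _ _ _ _ => rfl) (fun _ _ _ _ => rfl)
    (fun f hf => hf.comp w.contDiff)
    (fun K => K.map w.symm w.symm.continuous)
    (fun K f _ hK x hx => hK fun h => hx ⟨_, h, by simp⟩)
    (fun K i => by
      refine ⟨i, ‖(w : (Fin r → ℝ) →L[ℝ] (Fin r → ℝ))‖ ^ i, by positivity,
        fun f hf B hB x _ => ?_⟩
      have h := norm_iteratedFDeriv_avg_le i (L := fun _ => ContinuousLinearMap.id ℝ ℂ)
        (A := fun _ => (w : (Fin r → ℝ) →L[ℝ] (Fin r → ℝ))) (f := f) (by fun_prop) (by fun_prop)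
        hf (c := 1) (B := B) (fun _ _ => ContinuousLinearMap.norm_id_le) (fun _ _ => le_rfl)
        (hB i le_rfl) x
      have h2 : avg (fun _ => ContinuousLinearMap.id ℝ ℂ)
          (fun _ => (w : (Fin r → ℝ) →L[ℝ] (Fin r → ℝ))) f = f ∘ w := by
        funext t
        simp [avg]
      rw [h2, one_mul] at h
      exact h)

theorem compOp_apply (w : (Fin r → ℝ) ≃L[ℝ] (Fin r → ℝ)) (f : TF r) (t : Fin r → ℝ) :
    compOp w f t = f (w t) := rfl

end Delta

/-! ### Commutation of the elementary operators -/

section Elementary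

variable {r : ℕ}

/-- The coordinate form `ξ_i^*`. -/
abbrev coord (i : Fin r) : (Fin r → ℝ) →L[ℝ] ℝ :=
  ContinuousLinearMap.proj (R := ℝ) (φ := fun _ : Fin r => ℝ) i

theorem dense_ne_zero {l : (Fin r → ℝ) →L[ℝ] ℝ} {v : Fin r → ℝ} (h : l v = 2) :
    Dense {t | l t ≠ 0} := by
  have h1 : interior ((LinearMap.ker (l : (Fin r → ℝ) →ₗ[ℝ] ℝ) : Submodule ℝ (Fin r → ℝ)) :
      Set (Fin r → ℝ)) = ∅ := by
    by_contra hne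
    have := Submodule.eq_top_of_nonempty_interior' (R := ℝ)
      (LinearMap.ker (l : (Fin r → ℝ) →ₗ[ℝ] ℝ)) (Set.nonempty_iff_ne_empty.2 hne)
    have hv : v ∈ LinearMap.ker (l : (Fin r → ℝ) →ₗ[ℝ] ℝ) := by rw [this]; trivial
    simp only [LinearMap.mem_ker, ContinuousLinearMap.coe_coe] at hv
    rw [h] at hv
    norm_num at hv
  rw [interior_eq_empty_iff_dense_compl] at h1
  convert h1 using 1
  ext t
  simp

theorem isOpen_ne_zero (l : (Fin r → ℝ) →L[ℝ] ℝ) : IsOpen {t | l t ≠ 0} :=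
  isOpen_ne_fun l.continuous continuous_const

/-- Operators on test functions that agree on a dense set of points are equal. -/
theorem op_ext {S T : TF r →L[ℂ] TF r} {s : Set (Fin r → ℝ)} (hs : Dense s)
    (h : ∀ f, ∀ t ∈ s, S f t = T f t) : S = T := by
  ext f t
  exact congrFun (Continuous.ext_on hs (S f).continuous (T f).continuous (h f)) t

theorem op_comm_ext {S T : TF r →L[ℂ] TF r} {s : Set (Fin r → ℝ)} (hs : Dense s)
    (h : ∀ f, ∀ t ∈ s, S (T f) t = T (S f) t) : Commute S T :=
  op_ext hs h

/-- The derivative in the direction `w`. -/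
def dirOp (w : Fin r → ℝ) : TF r →L[ℂ] TF r := TestFunction.lineDerivCLM ℂ w

theorem dirOp_apply (w : Fin r → ℝ) (f : TF r) (t : Fin r → ℝ) :
    dirOp w f t = fderiv ℝ f t w := by
  unfold dirOp
  rw [TestFunction.lineDerivCLM_apply]
  have : DifferentiableAt ℝ f t := (contDiff_of_TF f).differentiable (by norm_num) t
  simp [this.lineDeriv_eq_fderiv]

theorem commute_dirOp (w w' : Fin r → ℝ) : Commute (dirOp w) (dirOp w') := by
  refine op_comm_ext dense_univ fun f t _ => ?_
  have h : ∀ (u u' : Fin r → ℝ), dirOp u (dirOp u' f) t = fderiv ℝ (fderiv ℝ f) t u u' := by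
    intro u u'
    rw [dirOp_apply]
    have h1 : (dirOp u' f : (Fin r → ℝ) → ℂ) = fun t => fderiv ℝ f t u' :=
      funext fun t => dirOp_apply u' f t
    have h2 : DifferentiableAt ℝ (fderiv ℝ f) t :=
      ((contDiff_of_TF f).fderiv_right (m := 1) (by norm_cast)).differentiable (by norm_num) t
    rw [h1, (h2.hasFDerivAt.clm_apply (hasFDerivAt_const u' t)).fderiv]
    simp
  rw [h, h]
  exact (((contDiff_of_TF f).contDiffAt).isSymmSndFDerivAt
    (by simp only [minSmoothness_of_isRCLikeNormedField]; norm_cast)) w w'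

theorem dirOp_divDiff_apply {l : (Fin r → ℝ) →L[ℝ] ℝ} {v : Fin r → ℝ} (h : l v = 2)
    (w : Fin r → ℝ) (f : TF r) {t : Fin r → ℝ} (ht : l t ≠ 0) :
    dirOp w (divDiff l v h f) t =
      2 * (coef (l t) : ℂ) * (1 - coef (l t)) * l w * (f t - f (refl l v t)) +
      coef (l t) * (dirOp w f t - dirOp (refl l v w) f (refl l v t)) := by
  rw [dirOp_apply, dirOp_apply, dirOp_apply]
  have h1 : (divDiff l v h f : (Fin r → ℝ) → ℂ) =ᶠ[nhds t]
      fun t => (coef (l t) : ℂ) * (f t - f (refl l v t)) := by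
    filter_upwards [l.continuous.continuousAt.eventually_ne ht] with y hy
    exact divDiff_apply h f hy
  have h2 : HasFDerivAt (fun t => coef (l t)) ((2 * coef (l t) * (1 - coef (l t))) • l) t :=
    (hasDerivAt_coef ht).comp_hasFDerivAt t l.hasFDerivAt
  have h3 : HasFDerivAt (fun t => (coef (l t) : ℂ))
      (Complex.ofRealCLM ∘L ((2 * coef (l t) * (1 - coef (l t))) • l)) t :=
    Complex.ofRealCLM.hasFDerivAt.comp t h2
  have hf : Differentiable ℝ f := (contDiff_of_TF f).differentiable (by norm_num)
  have h4 : HasFDerivAt (fun t => f t - f (refl l v t))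
      (fderiv ℝ f t - fderiv ℝ f (refl l v t) ∘L refl l v) t :=
    (hf t).hasFDerivAt.sub ((hf _).hasFDerivAt.comp t (refl l v).hasFDerivAt)
  have h5 := (h3.mul h4).fderiv
  simp only [Pi.mul_def] at h5
  rw [h1.fderiv_eq, h5]
  simp
  ring

/-- The divided difference operator of the pair `(ℓ, v)`, with value `0` if `ℓ(v) ≠ 2`. -/
def dd (l : (Fin r → ℝ) →L[ℝ] ℝ) (v : Fin r → ℝ) : TF r →L[ℂ] TF r :=
  open scoped Classical in if h : l v = 2 then divDiff l v h else 0

theorem dd_apply {l : (Fin r → ℝ) →L[ℝ] ℝ} {v : Fin r → ℝ} (h : l v = 2) (f : TF r)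
    {t : Fin r → ℝ} (ht : l t ≠ 0) :
    dd l v f t = (coef (l t) : ℂ) * (f t - f (refl l v t)) := by
  rw [dd, dif_pos h, divDiff_apply h f ht]

theorem commute_dirOp_dd {l : (Fin r → ℝ) →L[ℝ] ℝ} {v w : Fin r → ℝ} (h : l v = 2)
    (hw : l w = 0) : Commute (dirOp w) (dd l v) := by
  refine op_comm_ext (dense_ne_zero h) fun f t ht => ?_
  have h1 : refl l v w = w := by simp [refl_apply, hw]
  rw [dd_apply h _ ht, dd, dif_pos h, dirOp_divDiff_apply h w f ht, h1, hw]
  simp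

theorem commute_dd_dd {l l' : (Fin r → ℝ) →L[ℝ] ℝ} {v v' : Fin r → ℝ} (h : l v = 2)
    (h' : l' v' = 2) (h1 : l v' = 0) (h2 : l' v = 0) : Commute (dd l v) (dd l' v') := by
  refine op_comm_ext ((dense_ne_zero h).inter_of_isOpen_left (dense_ne_zero h')
    (isOpen_ne_zero l)) fun f t ht => ?_
  obtain ⟨ht1, ht2⟩ := ht
  have e1 : l (refl l' v' t) = l t := by simp [refl_apply, h1]
  have e2 : l' (refl l v t) = l' t := by simp [refl_apply, h2]
  have e3 : refl l v (refl l' v' t) = refl l' v' (refl l v t) := by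
    rw [refl_apply l v (refl l' v' t), refl_apply l' v' (refl l v t), e1, e2, refl_apply,
      refl_apply]
    abel
  have e4 : l (refl l' v' t) ≠ 0 := by rw [e1]; exact ht1
  have e5 : l' (refl l v t) ≠ 0 := by rw [e2]; exact ht2
  rw [dd_apply h _ ht1, dd_apply h' _ ht2, dd_apply h' _ ht2, dd_apply h _ ht1, dd_apply h' _ e5,
    dd_apply h _ e4, e1, e2, e3]
  ring

/-- The divided difference operator of the root `ξ_i - ξ_j`. -/
def dm (i j : Fin r) : TF r →L[ℂ] TF r :=
  dd (coord i - coord j) (Pi.single i 1 - Pi.single j 1)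

/-- The divided difference operator of the root `ξ_i + ξ_j`. -/
def dp (i j : Fin r) : TF r →L[ℂ] TF r :=
  dd (coord i + coord j) (Pi.single i 1 + Pi.single j 1)

/-- The divided difference operator of the root `ξ_i`. -/
def ds (i : Fin r) : TF r →L[ℂ] TF r :=
  dd (coord i) ((2 : ℝ) • Pi.single i 1)

/-- The divided difference operator of the root `2ξ_i`. -/
def dl (i : Fin r) : TF r →L[ℂ] TF r :=
  dd ((2 : ℝ) • coord i) (Pi.single i 1)

theorem refl_minus {i j : Fin r} (h : i ≠ j) (t : Fin r → ℝ) :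
    refl (coord i - coord j)
      (Pi.single i 1 - Pi.single j 1) t = reflSwap i j t := by
  funext k
  by_cases h1 : k = i
  · subst h1
    simp [refl_apply, reflSwap, h]
  · by_cases h2 : k = j
    · subst h2
      simp [refl_apply, reflSwap, h1]
    · simp [refl_apply, reflSwap, h1, h2, Equiv.swap_apply_of_ne_of_ne]

theorem refl_plus {i j : Fin r} (h : i ≠ j) (t : Fin r → ℝ) :
    refl (coord i + coord j)
      (Pi.single i 1 + Pi.single j 1) t = reflSignedSwap i j t := by
  funext k
  by_cases h1 : k = i
  · subst h1
    simp [refl_apply, reflSignedSwap, h]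
  · by_cases h2 : k = j
    · subst h2
      simp [refl_apply, reflSignedSwap, h1]
    · simp [refl_apply, reflSignedSwap, h1, h2]

theorem refl_short (i : Fin r) (t : Fin r → ℝ) :
    refl (coord i) ((2 : ℝ) • Pi.single i 1) t = reflSign i t := by
  funext k
  by_cases h1 : k = i
  · subst h1
    simp [refl_apply, reflSign]; ring
  · simp [refl_apply, reflSign, h1]

theorem refl_long (i : Fin r) (t : Fin r → ℝ) :
    refl ((2 : ℝ) • coord i) (Pi.single i 1) t = reflSign i t := by
  funext k
  by_cases h1 : k = i
  · subst h1
    simp [refl_apply, reflSign]; ring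
  · simp [refl_apply, reflSign, h1]

theorem minus_coroot {i j : Fin r} (h : i ≠ j) :
    (coord i - coord j : (Fin r → ℝ) →L[ℝ] ℝ)
      (Pi.single i 1 - Pi.single j 1) = 2 := by
  simp [h, h.symm]; norm_num

theorem plus_coroot {i j : Fin r} (h : i ≠ j) :
    (coord i + coord j : (Fin r → ℝ) →L[ℝ] ℝ)
      (Pi.single i 1 + Pi.single j 1) = 2 := by
  simp [h, h.symm]; norm_num

theorem short_coroot (i : Fin r) :
    (coord i : (Fin r → ℝ) →L[ℝ] ℝ) ((2 : ℝ) • Pi.single i 1) = 2 := by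
  simp

theorem long_coroot (i : Fin r) :
    ((2 : ℝ) • coord i : (Fin r → ℝ) →L[ℝ] ℝ) (Pi.single i 1) = 2 := by
  simp

theorem dm_apply {i j : Fin r} (h : i ≠ j) (f : TF r) {t : Fin r → ℝ} (ht : t i ≠ t j) :
    dm i j f t = (coef (t i - t j) : ℂ) * (f t - f (reflSwap i j t)) := by
  rw [dm, dd_apply (minus_coroot h) f (by simpa [sub_eq_zero] using ht), refl_minus h]
  simp

theorem dp_apply {i j : Fin r} (h : i ≠ j) (f : TF r) {t : Fin r → ℝ} (ht : t i ≠ -t j) :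
    dp i j f t = (coef (t i + t j) : ℂ) * (f t - f (reflSignedSwap i j t)) := by
  rw [dp, dd_apply (plus_coroot h) f (by simpa [add_eq_zero_iff_eq_neg] using ht), refl_plus h]
  simp

theorem ds_apply (i : Fin r) (f : TF r) {t : Fin r → ℝ} (ht : t i ≠ 0) :
    ds i f t = (coef (t i) : ℂ) * (f t - f (reflSign i t)) := by
  rw [ds, dd_apply (short_coroot i) f (by simpa using ht), refl_short]
  simp

theorem dl_apply (i : Fin r) (f : TF r) {t : Fin r → ℝ} (ht : t i ≠ 0) :
    dl i f t = (coef (2 * t i) : ℂ) * (f t - f (reflSign i t)) := by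
  rw [dl, dd_apply (long_coroot i) f (by simpa using ht), refl_long]
  simp

theorem isOpen_regularSet (r : ℕ) : IsOpen (regularSet r) := by
  have : regularSet r = (⋂ i, {t | t i ≠ 0}) ∩
      ⋂ i, ⋂ j, {t : Fin r → ℝ | i ≠ j → t i ≠ t j ∧ t i ≠ -t j} := by
    ext t; simp [regularSet]
  rw [this]
  refine (isOpen_iInter_of_finite fun i => isOpen_ne_fun (continuous_apply i)
    continuous_const).inter (isOpen_iInter_of_finite fun i => isOpen_iInter_of_finite fun j => ?_)
  by_cases h : i = j
  · simp [h]
  · simp only [ne_eq, h, not_false_eq_true, forall_const]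
    exact (isOpen_ne_fun (continuous_apply i) (continuous_apply j)).inter
      (isOpen_ne_fun (continuous_apply i) (continuous_apply j).neg)

theorem dense_regularSet (r : ℕ) : Dense (regularSet r) := by
  have : regularSet r = (⋂ i, {t | t i ≠ 0}) ∩
      ⋂ p : Fin r × Fin r, {t : Fin r → ℝ | p.1 ≠ p.2 → t p.1 ≠ t p.2 ∧ t p.1 ≠ -t p.2} := by
    ext t; simp [regularSet]
  rw [this]
  have o1 : IsOpen (⋂ i, {t : Fin r → ℝ | t i ≠ 0}) := isOpen_iInter_of_finite fun i =>
    isOpen_ne_fun (f := fun t : Fin r → ℝ => t i) (continuous_apply i) continuous_const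
  refine Dense.inter_of_isOpen_left ?_ ?_ o1
  · refine dense_iInter_of_isOpen (fun i => ?_) fun i => ?_
    · simpa using isOpen_ne_zero (coord i)
    · simpa using dense_ne_zero (short_coroot i)
  · refine dense_iInter_of_isOpen (fun p => ?_) fun p => ?_
    · by_cases h : p.1 = p.2
      · simp [h]
      · simp only [ne_eq, h, not_false_eq_true, forall_const]
        exact (isOpen_ne_fun (continuous_apply p.1) (continuous_apply p.2)).inter
          (isOpen_ne_fun (continuous_apply p.1) (continuous_apply p.2).neg)
    · by_cases h : p.1 = p.2
      · simp [h]
      · simp only [ne_eq, h, not_false_eq_true, forall_const]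
        have h1 := dense_ne_zero (minus_coroot h)
        have h2 := dense_ne_zero (plus_coroot h)
        have := h1.inter_of_isOpen_left h2 (isOpen_ne_zero _)
        convert this using 1
        ext t
        simp [sub_eq_zero, add_eq_zero_iff_eq_neg]

end Elementary

/-! ### The relations of the root systems of rank two and three -/

section Rank

variable {r : ℕ}

/-- The point `t` with its coordinates `i`, `j`, `k` replaced by `x`, `y`, `z`. -/
def pt (i j k : Fin r) (t : Fin r → ℝ) (x y z : ℝ) : Fin r → ℝ :=
  fun m => if m = i then x else if m = j then y else if m = k then z else t m

set_option linter.unusedSectionVars false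
set_option linter.unusedSimpArgs false

theorem pt_self (i j k : Fin r) (t : Fin r → ℝ) : pt i j k t (t i) (t j) (t k) = t := by
  funext m
  unfold pt
  split_ifs with h1 h2 h3 <;> simp [*]

section

variable {i j k : Fin r} (hij : i ≠ j) (hik : i ≠ k) (hjk : j ≠ k) (t : Fin r → ℝ) (x y z : ℝ)
include hij hik hjk

theorem pt_fst : pt i j k t x y z i = x := by simp [pt]
theorem pt_snd : pt i j k t x y z j = y := by simp [pt, hij.symm]
theorem pt_trd : pt i j k t x y z k = z := by simp [pt, hik.symm, hjk.symm]

theorem reflSwap_pt12 : reflSwap i j (pt i j k t x y z) = pt i j k t y x z := by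
  funext m
  simp only [reflSwap, pt, Equiv.swap_apply_def]
  split_ifs <;> simp_all

theorem reflSwap_pt13 : reflSwap i k (pt i j k t x y z) = pt i j k t z y x := by
  funext m
  simp only [reflSwap, pt, Equiv.swap_apply_def]
  split_ifs <;> simp_all

theorem reflSwap_pt23 : reflSwap j k (pt i j k t x y z) = pt i j k t x z y := by
  funext m
  simp only [reflSwap, pt, Equiv.swap_apply_def]
  split_ifs <;> simp_all

theorem reflSignedSwap_pt12 : reflSignedSwap i j (pt i j k t x y z) = pt i j k t (-y) (-x) z := by
  funext m
  simp only [reflSignedSwap, pt]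
  split_ifs <;> simp_all

theorem reflSignedSwap_pt13 : reflSignedSwap i k (pt i j k t x y z) = pt i j k t (-z) y (-x) := by
  funext m
  simp only [reflSignedSwap, pt]
  split_ifs <;> simp_all

theorem reflSignedSwap_pt23 : reflSignedSwap j k (pt i j k t x y z) = pt i j k t x (-z) (-y) := by
  funext m
  simp only [reflSignedSwap, pt]
  split_ifs <;> simp_all

theorem dm_pt12 (f : TF r) (h : x ≠ y) : dm i j f (pt i j k t x y z) =
    (coef (x - y) : ℂ) * (f (pt i j k t x y z) - f (pt i j k t y x z)) := by
  have h1 := pt_fst hij hik hjk t x y z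
  have h2 := pt_snd hij hik hjk t x y z
  rw [dm_apply hij f (by rw [h1, h2]; exact h), reflSwap_pt12 hij hik hjk, h1, h2]

theorem dm_pt13 (f : TF r) (h : x ≠ z) : dm i k f (pt i j k t x y z) =
    (coef (x - z) : ℂ) * (f (pt i j k t x y z) - f (pt i j k t z y x)) := by
  have h1 := pt_fst hij hik hjk t x y z
  have h2 := pt_trd hij hik hjk t x y z
  rw [dm_apply hik f (by rw [h1, h2]; exact h), reflSwap_pt13 hij hik hjk, h1, h2]

theorem dm_pt23 (f : TF r) (h : y ≠ z) : dm j k f (pt i j k t x y z) =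
    (coef (y - z) : ℂ) * (f (pt i j k t x y z) - f (pt i j k t x z y)) := by
  have h1 := pt_snd hij hik hjk t x y z
  have h2 := pt_trd hij hik hjk t x y z
  rw [dm_apply hjk f (by rw [h1, h2]; exact h), reflSwap_pt23 hij hik hjk, h1, h2]

theorem dp_pt12 (f : TF r) (h : x ≠ -y) : dp i j f (pt i j k t x y z) =
    (coef (x + y) : ℂ) * (f (pt i j k t x y z) - f (pt i j k t (-y) (-x) z)) := by
  have h1 := pt_fst hij hik hjk t x y z
  have h2 := pt_snd hij hik hjk t x y z
  rw [dp_apply hij f (by rw [h1, h2]; exact h), reflSignedSwap_pt12 hij hik hjk, h1, h2]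

theorem dp_pt13 (f : TF r) (h : x ≠ -z) : dp i k f (pt i j k t x y z) =
    (coef (x + z) : ℂ) * (f (pt i j k t x y z) - f (pt i j k t (-z) y (-x))) := by
  have h1 := pt_fst hij hik hjk t x y z
  have h2 := pt_trd hij hik hjk t x y z
  rw [dp_apply hik f (by rw [h1, h2]; exact h), reflSignedSwap_pt13 hij hik hjk, h1, h2]

theorem dp_pt23 (f : TF r) (h : y ≠ -z) : dp j k f (pt i j k t x y z) =
    (coef (y + z) : ℂ) * (f (pt i j k t x y z) - f (pt i j k t x (-z) (-y))) := by
  have h1 := pt_snd hij hik hjk t x y z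
  have h2 := pt_trd hij hik hjk t x y z
  rw [dp_apply hjk f (by rw [h1, h2]; exact h), reflSignedSwap_pt23 hij hik hjk, h1, h2]

end

/-- The values of the coefficient at the combinations `±x ± y` in terms of those at `x ± y`. -/
theorem coef_signs {x y : ℝ} (h : x ≠ y) (h' : x ≠ -y) :
    coef (y - x) = 1 - coef (x - y) ∧ coef (-x - y) = 1 - coef (x + y) ∧
    coef (-y - x) = 1 - coef (x + y) ∧ coef (-x + y) = 1 - coef (x - y) ∧
    coef (-y + x) = coef (x - y) ∧ coef (x + -y) = coef (x - y) ∧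
    coef (y + -x) = 1 - coef (x - y) ∧ coef (-x + -y) = 1 - coef (x + y) ∧
    coef (-y + -x) = 1 - coef (x + y) ∧ coef (y + x) = coef (x + y) := by
  have h1 := coef_neg (sub_ne_zero.2 h)
  have h2 := coef_neg (fun h0 => h' (add_eq_zero_iff_eq_neg.1 h0) : x + y ≠ 0)
  refine ⟨?_, ?_, ?_, ?_, ?_, ?_, ?_, ?_, ?_, ?_⟩
  · rw [← h1]; ring_nf
  · rw [← h2]; ring_nf
  · rw [← h2]; ring_nf
  · rw [← h1]; ring_nf
  · ring_nf
  · ring_nf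
  · rw [← h1]; ring_nf
  · rw [← h2]; ring_nf
  · rw [← h2]; ring_nf
  · ring_nf

/-- The three-term relations among the coefficients at `±x ± y`, `±y ± z`, `±x ± z`. -/
theorem coef_three {x y z : ℝ} (hxy : x ≠ y) (hxy' : x ≠ -y) (hyz : y ≠ z) (hyz' : y ≠ -z)
    (hxz : x ≠ z) (hxz' : x ≠ -z) :
    (coef (x - z) * (coef (x - y) + coef (y - z) - 1) = coef (x - y) * coef (y - z)) ∧
    (coef (x - z) * (coef (x + y) - coef (y + z)) = coef (x + y) * (1 - coef (y + z))) ∧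
    (coef (x + z) * (coef (x - y) + coef (y + z) - 1) = coef (x - y) * coef (y + z)) ∧
    (coef (x + z) * (coef (x + y) - coef (y - z)) = coef (x + y) * (1 - coef (y - z))) := by
  have key : ∀ {u v w : ℝ}, u ≠ 0 → v ≠ 0 → w ≠ 0 → u + v = w →
      coef w * (coef u + coef v - 1) = coef u * coef v := by
    intro u v w hu hv hw h
    subst h
    exact coef_add hu hv hw
  have e1 : x - y ≠ 0 := sub_ne_zero.2 hxy
  have e2 : x + y ≠ 0 := fun h0 => hxy' (add_eq_zero_iff_eq_neg.1 h0)
  have e3 : y - z ≠ 0 := sub_ne_zero.2 hyz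
  have e4 : y + z ≠ 0 := fun h0 => hyz' (add_eq_zero_iff_eq_neg.1 h0)
  have e5 : x - z ≠ 0 := sub_ne_zero.2 hxz
  have e6 : x + z ≠ 0 := fun h0 => hxz' (add_eq_zero_iff_eq_neg.1 h0)
  have n3 := coef_neg e3
  have n4 := coef_neg e4
  refine ⟨key e1 e3 e5 (by ring), ?_, key e1 e4 e6 (by ring), ?_⟩
  · have := key e2 (neg_ne_zero.2 e4) e5 (by ring)
    rw [n4] at this
    linear_combination this
  · have := key e2 (neg_ne_zero.2 e3) e6 (by ring)
    rw [n3] at this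
    linear_combination this

theorem exists_pt {i j k : Fin r} (hij : i ≠ j) (hik : i ≠ k) (hjk : j ≠ k) {t : Fin r → ℝ}
    (ht : t ∈ regularSet r) : ∃ x y z : ℝ, t = pt i j k t x y z ∧ x ≠ y ∧ x ≠ -y ∧ y ≠ z ∧
      y ≠ -z ∧ x ≠ z ∧ x ≠ -z ∧ x ≠ 0 ∧ y ≠ 0 ∧ z ≠ 0 :=
  ⟨t i, t j, t k, (pt_self i j k t).symm, (ht.2 i j hij).1, (ht.2 i j hij).2, (ht.2 j k hjk).1,
    (ht.2 j k hjk).2, (ht.2 i k hik).1, (ht.2 i k hik).2, ht.1 i, ht.1 j, ht.1 k⟩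

theorem neg_side {x y : ℝ} (h : x ≠ -y) : -x ≠ y := fun h0 => h (by rw [← h0, neg_neg])

/-- All the inequalities between `±x` and `±y`. -/
theorem ne_signs {x y : ℝ} (h : x ≠ y) (h' : x ≠ -y) :
    y ≠ x ∧ -x ≠ y ∧ y ≠ -x ∧ -y ≠ x ∧ -x ≠ -y ∧ -y ≠ -x :=
  ⟨h.symm, neg_side h', (neg_side h').symm, h'.symm, fun h0 => h (neg_injective h0),
    fun h0 => h (neg_injective h0).symm⟩

section

variable {p q m : Fin r} (hpq : p ≠ q) (hpm : p ≠ m) (hqm : q ≠ m)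
include hpq hpm hqm

/-- The relations of the root systems `A_3 = D_3`, for the three possible orders of the indices. -/
theorem rank_three :
    (⁅dm p q + dp p q, dm q m + dp q m⁆ + ⁅dm p m + dp p m, dp p q - dm p q⁆ +
      ⁅dm p m + dp p m, dm q m + dp q m⁆ = 0) ∧
    (⁅dm p m + dp p m, dp q m - dm q m⁆ + ⁅dm p q + dp p q, dp p m - dm p m⁆ +
      ⁅dm p q + dp p q, dp q m - dm q m⁆ = 0) ∧
    (⁅dm q m + dp q m, dp p m - dm p m⁆ + ⁅dp p q - dm p q, dp q m - dm q m⁆ +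
      ⁅dp p q - dm p q, dp p m - dm p m⁆ = 0) := by
  have key : ∀ f : TF r, ∀ t ∈ regularSet r,
      ((⁅dm p q + dp p q, dm q m + dp q m⁆ + ⁅dm p m + dp p m, dp p q - dm p q⁆ +
        ⁅dm p m + dp p m, dm q m + dp q m⁆) f t = 0) ∧
      ((⁅dm p m + dp p m, dp q m - dm q m⁆ + ⁅dm p q + dp p q, dp p m - dm p m⁆ +
        ⁅dm p q + dp p q, dp q m - dm q m⁆) f t = 0) ∧
      ((⁅dm q m + dp q m, dp p m - dm p m⁆ + ⁅dp p q - dm p q, dp q m - dm q m⁆ +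
        ⁅dp p q - dm p q, dp p m - dm p m⁆) f t = 0) := by
    intro f t ht
    obtain ⟨x, y, z, hxyz, hxy, hxy', hyz, hyz', hxz, hxz', -, -, -⟩ := exists_pt hpq hpm hqm ht
    rw [hxyz]
    obtain ⟨a1, a2, a3, a4, a5, a6⟩ := ne_signs hxy hxy'
    obtain ⟨b1, b2, b3, b4, b5, b6⟩ := ne_signs hyz hyz'
    obtain ⟨c1, c2, c3, c4, c5, c6⟩ := ne_signs hxz hxz'
    obtain ⟨r1, r2, r3, r4⟩ := coef_three hxy hxy' hyz hyz' hxz hxz'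
    obtain ⟨d1, d2, d3, d4, d5, d6, d7, d8, d9, d10⟩ := coef_signs hxy hxy'
    obtain ⟨e1, e2, e3, e4, e5, e6, e7, e8, e9, e10⟩ := coef_signs hyz hyz'
    obtain ⟨g1, g2, g3, g4, g5, g6, g7, g8, g9, g10⟩ := coef_signs hxz hxz'
    replace r1 := congrArg (fun u : ℝ => (u : ℂ)) r1
    replace r2 := congrArg (fun u : ℝ => (u : ℂ)) r2
    replace r3 := congrArg (fun u : ℝ => (u : ℂ)) r3
    replace r4 := congrArg (fun u : ℝ => (u : ℂ)) r4
    push_cast at r1 r2 r3 r4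
    simp (disch := first | assumption | (rw [neg_neg]; assumption)) only [Ring.lie_def,
      add_apply, sub_apply, mul_apply_eq_comp,
      dm_pt12 hpq hpm hqm, dm_pt13 hpq hpm hqm, dm_pt23 hpq hpm hqm, dp_pt12 hpq hpm hqm,
      dp_pt13 hpq hpm hqm, dp_pt23 hpq hpm hqm, neg_neg, sub_neg_eq_add,
      d1, d2, d3, d4, d5, d6, d7, d8, d9, d10, e1, e2, e3, e4, e5, e6, e7, e8, e9, e10,
      g1, g2, g3, g4, g5, g6, g7, g8, g9, g10, Complex.ofReal_sub, Complex.ofReal_one]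
    generalize (coef (x - y) : ℂ) = cxy at *
    generalize (coef (x + y) : ℂ) = pxy at *
    generalize (coef (y - z) : ℂ) = cyz at *
    generalize (coef (y + z) : ℂ) = pyz at *
    generalize (coef (x - z) : ℂ) = cxz at *
    generalize (coef (x + z) : ℂ) = pxz at *
    set q : ℝ → ℝ → ℝ → ℂ := fun x y z => f (pt p q m t x y z) with hq
    refine ⟨?_, ?_, ?_⟩
    · linear_combination (q y z x - q z x y) * r1 + (q y (-z) (-x) - q (-z) x (-y)) * r3 +
        (-q (-y) z (-x) + q (-z) (-x) y) * r4 + (-q (-y) (-z) x + q z (-x) (-y)) * r2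
    · linear_combination (q z x y - q y z x) * r1 + (q z (-x) (-y) - q (-y) (-z) x) * r2 +
        (-q (-z) (-x) y + q (-y) z (-x)) * r4 + (-q (-z) x (-y) + q y (-z) (-x)) * r3
    · linear_combination (q y z x - q z x y) * r1 + (q (-y) z (-x) - q (-z) (-x) y) * r4 +
        (-q (-y) (-z) x + q z (-x) (-y)) * r2 + (-q y (-z) (-x) + q (-z) x (-y)) * r3
  refine ⟨?_, ?_, ?_⟩
  · exact op_ext (dense_regularSet r) fun f t ht => (key f t ht).1
  · exact op_ext (dense_regularSet r) fun f t ht => (key f t ht).2.1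
  · exact op_ext (dense_regularSet r) fun f t ht => (key f t ht).2.2

end

/-- The point `t` with its coordinates `i`, `j` replaced by `x`, `y`. -/
def ptTwo (i j : Fin r) (t : Fin r → ℝ) (x y : ℝ) : Fin r → ℝ :=
  fun m => if m = i then x else if m = j then y else t m

section

variable {i j : Fin r} (hij : i ≠ j) (t : Fin r → ℝ) (x y : ℝ)
include hij

theorem dm_ptTwo (f : TF r) (h : x ≠ y) : dm i j f (ptTwo i j t x y) =
    (coef (x - y) : ℂ) * (f (ptTwo i j t x y) - f (ptTwo i j t y x)) := by
  have h1 : ptTwo i j t x y i = x := by simp [ptTwo]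
  have h2 : ptTwo i j t x y j = y := by simp [ptTwo, hij.symm]
  have h3 : reflSwap i j (ptTwo i j t x y) = ptTwo i j t y x := by
    funext m
    simp only [reflSwap, ptTwo, Equiv.swap_apply_def]
    split_ifs <;> simp_all
  rw [dm_apply hij f (by rw [h1, h2]; exact h), h1, h2, h3]

theorem dp_ptTwo (f : TF r) (h : x ≠ -y) : dp i j f (ptTwo i j t x y) =
    (coef (x + y) : ℂ) * (f (ptTwo i j t x y) - f (ptTwo i j t (-y) (-x))) := by
  have h1 : ptTwo i j t x y i = x := by simp [ptTwo]
  have h2 : ptTwo i j t x y j = y := by simp [ptTwo, hij.symm]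
  have h3 : reflSignedSwap i j (ptTwo i j t x y) = ptTwo i j t (-y) (-x) := by
    funext m
    simp only [reflSignedSwap, ptTwo]
    split_ifs <;> simp_all
  rw [dp_apply hij f (by rw [h1, h2]; exact h), h1, h2, h3]

theorem reflSign_ptTwo_fst : reflSign i (ptTwo i j t x y) = ptTwo i j t (-x) y := by
  funext m
  simp only [reflSign, ptTwo]
  split_ifs <;> simp_all

theorem reflSign_ptTwo_snd : reflSign j (ptTwo i j t x y) = ptTwo i j t x (-y) := by
  funext m
  simp only [reflSign, ptTwo]
  split_ifs <;> simp_all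

/-- The relation of the root systems `B_2` and `C_2`, for operators `X_i = c(t_i) (1 - σ_i)` with an
odd function `c - 1 / 2` that satisfies the addition law of `coth`. -/
theorem rank_two_aux (c : ℝ → ℝ) (X : Fin r → TF r →L[ℂ] TF r)
    (hX : ∀ (k : Fin r) (f : TF r) (t : Fin r → ℝ), t k ≠ 0 →
      X k f t = (c (t k) : ℂ) * (f t - f (reflSign k t)))
    (hneg : ∀ x, x ≠ 0 → c (-x) = 1 - c x)
    (hc : ∀ x y, x ≠ 0 → y ≠ 0 → x ≠ y → x ≠ -y →
      coef (x + y) * (c x + c y - 1) + coef (x - y) * (c x - c y) = c x) :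
    ⁅X i - X j, dp i j⁆ - ⁅X i + X j, dm i j⁆ = 0 := by
  refine op_ext (dense_regularSet r) fun f t ht => ?_
  obtain ⟨x, y, hxyt, hxy, hxy', hx, hy⟩ : ∃ x y : ℝ, t = ptTwo i j t x y ∧ x ≠ y ∧ x ≠ -y ∧
      x ≠ 0 ∧ y ≠ 0 := by
    refine ⟨t i, t j, ?_, (ht.2 i j hij).1, (ht.2 i j hij).2, ht.1 i, ht.1 j⟩
    funext m
    unfold ptTwo
    split_ifs <;> simp [*]
  rw [hxyt]
  have X1 : ∀ (f : TF r) (x y : ℝ), x ≠ 0 → X i f (ptTwo i j t x y) =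
      (c x : ℂ) * (f (ptTwo i j t x y) - f (ptTwo i j t (-x) y)) := by
    intro f x y hx
    have h1 : ptTwo i j t x y i = x := by simp [ptTwo]
    rw [hX i f _ (by rw [h1]; exact hx), h1, reflSign_ptTwo_fst hij]
  have X2 : ∀ (f : TF r) (x y : ℝ), y ≠ 0 → X j f (ptTwo i j t x y) =
      (c y : ℂ) * (f (ptTwo i j t x y) - f (ptTwo i j t x (-y))) := by
    intro f x y hy
    have h1 : ptTwo i j t x y j = y := by simp [ptTwo, hij.symm]
    rw [hX j f _ (by rw [h1]; exact hy), h1, reflSign_ptTwo_snd hij]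
  obtain ⟨a1, a2, a3, a4, a5, a6⟩ := ne_signs hxy hxy'
  obtain ⟨d1, d2, d3, d4, d5, d6, d7, d8, d9, d10⟩ := coef_signs hxy hxy'
  have r1 := congrArg (fun u : ℝ => (u : ℂ)) (hc x y hx hy hxy hxy')
  push_cast at r1
  have hx' : -x ≠ 0 := neg_ne_zero.2 hx
  have hy' : -y ≠ 0 := neg_ne_zero.2 hy
  have n1 := hneg x hx
  have n2 := hneg y hy
  simp (disch := first | assumption | (rw [neg_neg]; assumption)) only [Ring.lie_def,
    add_apply, sub_apply, mul_apply_eq_comp, X1, X2,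
    dm_ptTwo hij, dp_ptTwo hij, neg_neg, sub_neg_eq_add, n1, n2,
    d1, d2, d3, d4, d5, d6, d7, d8, d9, d10, Complex.ofReal_sub, Complex.ofReal_one, zero_apply]
  generalize (coef (x - y) : ℂ) = u at *
  generalize (coef (x + y) : ℂ) = v at *
  generalize (c x : ℂ) = p at *
  generalize (c y : ℂ) = q at *
  set F : ℝ → ℝ → ℂ := fun x y => f (ptTwo i j t x y) with hF
  linear_combination (F y (-x) - F (-y) x) * r1

theorem rank_two_short : ⁅ds i - ds j, dp i j⁆ - ⁅ds i + ds j, dm i j⁆ = 0 := by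
  refine rank_two_aux hij coef ds (fun k f t h => ds_apply k f h) (fun x hx => coef_neg hx)
    fun x y hx hy h h' => ?_
  have h1 := coef_add hx hy (fun h0 => h' (add_eq_zero_iff_eq_neg.1 h0))
  have h2 := coef_add hx (neg_ne_zero.2 hy) (by rw [← sub_eq_add_neg]; exact sub_ne_zero.2 h)
  rw [coef_neg hy, ← sub_eq_add_neg] at h2
  linear_combination h1 + h2

theorem rank_two_long : ⁅dl i - dl j, dp i j⁆ - ⁅dl i + dl j, dm i j⁆ = 0 := by
  refine rank_two_aux hij (fun x => coef (2 * x)) dl (fun k f t h => dl_apply k f h)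
    (fun x hx => by rw [← coef_neg (mul_ne_zero two_ne_zero hx)]; ring_nf)
    fun x y hx hy h h' => ?_
  have e1 : x + y ≠ 0 := fun h0 => h' (add_eq_zero_iff_eq_neg.1 h0)
  have e2 : x - y ≠ 0 := sub_ne_zero.2 h
  have h1 := coef_add e1 e2 (by ring_nf; exact mul_ne_zero hx two_ne_zero)
  have h2 := coef_add e1 (neg_ne_zero.2 e2) (by ring_nf; exact mul_ne_zero hy two_ne_zero)
  rw [coef_neg e2] at h2
  rw [show x + y + (x - y) = 2 * x by ring] at h1
  rw [show x + y + -(x - y) = 2 * y by ring] at h2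
  linear_combination h1 + h2

end

end Rank

/-! ### The Cherednik operators on test functions -/

section Cherednik

variable {r : ℕ}

/-- The pair operator `β_{ik}` of the coordinates `i ≠ k`: the part of the Cherednik operator `D_i`
that comes from the roots `±ξ_i ± ξ_k` of multiplicity one; it is `0` for `i = k`. -/
def pairOp (i k : Fin r) : TF r →L[ℂ] TF r :=
  if i < k then dp i k + dm i k else if k < i then dp k i - dm k i else 0

/-- The part of the Cherednik operator `D_i` that involves the coordinate `i` only. -/
def singleOp (b ι : ℝ) (i : Fin r) : TF r →L[ℂ] TF r :=
  dirOp (Pi.single i 1) + (2 * ι : ℂ) • dl i + (2 * b : ℂ) • ds i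

/-- The Cherednik operator `D_j` on test functions. -/
def cherOp (a b ι : ℝ) (j : Fin r) : TF r →L[ℂ] TF r :=
  singleOp b ι j + (a : ℂ) • ∑ k, pairOp j k - (rho r a b ι j : ℂ) • 1

theorem pairOp_of_lt {i k : Fin r} (h : i < k) : pairOp i k = dp i k + dm i k := if_pos h

theorem pairOp_of_gt {i k : Fin r} (h : k < i) : pairOp i k = dp k i - dm k i := by
  rw [pairOp, if_neg (not_lt.2 h.le), if_pos h]

theorem pairOp_self (i : Fin r) : pairOp i i = 0 := by simp [pairOp]

section Bracket

variable (A B D : TF r →L[ℂ] TF r) (c : ℂ)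

theorem op_add_lie : ⁅A + B, D⁆ = ⁅A, D⁆ + ⁅B, D⁆ := by
  simp only [Ring.lie_def, mul_add, add_mul]; abel

theorem op_lie_add : ⁅A, B + D⁆ = ⁅A, B⁆ + ⁅A, D⁆ := by
  simp only [Ring.lie_def, mul_add, add_mul]; abel

theorem op_smul_lie : ⁅c • A, B⁆ = c • ⁅A, B⁆ := by
  simp only [Ring.lie_def, smul_mul_assoc, mul_smul_comm, smul_sub]

theorem op_lie_smul : ⁅A, c • B⁆ = c • ⁅A, B⁆ := by
  simp only [Ring.lie_def, smul_mul_assoc, mul_smul_comm, smul_sub]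

theorem op_lie_zero : ⁅A, (0 : TF r →L[ℂ] TF r)⁆ = 0 := by simp [Ring.lie_def]

theorem op_zero_lie : ⁅(0 : TF r →L[ℂ] TF r), A⁆ = 0 := by simp [Ring.lie_def]

theorem op_lie_sum {κ : Type*} (s : Finset κ) (X : κ → TF r →L[ℂ] TF r) :
    ⁅A, ∑ k ∈ s, X k⁆ = ∑ k ∈ s, ⁅A, X k⁆ := by
  simp only [Ring.lie_def, Finset.mul_sum, Finset.sum_mul, Finset.sum_sub_distrib]

theorem op_sum_lie {κ : Type*} (s : Finset κ) (X : κ → TF r →L[ℂ] TF r) :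
    ⁅∑ k ∈ s, X k, A⁆ = ∑ k ∈ s, ⁅X k, A⁆ := by
  simp only [Ring.lie_def, Finset.mul_sum, Finset.sum_mul, Finset.sum_sub_distrib]

end Bracket

theorem commute_dm_dp {i j : Fin r} (h : i ≠ j) : Commute (dm i j) (dp i j) :=
  commute_dd_dd (minus_coroot h) (plus_coroot h) (by simp [h, h.symm]) (by simp [h, h.symm])

theorem commute_dir_dm {k i j : Fin r} (h : i ≠ j) (hi : k ≠ i) (hj : k ≠ j) :
    Commute (dirOp (Pi.single k 1)) (dm i j) :=
  commute_dirOp_dd (minus_coroot h) (by simp [hi.symm, hj.symm])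

theorem commute_dir_dp {k i j : Fin r} (h : i ≠ j) (hi : k ≠ i) (hj : k ≠ j) :
    Commute (dirOp (Pi.single k 1)) (dp i j) :=
  commute_dirOp_dd (plus_coroot h) (by simp [hi.symm, hj.symm])

theorem commute_ds_dm {k i j : Fin r} (h : i ≠ j) (hi : k ≠ i) (hj : k ≠ j) :
    Commute (ds k) (dm i j) :=
  commute_dd_dd (short_coroot k) (minus_coroot h) (by simp [hi, hj])
    (by simp [hi.symm, hj.symm])

theorem commute_ds_dp {k i j : Fin r} (h : i ≠ j) (hi : k ≠ i) (hj : k ≠ j) :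
    Commute (ds k) (dp i j) :=
  commute_dd_dd (short_coroot k) (plus_coroot h) (by simp [hi, hj])
    (by simp [hi.symm, hj.symm])

theorem commute_dl_dm {k i j : Fin r} (h : i ≠ j) (hi : k ≠ i) (hj : k ≠ j) :
    Commute (dl k) (dm i j) :=
  commute_dd_dd (long_coroot k) (minus_coroot h) (by simp [hi, hj])
    (by simp [hi.symm, hj.symm])

theorem commute_dl_dp {k i j : Fin r} (h : i ≠ j) (hi : k ≠ i) (hj : k ≠ j) :
    Commute (dl k) (dp i j) :=
  commute_dd_dd (long_coroot k) (plus_coroot h) (by simp [hi, hj])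
    (by simp [hi.symm, hj.symm])

theorem commute_single_pair (b ι : ℝ) {k i j : Fin r} (hi : k ≠ i) (hj : k ≠ j) :
    Commute (singleOp b ι k) (pairOp i j) := by
  have hm : ∀ {i j : Fin r}, i ≠ j → k ≠ i → k ≠ j → Commute (singleOp b ι k) (dm i j) :=
    fun h hi hj => ((commute_dir_dm h hi hj).add_left
      ((commute_dl_dm h hi hj).smul_left _)).add_left ((commute_ds_dm h hi hj).smul_left _)
  have hp : ∀ {i j : Fin r}, i ≠ j → k ≠ i → k ≠ j → Commute (singleOp b ι k) (dp i j) :=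
    fun h hi hj => ((commute_dir_dp h hi hj).add_left
      ((commute_dl_dp h hi hj).smul_left _)).add_left ((commute_ds_dp h hi hj).smul_left _)
  rcases lt_trichotomy i j with h | h | h
  · rw [pairOp_of_lt h]
    exact (hp h.ne hi hj).add_right (hm h.ne hi hj)
  · rw [h, pairOp_self]
    exact Commute.zero_right _
  · rw [pairOp_of_gt h]
    exact (hp h.ne hj hi).sub_right (hm h.ne hj hi)

theorem commute_single_single (b ι : ℝ) {i j : Fin r} (h : i ≠ j) :
    Commute (singleOp b ι i) (singleOp b ι j) := by
  have h1 : ∀ {i j : Fin r}, i ≠ j → Commute (dirOp (Pi.single i 1)) (dl j) := fun h =>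
    commute_dirOp_dd (long_coroot _) (by simp [h])
  have h2 : ∀ {i j : Fin r}, i ≠ j → Commute (dirOp (Pi.single i 1)) (ds j) := fun h =>
    commute_dirOp_dd (short_coroot _) (by simp [h])
  have h3 : ∀ {i j : Fin r}, i ≠ j → Commute (ds i) (dl j) := fun h =>
    commute_dd_dd (short_coroot _) (long_coroot _) (by simp [h]) (by simp [h])
  have h4 : Commute (ds i) (ds j) :=
    commute_dd_dd (short_coroot _) (short_coroot _) (by simp [h]) (by simp [h.symm])
  have h5 : Commute (dl i) (dl j) :=
    commute_dd_dd (long_coroot _) (long_coroot _) (by simp [h]) (by simp [h.symm])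
  have h0 : Commute (dirOp (Pi.single i (1 : ℝ))) (dirOp (Pi.single j 1)) := commute_dirOp _ _
  unfold singleOp
  refine Commute.add_left (Commute.add_left ?_ (Commute.smul_left ?_ _))
    (Commute.smul_left ?_ _)
  · exact (h0.add_right ((h1 h).smul_right _)).add_right ((h2 h).smul_right _)
  · exact ((h1 h.symm).symm.add_right (h5.smul_right _)).add_right
      ((h3 h.symm).symm.smul_right _)
  · exact ((h2 h.symm).symm.add_right ((h3 h).smul_right _)).add_right (h4.smul_right _)

theorem commute_pair_pair {i k j l : Fin r} (hij : i ≠ j) (hil : i ≠ l) (hkj : k ≠ j)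
    (hkl : k ≠ l) : Commute (pairOp i k) (pairOp j l) := by
  have key : ∀ {i k j l : Fin r}, i ≠ k → j ≠ l → i ≠ j → i ≠ l → k ≠ j → k ≠ l →
      Commute (dm i k) (dm j l) ∧ Commute (dm i k) (dp j l) ∧ Commute (dp i k) (dm j l) ∧
        Commute (dp i k) (dp j l) := by
    intro i k j l h1 h2 h3 h4 h5 h6
    refine ⟨commute_dd_dd (minus_coroot h1) (minus_coroot h2) ?_ ?_,
      commute_dd_dd (minus_coroot h1) (plus_coroot h2) ?_ ?_,
      commute_dd_dd (plus_coroot h1) (minus_coroot h2) ?_ ?_,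
      commute_dd_dd (plus_coroot h1) (plus_coroot h2) ?_ ?_⟩ <;>
    simp [h3, h4, h5, h6, h3.symm, h4.symm, h5.symm, h6.symm]
  rcases lt_trichotomy i k with h | h | h
  · rcases lt_trichotomy j l with h' | h' | h'
    · obtain ⟨h1, h2, h3, h4⟩ := key h.ne h'.ne hij hil hkj hkl
      rw [pairOp_of_lt h, pairOp_of_lt h']
      exact (h4.add_right h3).add_left (h2.add_right h1)
    · rw [h', pairOp_self]
      exact Commute.zero_right _
    · obtain ⟨h1, h2, h3, h4⟩ := key h.ne h'.ne hil hij hkl hkj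
      rw [pairOp_of_lt h, pairOp_of_gt h']
      exact (h4.sub_right h3).add_left (h2.sub_right h1)
  · rw [h, pairOp_self]
    exact Commute.zero_left _
  · rcases lt_trichotomy j l with h' | h' | h'
    · obtain ⟨h1, h2, h3, h4⟩ := key h.ne h'.ne hkj hkl hij hil
      rw [pairOp_of_gt h, pairOp_of_lt h']
      exact (h4.add_right h3).sub_left (h2.add_right h1)
    · rw [h', pairOp_self]
      exact Commute.zero_right _
    · obtain ⟨h1, h2, h3, h4⟩ := key h.ne h'.ne hkl hkj hil hij
      rw [pairOp_of_gt h, pairOp_of_gt h']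
      exact (h4.sub_right h3).sub_left (h2.sub_right h1)

theorem dirOp_add (w w' : Fin r → ℝ) : dirOp (w + w') = dirOp w + dirOp w' := by
  ext f t
  simp [dirOp_apply]

theorem dirOp_sub (w w' : Fin r → ℝ) : dirOp (w - w') = dirOp w - dirOp w' := by
  ext f t
  simp [dirOp_apply]

/-- The relation between single and pair operators, from the root system `BC_2`. -/
theorem lie_single_pair (b ι : ℝ) {i j : Fin r} (h : i < j) :
    ⁅singleOp b ι i, pairOp j i⁆ + ⁅pairOp i j, singleOp b ι j⁆ = 0 := by
  have h1 : ⁅dirOp (Pi.single i (1 : ℝ)) - dirOp (Pi.single j 1), dp i j⁆ = 0 := by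
    rw [← dirOp_sub, ← commute_iff_lie_eq]
    exact commute_dirOp_dd (plus_coroot h.ne) (by simp [h.ne, h.ne'])
  have h2 : ⁅dirOp (Pi.single i (1 : ℝ)) + dirOp (Pi.single j 1), dm i j⁆ = 0 := by
    rw [← dirOp_add, ← commute_iff_lie_eq]
    exact commute_dirOp_dd (minus_coroot h.ne) (by simp [h.ne, h.ne'])
  have h3 := rank_two_short h.ne
  have h4 := rank_two_long h.ne
  rw [pairOp_of_lt h, pairOp_of_gt h]
  have e : ∀ A B N M : TF r →L[ℂ] TF r,
      ⁅A, N - M⁆ + ⁅N + M, B⁆ = ⁅A - B, N⁆ - ⁅A + B, M⁆ := by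
    intro A B N M
    simp only [Ring.lie_def]
    noncomm_ring
  rw [e]
  have e1 : singleOp b ι i - singleOp b ι j = (dirOp (Pi.single i (1 : ℝ)) - dirOp (Pi.single j 1))
      + (2 * ι : ℂ) • (dl i - dl j) + (2 * b : ℂ) • (ds i - ds j) := by
    unfold singleOp; module
  have e2 : singleOp b ι i + singleOp b ι j = (dirOp (Pi.single i (1 : ℝ)) + dirOp (Pi.single j 1))
      + (2 * ι : ℂ) • (dl i + dl j) + (2 * b : ℂ) • (ds i + ds j) := by
    unfold singleOp; module
  rw [e1, e2]
  simp only [op_add_lie, op_smul_lie] at h2 h3 h4 ⊢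
  rw [h1, h2, sub_eq_zero.1 h3, sub_eq_zero.1 h4]
  abel

theorem lie_pair_pair {i j : Fin r} (h : i ≠ j) : ⁅pairOp i j, pairOp j i⁆ = 0 := by
  rw [← commute_iff_lie_eq]
  rcases lt_or_gt_of_ne h with h | h
  · rw [pairOp_of_lt h, pairOp_of_gt h]
    have := commute_dm_dp h.ne
    exact ((Commute.refl _).sub_right this.symm).add_left (this.sub_right (Commute.refl _))
  · rw [pairOp_of_lt h, pairOp_of_gt h]
    have := commute_dm_dp h.ne
    exact ((Commute.refl _).add_right this.symm).sub_left (this.add_right (Commute.refl _))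

/-- A relation of Yang-Baxter type, from the root system `A_3 = D_3`. -/
theorem lie_pair_three {i j k : Fin r} (hij : i < j) (hik : i ≠ k) (hjk : j ≠ k) :
    ⁅pairOp i j, pairOp j k⁆ + ⁅pairOp i k, pairOp j i⁆ + ⁅pairOp i k, pairOp j k⁆ = 0 := by
  rcases lt_or_gt_of_ne hjk with h | h
  · have := (rank_three hij.ne hik hjk).1
    rw [pairOp_of_lt hij, pairOp_of_lt h, pairOp_of_lt (hij.trans h), pairOp_of_gt hij,
      add_comm (dp i j), add_comm (dp j k), add_comm (dp i k)]
    exact this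
  · rcases lt_or_gt_of_ne hik with h' | h'
    · have := (rank_three h'.ne hij.ne h.ne).2.1
      rw [pairOp_of_lt hij, pairOp_of_gt h, pairOp_of_lt h', pairOp_of_gt hij,
        add_comm (dp i j), add_comm (dp i k)]
      exact this
    · have := (rank_three h'.ne h.ne hij.ne).2.2
      rw [pairOp_of_lt hij, pairOp_of_gt h, pairOp_of_gt h', pairOp_of_gt hij,
        add_comm (dp i j)]
      exact this

/-- Pair operators without a common index commute, and so do `β_{ij}` and `β_{ji}`. The remaining
brackets cancel in groups of three, one group for each index `k ≠ i, j`. -/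
theorem lie_sum_pair {i j : Fin r} (hij : i < j) : ⁅∑ k, pairOp i k, ∑ l, pairOp j l⁆ = 0 := by
  have hzero : ∀ k l : Fin r, i ≠ l → k ≠ j → k ≠ l → ⁅pairOp i k, pairOp j l⁆ = 0 :=
    fun k l h1 h2 h3 => (commute_iff_lie_eq).1 (commute_pair_pair hij.ne h1 h2 h3)
  have hinner : ∀ k, k ≠ j → ⁅pairOp i k, ∑ l, pairOp j l⁆ =
      if k = i then 0 else ⁅pairOp i k, pairOp j i⁆ + ⁅pairOp i k, pairOp j k⁆ := by
    intro k hk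
    split_ifs with hki
    · rw [hki, pairOp_self, op_zero_lie]
    · rw [op_lie_sum, Finset.sum_eq_add_of_mem i k (Finset.mem_univ _) (Finset.mem_univ _)
        (Ne.symm hki)]
      intro l _ hl
      exact hzero k l (Ne.symm hl.1) hk (Ne.symm hl.2)
  have hj : ⁅pairOp i j, ∑ l, pairOp j l⁆ =
      ∑ k, if k = i then 0 else if k = j then 0 else ⁅pairOp i j, pairOp j k⁆ := by
    rw [op_lie_sum]
    refine Finset.sum_congr rfl fun k _ => ?_
    split_ifs with h1 h2
    · rw [h1]; exact lie_pair_pair hij.ne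
    · rw [h2, pairOp_self, op_lie_zero]
    · rfl
  rw [op_sum_lie, ← Finset.add_sum_erase _ _ (Finset.mem_univ j), hj,
    ← Finset.add_sum_erase _ _ (Finset.mem_univ j)]
  have : (if j = i then (0 : TF r →L[ℂ] TF r) else if j = j then 0
      else ⁅pairOp i j, pairOp j j⁆) = 0 := by simp
  rw [this, zero_add, ← Finset.sum_add_distrib]
  refine Finset.sum_eq_zero fun k hk => ?_
  have hkj : k ≠ j := Finset.ne_of_mem_erase hk
  rw [hinner k hkj]
  by_cases hki : k = i
  · simp [hki]
  · simp only [hki, hkj, if_false]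
    rw [← lie_pair_three hij (Ne.symm hki) (Ne.symm hkj)]
    abel

/-- The Cherednik operators commute. -/
theorem commute_cherOp (a b ι : ℝ) (i j : Fin r) :
    Commute (cherOp a b ι i) (cherOp a b ι j) := by
  have key : ∀ {i j : Fin r}, i < j → Commute (cherOp a b ι i) (cherOp a b ι j) := by
    intro i j hij
    have h1 : ⁅singleOp b ι i, ∑ l, pairOp j l⁆ = ⁅singleOp b ι i, pairOp j i⁆ := by
      rw [op_lie_sum, Finset.sum_eq_single i]
      · intro l _ hl
        exact (commute_iff_lie_eq).1 (commute_single_pair b ι hij.ne (Ne.symm hl))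
      · simp
    have h2 : ⁅∑ l, pairOp i l, singleOp b ι j⁆ = ⁅pairOp i j, singleOp b ι j⁆ := by
      rw [op_sum_lie, Finset.sum_eq_single j]
      · intro l _ hl
        exact (commute_iff_lie_eq).1 (commute_single_pair b ι hij.ne' (Ne.symm hl)).symm
      · simp
    unfold cherOp
    refine Commute.sub_left (Commute.sub_right ?_ (by
      exact (Commute.one_right _).smul_right _)) ((Commute.one_left _).smul_left _)
    rw [commute_iff_lie_eq]
    simp only [op_add_lie, op_lie_add, op_smul_lie, op_lie_smul, h1, h2, lie_sum_pair hij,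
      (commute_iff_lie_eq).1 (commute_single_single b ι hij.ne), zero_add, smul_zero, add_zero]
    rw [← smul_add, add_comm, lie_single_pair b ι hij, smul_zero]
  rcases lt_trichotomy i j with h | h | h
  · exact key h
  · rw [h]
  · exact (key h).symm

end Cherednik

/-! ### The graded Hecke algebra relations -/

section Hecke

variable {r : ℕ}

/-- The linear automorphism given by a linear involution. -/
def involEquiv (g : (Fin r → ℝ) →L[ℝ] (Fin r → ℝ)) (h : Function.Involutive g) :
    (Fin r → ℝ) ≃L[ℝ] (Fin r → ℝ) :=
  ContinuousLinearEquiv.equivOfInverse g g h h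

/-- The reflection `s_{ij}` as a linear automorphism. -/
def swapEquiv (i j : Fin r) : (Fin r → ℝ) ≃L[ℝ] (Fin r → ℝ) :=
  involEquiv (ContinuousLinearMap.pi fun k => coord (Equiv.swap i j k)) (reflSwap_involutive i j)

/-- The reflection `σ_i` as a linear automorphism. -/
def signEquiv (i : Fin r) : (Fin r → ℝ) ≃L[ℝ] (Fin r → ℝ) :=
  involEquiv (ContinuousLinearMap.pi fun k => if k = i then -coord k else coord k) (by
    have : ⇑(ContinuousLinearMap.pi fun k => if k = i then -coord k else coord k :
        (Fin r → ℝ) →L[ℝ] (Fin r → ℝ)) = reflSign i := by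
      funext t k
      by_cases h : k = i <;> simp [reflSign, h]
    rw [this]
    exact reflSign_involutive i)

theorem swapEquiv_apply (i j : Fin r) (t : Fin r → ℝ) : swapEquiv i j t = reflSwap i j t := rfl

theorem swapEquiv_symm (i j : Fin r) : (swapEquiv i j).symm = swapEquiv i j := rfl

theorem signEquiv_symm (i : Fin r) : (signEquiv i).symm = signEquiv i := rfl

theorem signEquiv_apply (i : Fin r) (t : Fin r → ℝ) : signEquiv i t = reflSign i t := by
  change (ContinuousLinearMap.pi fun k => if k = i then -coord k else coord k :
        (Fin r → ℝ) →L[ℝ] (Fin r → ℝ)) t = _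
  funext k
  by_cases h : k = i <;> simp [reflSign, h]

theorem compOp_mul (w w' : (Fin r → ℝ) ≃L[ℝ] (Fin r → ℝ)) :
    compOp w * compOp w' = compOp (w.trans w') := rfl

theorem compOp_refl : compOp (ContinuousLinearEquiv.refl ℝ (Fin r → ℝ)) = 1 := rfl

theorem compOp_mul_dirOp (w : (Fin r → ℝ) ≃L[ℝ] (Fin r → ℝ)) (u : Fin r → ℝ) :
    compOp w * dirOp u = dirOp (w.symm u) * compOp w := by
  refine op_ext dense_univ fun f t _ => ?_
  rw [mul_apply_eq_comp, mul_apply_eq_comp, compOp_apply, dirOp_apply, dirOp_apply]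
  have h1 : (compOp w f : (Fin r → ℝ) → ℂ) = f ∘ w := rfl
  have h2 : HasFDerivAt f (fderiv ℝ f (w t)) (w t) :=
    ((contDiff_of_TF f).differentiable (by norm_num) _).hasFDerivAt
  rw [h1, (h2.comp t w.hasFDerivAt).fderiv]
  simp

/-- A linear map that carries the root datum `(l', v')` to `(l, v)` intertwines the divided
differences. -/
theorem compOp_mul_dd (w : (Fin r → ℝ) ≃L[ℝ] (Fin r → ℝ)) {l l' : (Fin r → ℝ) →L[ℝ] ℝ}
    {v v' : Fin r → ℝ} (h : l v = 2) (hl : ∀ t, l (w t) = l' t) (hv : w v' = v) :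
    compOp w * dd l v = dd l' v' * compOp w := by
  have h' : l' v' = 2 := by rw [← hl, hv, h]
  refine op_ext (dense_ne_zero h') fun f t ht => ?_
  have ht' : l (w t) ≠ 0 := by rw [hl]; exact ht
  have e : w (refl l' v' t) = refl l v (w t) := by
    rw [refl_apply, refl_apply, map_sub, map_smul, hv, hl]
  rw [mul_apply_eq_comp, mul_apply_eq_comp, compOp_apply, dd_apply h _ ht', dd_apply h' _ ht,
    compOp_apply, compOp_apply, hl, e]

theorem swap_single (i j k : Fin r) : swapEquiv i j (Pi.single (Equiv.swap i j k) 1) =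
    Pi.single k 1 := by
  funext m
  rw [swapEquiv_apply]
  simp only [reflSwap, Pi.single_apply]
  simp

theorem swap_mul_dir (i j k : Fin r) : compOp (swapEquiv i j) * dirOp (Pi.single k 1) =
    dirOp (Pi.single (Equiv.swap i j k) 1) * compOp (swapEquiv i j) := by
  rw [compOp_mul_dirOp, swapEquiv_symm]
  congr 2
  have := swap_single i j (Equiv.swap i j k)
  rwa [Equiv.swap_apply_self] at this

theorem swap_mul_ds (i j k : Fin r) : compOp (swapEquiv i j) * ds k =
    ds (Equiv.swap i j k) * compOp (swapEquiv i j) :=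
  compOp_mul_dd _ (short_coroot k) (fun t => rfl) (by rw [map_smul, swap_single])

theorem swap_mul_dl (i j k : Fin r) : compOp (swapEquiv i j) * dl k =
    dl (Equiv.swap i j k) * compOp (swapEquiv i j) :=
  compOp_mul_dd _ (long_coroot k) (fun t => rfl) (by rw [swap_single])

theorem swap_mul_dm (i j : Fin r) {k l : Fin r} (h : k ≠ l) : compOp (swapEquiv i j) * dm k l =
    dm (Equiv.swap i j k) (Equiv.swap i j l) * compOp (swapEquiv i j) :=
  compOp_mul_dd _ (minus_coroot h) (fun t => rfl) (by rw [map_sub, swap_single, swap_single])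

theorem swap_mul_dp (i j : Fin r) {k l : Fin r} (h : k ≠ l) : compOp (swapEquiv i j) * dp k l =
    dp (Equiv.swap i j k) (Equiv.swap i j l) * compOp (swapEquiv i j) :=
  compOp_mul_dd _ (plus_coroot h) (fun t => rfl) (by rw [map_add, swap_single, swap_single])

theorem swap_mul_self (i j : Fin r) : compOp (swapEquiv i j) * compOp (swapEquiv i j) = 1 := by
  ext f t
  rw [mul_apply_eq_comp, compOp_apply, compOp_apply, swapEquiv_apply, swapEquiv_apply,
    reflSwap_involutive]
  rfl

theorem sign_mul_self (i : Fin r) : compOp (signEquiv i) * compOp (signEquiv i) = 1 := by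
  ext f t
  rw [mul_apply_eq_comp, compOp_apply, compOp_apply, signEquiv_apply, signEquiv_apply,
    reflSign_involutive]
  rfl

theorem dp_symm (i j : Fin r) : dp i j = dp j i := by
  unfold dp
  rw [add_comm (coord i) (coord j), add_comm (Pi.single i (1 : ℝ) : Fin r → ℝ) (Pi.single j 1)]

theorem dm_symm {i j : Fin r} (h : i ≠ j) : dm j i = 1 - compOp (swapEquiv i j) - dm i j := by
  refine op_ext (dense_regularSet r) fun f t ht => ?_
  have h1 := (ht.2 i j h).1
  have h2 : reflSwap j i t = reflSwap i j t := by
    funext k; simp only [reflSwap, Equiv.swap_comm]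
  have h3 := coef_neg (sub_ne_zero.2 h1)
  rw [neg_sub] at h3
  simp only [sub_apply, one_apply_eq_self, dm_apply h f h1, dm_apply h.symm f h1.symm, h2, h3,
    compOp_apply, swapEquiv_apply]
  push_cast
  ring

theorem swap_mul_single (b ι : ℝ) (i j k : Fin r) :
    compOp (swapEquiv i j) * singleOp b ι k =
      singleOp b ι (Equiv.swap i j k) * compOp (swapEquiv i j) := by
  unfold singleOp
  simp only [mul_add, add_mul, mul_smul_comm, smul_mul_assoc, swap_mul_dir, swap_mul_ds,
    swap_mul_dl]

/-- An adjacent transposition preserves the order of all pairs except one. -/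
theorem swap_lt_swap {i j k l : Fin r} (hij : (i : ℕ) + 1 = j) (h : ¬ (k = i ∧ l = j))
    (hkl : k < l) : Equiv.swap i j k < Equiv.swap i j l := by
  rw [Fin.lt_def] at hkl ⊢
  simp only [Equiv.swap_apply_def, Fin.ext_iff] at h ⊢
  split_ifs <;> omega

theorem swap_mul_pair {i j k l : Fin r} (hij : (i : ℕ) + 1 = j) (h : ¬ (k = i ∧ l = j))
    (h' : ¬ (k = j ∧ l = i)) : compOp (swapEquiv i j) * pairOp k l =
      pairOp (Equiv.swap i j k) (Equiv.swap i j l) * compOp (swapEquiv i j) := by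
  rcases lt_trichotomy k l with hkl | hkl | hkl
  · rw [pairOp_of_lt hkl, pairOp_of_lt (swap_lt_swap hij h hkl), mul_add, add_mul,
      swap_mul_dm i j hkl.ne, swap_mul_dp i j hkl.ne]
  · rw [hkl, pairOp_self, pairOp_self, mul_zero, zero_mul]
  · rw [pairOp_of_gt hkl, pairOp_of_gt (swap_lt_swap hij (fun hh => h' ⟨hh.2, hh.1⟩) hkl), mul_sub,
      sub_mul, swap_mul_dm i j hkl.ne, swap_mul_dp i j hkl.ne]

theorem rho_eq_of_succ (a b ι : ℝ) {i j : Fin r} (hij : (i : ℕ) + 1 = j) :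
    rho r a b ι i = rho r a b ι j + a := by
  unfold rho
  rw [← hij]
  push_cast
  ring

/-- The Hecke relation between an adjacent transposition `s = s_{ij}`, `j = i + 1`, and `D_i`. -/
theorem swap_mul_cherOp_fst (a b ι : ℝ) {i j : Fin r} (hij : (i : ℕ) + 1 = j) :
    compOp (swapEquiv i j) * cherOp a b ι i =
      cherOp a b ι j * compOp (swapEquiv i j) - (a : ℂ) • 1 := by
  have hlt : i < j := by rw [Fin.lt_def]; omega
  set S := compOp (swapEquiv i j) with hS
  have hSS : S * S = 1 := swap_mul_self i j
  have h1 : S * singleOp b ι i = singleOp b ι j * S := by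
    simpa using swap_mul_single b ι i j i
  have h2 : S * ∑ k, pairOp i k = (∑ k, pairOp j k) * S + S - 1 := by
    have e1 : ∀ k, S * pairOp i k = pairOp j (Equiv.swap i j k) * S +
        if k = j then S - 1 else 0 := by
      intro k
      by_cases hk : k = j
      · rw [if_pos hk, hk, pairOp_of_lt hlt, Equiv.swap_apply_right, pairOp_of_gt hlt, mul_add,
          swap_mul_dm i j hlt.ne, swap_mul_dp i j hlt.ne, Equiv.swap_apply_left,
          Equiv.swap_apply_right, dp_symm j i, dm_symm hlt.ne, ← hS, sub_mul, sub_mul, sub_mul, hSS,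
          one_mul]
        abel
      · rw [if_neg hk, add_zero]
        simpa using swap_mul_pair (k := i) (l := k) hij (fun hh => hk hh.2)
          (fun hh => hlt.ne hh.1)
    rw [Finset.mul_sum, Finset.sum_congr rfl fun k _ => e1 k, Finset.sum_add_distrib,
      ← Finset.sum_mul, Equiv.sum_comp (Equiv.swap i j) (fun k => pairOp j k)]
    simp
    abel
  unfold cherOp
  rw [mul_sub, mul_add, mul_smul_comm, mul_smul_comm, h1, h2, rho_eq_of_succ a b ι hij, sub_mul,
    add_mul, smul_mul_assoc, smul_mul_assoc, mul_one, one_mul]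
  push_cast
  module

theorem swap_mul_cherOp_snd (a b ι : ℝ) {i j : Fin r} (hij : (i : ℕ) + 1 = j) :
    compOp (swapEquiv i j) * cherOp a b ι j =
      cherOp a b ι i * compOp (swapEquiv i j) + (a : ℂ) • 1 := by
  have h := swap_mul_cherOp_fst a b ι hij
  set S := compOp (swapEquiv i j) with hS
  have hSS : S * S = 1 := swap_mul_self i j
  have h2 : cherOp a b ι j = (S * cherOp a b ι i + (a : ℂ) • 1) * S := by
    rw [h, sub_add_cancel, mul_assoc, hSS, mul_one]
  rw [h2, add_mul, mul_add, ← mul_assoc, ← mul_assoc, hSS, one_mul, smul_mul_assoc, one_mul,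
    mul_smul_comm, hSS]

theorem swap_commute_cherOp (a b ι : ℝ) {i j k : Fin r} (hij : (i : ℕ) + 1 = j) (hki : k ≠ i)
    (hkj : k ≠ j) : Commute (compOp (swapEquiv i j)) (cherOp a b ι k) := by
  set S := compOp (swapEquiv i j) with hS
  have hk : Equiv.swap i j k = k := Equiv.swap_apply_of_ne_of_ne hki hkj
  have h1 : S * singleOp b ι k = singleOp b ι k * S := by
    have := swap_mul_single b ι i j k
    rwa [hk] at this
  have h2 : S * ∑ l, pairOp k l = (∑ l, pairOp k l) * S := by
    have e1 : ∀ l, S * pairOp k l = pairOp k (Equiv.swap i j l) * S := by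
      intro l
      have := swap_mul_pair (k := k) (l := l) hij (fun hh => hki hh.1) (fun hh => hkj hh.1)
      rwa [hk] at this
    rw [Finset.mul_sum, Finset.sum_congr rfl fun l _ => e1 l, ← Finset.sum_mul,
      Equiv.sum_comp (Equiv.swap i j) (fun l => pairOp k l)]
  unfold cherOp
  change S * _ = _ * S
  rw [mul_sub, mul_add, mul_smul_comm, mul_smul_comm, h1, h2, sub_mul,
    add_mul, smul_mul_assoc, smul_mul_assoc, mul_one, one_mul]

theorem sign_single_self (i : Fin r) : signEquiv i (Pi.single i 1) = -Pi.single i 1 := by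
  funext k
  rw [signEquiv_apply]
  by_cases h : k = i <;> simp [reflSign, h]

theorem sign_single_ne {i k : Fin r} (h : k ≠ i) :
    signEquiv i (Pi.single k 1) = Pi.single k 1 := by
  funext m
  rw [signEquiv_apply]
  by_cases hm : m = i
  · subst hm
    simp [reflSign, h.symm]
  · simp [reflSign, hm]

theorem sign_coord_self (i : Fin r) (t : Fin r → ℝ) : signEquiv i t i = -t i := by
  rw [signEquiv_apply]; simp [reflSign]

theorem sign_coord_ne {i k : Fin r} (h : k ≠ i) (t : Fin r → ℝ) : signEquiv i t k = t k := by
  rw [signEquiv_apply]; simp [reflSign, h]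

theorem dirOp_neg (w : Fin r → ℝ) : dirOp (-w) = -dirOp w := by
  ext f t
  simp [dirOp_apply]

theorem sign_mul_dir (i : Fin r) : compOp (signEquiv i) * dirOp (Pi.single i 1) =
    -dirOp (Pi.single i 1) * compOp (signEquiv i) := by
  rw [compOp_mul_dirOp, signEquiv_symm, sign_single_self, dirOp_neg]

theorem sign_mul_ds (i : Fin r) : compOp (signEquiv i) * ds i =
    (1 - compOp (signEquiv i) - ds i) * compOp (signEquiv i) := by
  refine op_ext (dense_regularSet r) fun f t ht => ?_
  have h1 := ht.1 i
  have h2 : signEquiv i t i ≠ 0 := by rw [sign_coord_self]; exact neg_ne_zero.2 h1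
  simp only [mul_apply_eq_comp, sub_apply, one_apply_eq_self, compOp_apply, ds_apply i _ h1,
    ds_apply i _ h2, sign_coord_self, coef_neg h1, ← signEquiv_apply]
  push_cast
  ring

theorem sign_mul_dl (i : Fin r) : compOp (signEquiv i) * dl i =
    (1 - compOp (signEquiv i) - dl i) * compOp (signEquiv i) := by
  refine op_ext (dense_regularSet r) fun f t ht => ?_
  have h1 := ht.1 i
  have h2 : signEquiv i t i ≠ 0 := by rw [sign_coord_self]; exact neg_ne_zero.2 h1
  simp only [mul_apply_eq_comp, sub_apply, one_apply_eq_self, compOp_apply, dl_apply i _ h1,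
    dl_apply i _ h2, sign_coord_self, mul_neg, coef_neg (mul_ne_zero two_ne_zero h1),
    ← signEquiv_apply]
  push_cast
  ring

theorem sign_mul_dm {n k : Fin r} (h : k ≠ n) : compOp (signEquiv n) * dm k n =
    dp k n * compOp (signEquiv n) :=
  compOp_mul_dd _ (minus_coroot h)
    (fun t => by simp [sign_coord_self, sign_coord_ne h])
    (by rw [map_add, sign_single_self, sign_single_ne h, sub_eq_add_neg])

theorem sign_mul_dp {n k : Fin r} (h : k ≠ n) : compOp (signEquiv n) * dp k n =
    dm k n * compOp (signEquiv n) :=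
  compOp_mul_dd _ (plus_coroot h)
    (fun t => by simp [sign_coord_self, sign_coord_ne h, sub_eq_add_neg])
    (by rw [map_sub, sign_single_self, sign_single_ne h, sub_neg_eq_add])

/-- The Hecke relation between the sign change of the last coordinate and the last `D_n`. -/
theorem sign_mul_cherOp (a b ι : ℝ) {n : Fin r} (hn : (n : ℕ) + 1 = r) :
    compOp (signEquiv n) * cherOp a b ι n =
      -(cherOp a b ι n * compOp (signEquiv n)) - (2 * ι + 2 * b : ℂ) • 1 := by
  set S := compOp (signEquiv n) with hS
  have hSS : S * S = 1 := sign_mul_self n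
  have h1 : S * singleOp b ι n = -(singleOp b ι n * S) + (2 * ι + 2 * b : ℂ) • (S - 1) := by
    unfold singleOp
    simp only [mul_add, add_mul, mul_smul_comm, smul_mul_assoc, hS, sign_mul_dir, sign_mul_ds,
      sign_mul_dl, sub_mul, one_mul, sign_mul_self, neg_mul]
    module
  have h2 : S * ∑ k, pairOp n k = -((∑ k, pairOp n k) * S) := by
    rw [Finset.mul_sum, Finset.sum_mul, ← Finset.sum_neg_distrib]
    refine Finset.sum_congr rfl fun k _ => ?_
    rcases eq_or_ne k n with hk | hk
    · rw [hk, pairOp_self, mul_zero, zero_mul, neg_zero]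
    · have hlt : k < n := by
        have := k.2
        rw [Fin.lt_def]
        have : (k : ℕ) ≠ n := fun hh => hk (Fin.ext hh)
        omega
      rw [pairOp_of_gt hlt, mul_sub, sign_mul_dm hk, sign_mul_dp hk, sub_mul]
      abel
  have h3 : (rho r a b ι n : ℂ) = ι + b := by
    have : (n : ℝ) = r - 1 := by rw [eq_sub_iff_add_eq]; exact_mod_cast hn
    unfold rho
    rw [this]
    push_cast
    ring
  unfold cherOp
  rw [mul_sub, mul_add, mul_smul_comm, mul_smul_comm, h1, h2, h3, sub_mul,
    add_mul, smul_mul_assoc, smul_mul_assoc, mul_one, one_mul]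
  module

theorem sign_commute_cherOp (a b ι : ℝ) {n k : Fin r} (hn : (n : ℕ) + 1 = r) (hk : k ≠ n) :
    Commute (compOp (signEquiv n)) (cherOp a b ι k) := by
  set S := compOp (signEquiv n) with hS
  have hlt : ∀ l, l ≠ n → l < n := by
    intro l hl
    have := l.2
    rw [Fin.lt_def]
    have : (l : ℕ) ≠ n := fun hh => hl (Fin.ext hh)
    omega
  have h1 : Commute S (singleOp b ι k) := by
    have c1 : Commute S (dirOp (Pi.single k 1)) := by
      change S * _ = _ * S
      rw [hS, compOp_mul_dirOp, signEquiv_symm, sign_single_ne hk]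
    have c2 : Commute S (dl k) := compOp_mul_dd _ (long_coroot k)
      (fun t => by simp [sign_coord_ne hk]) (sign_single_ne hk)
    have c3 : Commute S (ds k) := compOp_mul_dd _ (short_coroot k)
      (fun t => by simp [sign_coord_ne hk]) (by rw [map_smul, sign_single_ne hk])
    exact (c1.add_right (c2.smul_right _)).add_right (c3.smul_right _)
  have h2 : Commute S (∑ l, pairOp k l) := by
    refine Commute.sum_right _ _ _ fun l _ => ?_
    rcases eq_or_ne l n with hl | hl
    · rw [hl, pairOp_of_lt (hlt k hk)]
      change S * _ = _ * S
      rw [mul_add, add_mul, sign_mul_dm hk, sign_mul_dp hk, add_comm]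
    · have hm : ∀ {k l : Fin r}, k ≠ l → k ≠ n → l ≠ n → Commute S (dm k l) :=
        fun h hk hl => compOp_mul_dd _ (minus_coroot h)
          (fun t => by simp [sign_coord_ne hk, sign_coord_ne hl])
          (by rw [map_sub, sign_single_ne hk, sign_single_ne hl])
      have hp : ∀ {k l : Fin r}, k ≠ l → k ≠ n → l ≠ n → Commute S (dp k l) :=
        fun h hk hl => compOp_mul_dd _ (plus_coroot h)
          (fun t => by simp [sign_coord_ne hk, sign_coord_ne hl])
          (by rw [map_add, sign_single_ne hk, sign_single_ne hl])
      rcases lt_trichotomy k l with hkl | hkl | hkl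
      · rw [pairOp_of_lt hkl]
        exact (hp hkl.ne hk hl).add_right (hm hkl.ne hk hl)
      · rw [hkl, pairOp_self]
        exact Commute.zero_right _
      · rw [pairOp_of_gt hkl]
        exact (hp hkl.ne hl hk).sub_right (hm hkl.ne hl hk)
  exact (h1.add_right (h2.smul_right _)).sub_right ((Commute.one_right _).smul_right _)

end Hecke

/-! ### The operator `𝓜_δ` on test functions -/

section Product

variable {r : ℕ}

/-- The operator `D_j ^ 2 - c ^ 2` on test functions. -/
def sqOp (a b ι : ℝ) (c : ℂ) (j : Fin r) : TF r →L[ℂ] TF r :=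
  cherOp a b ι j * cherOp a b ι j - (c ^ 2) • 1

/-- The operator `∏_j (D_j ^ 2 - c ^ 2)` on test functions. -/
def prodOp (r : ℕ) (a b ι : ℝ) (c : ℂ) : TF r →L[ℂ] TF r :=
  ((List.finRange r).map (sqOp a b ι c)).prod

theorem commute_sqOp (a b ι : ℝ) (c : ℂ) (i j : Fin r) :
    Commute (sqOp a b ι c i) (sqOp a b ι c j) := by
  have h := commute_cherOp a b ι i j
  have h' := (h.mul_left h).mul_right (h.mul_left h)
  exact (h'.sub_left ((Commute.one_left _).smul_left _)).sub_right
    ((Commute.one_right _).smul_right _)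

theorem commute_list_prod {κ : Type*} (S : TF r →L[ℂ] TF r) (X : κ → TF r →L[ℂ] TF r)
    (l : List κ) (h : ∀ k ∈ l, Commute S (X k)) : Commute S (l.map X).prod := by
  induction l with
  | nil => exact Commute.one_right _
  | cons k l ih =>
    rw [List.map_cons, List.prod_cons]
    exact (h k (by simp)).mul_right (ih fun m hm => h m (by simp [hm]))

theorem prodOp_eq_of_perm (a b ι : ℝ) (c : ℂ) {l : List (Fin r)} (h : (List.finRange r).Perm l) :
    prodOp r a b ι c = (l.map (sqOp a b ι c)).prod := by
  refine List.Perm.prod_eq' (h.map _) ?_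
  rw [List.pairwise_map]
  exact List.pairwise_of_forall fun i j => commute_sqOp a b ι c i j

/-- By the Hecke relations an adjacent transposition commutes with the symmetric functions
`D_i D_j` and `D_i² + D_j²`, hence with the product of the two factors it moves. -/
theorem swap_commute_prodOp_of_succ (a b ι : ℝ) (c : ℂ) {i j : Fin r} (hij : (i : ℕ) + 1 = j) :
    Commute (compOp (swapEquiv i j)) (prodOp r a b ι c) := by
  have hne : j ≠ i := by rintro rfl; omega
  have h1 := swap_mul_cherOp_fst a b ι hij
  have h2 := swap_mul_cherOp_snd a b ι hij
  have h3 : cherOp a b ι i * cherOp a b ι j = cherOp a b ι j * cherOp a b ι i :=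
    commute_cherOp a b ι i j
  have hp : (List.finRange r).Perm (i :: j :: ((List.finRange r).erase i).erase j) :=
    (List.perm_cons_erase (List.mem_finRange i)).trans ((List.perm_cons_erase
      ((List.mem_erase_of_ne hne).2 (List.mem_finRange j))).cons i)
  have hnd := List.nodup_finRange r
  have hl : ∀ k ∈ ((List.finRange r).erase i).erase j, k ≠ i ∧ k ≠ j := by
    intro k hk
    rw [(hnd.erase i).mem_erase_iff, hnd.mem_erase_iff] at hk
    exact ⟨hk.2.1, hk.1⟩
  rw [prodOp_eq_of_perm a b ι c hp, List.map_cons, List.map_cons, List.prod_cons, List.prod_cons,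
    ← mul_assoc]
  refine Commute.mul_right ?_ (commute_list_prod _ _ _ fun k hk => ?_)
  · set S := compOp (swapEquiv i j)
    unfold sqOp
    generalize cherOp a b ι i = X at h1 h2 h3 ⊢
    generalize cherOp a b ι j = Y at h1 h2 h3 ⊢
    have hmul : Commute S (X * Y) := by
      change S * (X * Y) = X * Y * S
      rw [← mul_assoc, h1, sub_mul, mul_assoc, h2, mul_add, ← mul_assoc, h3]
      simp
    have hadd : Commute S (X * X + Y * Y) := by
      change S * (X * X + Y * Y) = (X * X + Y * Y) * S
      rw [mul_add, ← mul_assoc, ← mul_assoc, h1, h2, sub_mul, add_mul, mul_assoc, mul_assoc, h1, h2]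
      simp only [mul_sub, mul_add, add_mul, mul_smul_comm, smul_mul_assoc, mul_one, one_mul,
        mul_assoc]
      abel
    have e : (X * X - c ^ 2 • 1) * (Y * Y - c ^ 2 • 1) =
        (X * Y) * (X * Y) - c ^ 2 • (X * X + Y * Y) + (c ^ 2 * c ^ 2) • 1 := by
      have : X * Y * (X * Y) = X * X * (Y * Y) := by
        rw [mul_assoc, ← mul_assoc Y, ← h3]; simp only [mul_assoc]
      rw [this]
      simp only [sub_mul, mul_sub, mul_smul_comm, smul_mul_assoc, mul_one, one_mul]
      module
    rw [e]
    exact ((hmul.mul_right hmul).sub_right (hadd.smul_right _)).add_right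
      ((Commute.one_right _).smul_right _)
  · have := swap_commute_cherOp a b ι hij (hl k hk).1 (hl k hk).2
    exact (this.mul_right this).sub_right ((Commute.one_right _).smul_right _)

/-- By the Hecke relation the sign change of the last coordinate commutes with the square of the
last Cherednik operator. -/
theorem sign_commute_prodOp_of_last (a b ι : ℝ) (c : ℂ) {n : Fin r} (hn : (n : ℕ) + 1 = r) :
    Commute (compOp (signEquiv n)) (prodOp r a b ι c) := by
  refine commute_list_prod _ _ _ fun k _ => ?_
  rcases eq_or_ne k n with rfl | hk
  · have h := sign_mul_cherOp a b ι hn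
    refine Commute.sub_right ?_ ((Commute.one_right _).smul_right _)
    set S := compOp (signEquiv k)
    generalize cherOp a b ι k = X at h ⊢
    change S * (X * X) = X * X * S
    rw [← mul_assoc, h, sub_mul, neg_mul, mul_assoc, h]
    simp only [mul_sub, mul_neg, mul_smul_comm, smul_mul_assoc, mul_one, one_mul, mul_assoc]
    abel
  · have := sign_commute_cherOp a b ι hn hk
    exact (this.mul_right this).sub_right ((Commute.one_right _).smul_right _)

theorem commute_compOp_trans {w w' : (Fin r → ℝ) ≃L[ℝ] (Fin r → ℝ)} {M : TF r →L[ℂ] TF r}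
    (h : Commute (compOp w) M) (h' : Commute (compOp w') M) : Commute (compOp (w.trans w')) M := by
  rw [← compOp_mul]
  exact h.mul_left h'

theorem swap_commute_prodOp (a b ι : ℝ) (c : ℂ) (i j : Fin r) :
    Commute (compOp (swapEquiv i j)) (prodOp r a b ι c) := by
  have key : ∀ (d : ℕ) (i j : Fin r), (i : ℕ) + (d + 1) = j →
      Commute (compOp (swapEquiv i j)) (prodOp r a b ι c) := by
    intro d
    induction d with
    | zero => exact fun i j h => swap_commute_prodOp_of_succ a b ι c h
    | succ d ih =>
      intro i j h
      have hlt : (i : ℕ) + (d + 1) < r := by have := j.2; omega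
      set k : Fin r := ⟨i + (d + 1), hlt⟩ with hk
      have h1 := ih i k rfl
      have h2 := swap_commute_prodOp_of_succ a b ι c (i := k) (j := j) (by simp [hk]; omega)
      have hik : i ≠ k := by intro hh; have := congrArg Fin.val hh; simp [hk] at this
      have hij : i ≠ j := by intro hh; have := congrArg Fin.val hh; omega
      have e : swapEquiv i j = ((swapEquiv k j).trans (swapEquiv i k)).trans (swapEquiv k j) := by
        ext t m
        change t _ = t _
        rw [Equiv.swap_comm i j, ← Equiv.swap_mul_swap_mul_swap hik hij]
        rfl
      rw [e]
      exact commute_compOp_trans (commute_compOp_trans h2 h1) h2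
  rcases lt_trichotomy i j with h | h | h
  · rw [Fin.lt_def] at h
    exact key (j - i - 1) i j (by omega)
  · rw [h]
    have : swapEquiv j j = ContinuousLinearEquiv.refl ℝ (Fin r → ℝ) := by
      ext t m
      change t _ = t _
      simp
    rw [this, compOp_refl]
    exact Commute.one_left _
  · rw [Fin.lt_def] at h
    have := key (i - j - 1) j i (by omega)
    have e : swapEquiv i j = swapEquiv j i := by
      ext t m
      change t _ = t _
      rw [Equiv.swap_comm]
    rwa [e]

theorem sign_commute_prodOp (a b ι : ℝ) (c : ℂ) (i : Fin r) :
    Commute (compOp (signEquiv i)) (prodOp r a b ι c) := by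
  have hr : r - 1 < r := by have := i.2; omega
  set n : Fin r := ⟨r - 1, hr⟩ with hn
  have h1 := swap_commute_prodOp a b ι c i n
  have h2 := sign_commute_prodOp_of_last a b ι c (n := n) (by simp [hn]; omega)
  have e : signEquiv i = ((swapEquiv i n).trans (signEquiv n)).trans (swapEquiv i n) := by
    ext t k
    simp only [ContinuousLinearEquiv.trans_apply, signEquiv_apply, swapEquiv_apply, reflSign,
      reflSwap, Equiv.swap_apply_self]
    have : Equiv.swap i n k = n ↔ k = i := by
      rw [Equiv.swap_apply_eq_iff, Equiv.swap_apply_right]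
    simp only [this]
  rw [e]
  exact commute_compOp_trans (commute_compOp_trans h1 h2) h1

theorem reflSignedSwap_eq {i j : Fin r} (h : i ≠ j) (t : Fin r → ℝ) :
    reflSignedSwap i j t = reflSign i (reflSign j (reflSwap i j t)) := by
  funext k
  simp only [reflSignedSwap, reflSign, reflSwap, Equiv.swap_apply_def]
  by_cases h1 : k = i
  · subst h1; simp [h]
  · by_cases h2 : k = j
    · subst h2; simp [h1]
    · simp [h1, h2]

/-- `∏_j (D_j ^ 2 - c ^ 2)` commutes with `t ↦ -t`. -/
theorem neg_commute_prodOp (a b ι : ℝ) (c : ℂ) :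
    Commute (compOp (ContinuousLinearEquiv.neg ℝ)) (prodOp r a b ι c) := by
  -- sign changes on a set `s` of coordinates, by induction on `s`
  have key : ∀ s : Finset (Fin r), ∃ w : (Fin r → ℝ) ≃L[ℝ] (Fin r → ℝ),
      (∀ t k, w t k = if k ∈ s then -t k else t k) ∧ Commute (compOp w) (prodOp r a b ι c) := by
    intro s
    induction s using Finset.induction_on with
    | empty =>
      refine ⟨ContinuousLinearEquiv.refl ℝ _, fun t k => by simp, ?_⟩
      rw [compOp_refl]
      exact Commute.one_left _
    | insert i s hi ih =>
      obtain ⟨w, hw, hc⟩ := ih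
      refine ⟨w.trans (signEquiv i), fun t k => ?_,
        commute_compOp_trans hc (sign_commute_prodOp a b ι c i)⟩
      rw [ContinuousLinearEquiv.trans_apply, signEquiv_apply]
      by_cases h : k = i
      · subst h; simp [reflSign, hw, hi]
      · simp [reflSign, hw, h]
  obtain ⟨w, hw, hc⟩ := key Finset.univ
  have e : ContinuousLinearEquiv.neg ℝ = w := by
    ext t k
    simp [hw]
  rwa [e]

theorem prodOp_mem_invariant (a b ι : ℝ) (c : ℂ) {f : TF r}
    (hf : f ∈ invariantTestFunctions r a b ι) :
    prodOp r a b ι c f ∈ invariantTestFunctions r a b ι := by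
  have key : ∀ w : (Fin r → ℝ) ≃L[ℝ] (Fin r → ℝ), Commute (compOp w) (prodOp r a b ι c) →
      (∀ t, f (w t) = f t) → ∀ t, prodOp r a b ι c f (w t) = prodOp r a b ι c f t := by
    intro w hw hfw t
    have h1 : compOp w f = f := by ext t; exact hfw t
    have h2 : compOp w (prodOp r a b ι c f) = prodOp r a b ι c (compOp w f) :=
      congrArg (fun A : TF r →L[ℂ] TF r => A f) hw
    rw [h1] at h2
    exact congrArg (fun g : TF r => g t) h2
  intro w hw
  induction hw using Subgroup.closure_induction with
  | mem w hw =>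
    have hfw : ∀ t, f (w t) = f t := hf w (Subgroup.subset_closure hw)
    rcases hw with (⟨_, i, j, hij, rfl⟩ | ⟨_, i, j, hij, rfl⟩) | ⟨_, i, rfl⟩
    · exact key (swapEquiv i j) (swap_commute_prodOp a b ι c i j) hfw
    · have e : ∀ t, ((swapEquiv i j).trans (signEquiv j)).trans (signEquiv i) t =
          reflSignedSwap i j t := by
        intro t
        rw [reflSignedSwap_eq hij, ContinuousLinearEquiv.trans_apply,
          ContinuousLinearEquiv.trans_apply, signEquiv_apply, signEquiv_apply, swapEquiv_apply]
      intro t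
      have := key _ (commute_compOp_trans (commute_compOp_trans
        (swap_commute_prodOp a b ι c i j) (sign_commute_prodOp a b ι c j))
        (sign_commute_prodOp a b ι c i)) (fun t => by rw [e]; exact hfw t) t
      rw [e] at this
      exact this
    · intro t
      have := key _ (sign_commute_prodOp a b ι c i)
        (fun t => by rw [signEquiv_apply]; exact hfw t) t
      rw [signEquiv_apply] at this
      exact this
  | one => exact fun t => rfl
  | mul x y _ _ hx hy => exact fun t => (hx (y t)).trans (hy t)
  | inv x _ hx =>
    intro t
    rw [← hx (x⁻¹ t), ← Equiv.Perm.mul_apply, mul_inv_cancel, Equiv.Perm.one_apply]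

/-- The operator `∏_j (D_j ^ 2 - c ^ 2)` on invariant test functions. -/
def invOp (r : ℕ) (a b ι : ℝ) (c : ℂ) :
    invariantTestFunctions r a b ι →L[ℂ] invariantTestFunctions r a b ι :=
  ((prodOp r a b ι c).comp (invariantTestFunctions r a b ι).subtypeL).codRestrict _
    fun f => prodOp_mem_invariant a b ι c f.2

end Product

section RegularPoints

variable {r : ℕ}

theorem reflSwap_mem_regularSet (i j : Fin r) {t : Fin r → ℝ} (ht : t ∈ regularSet r) :
    reflSwap i j t ∈ regularSet r :=
  ⟨fun _ => ht.1 _, fun _ _ h => ht.2 _ _ ((Equiv.swap i j).injective.ne h)⟩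

theorem reflSign_mem_regularSet (i : Fin r) {t : Fin r → ℝ} (ht : t ∈ regularSet r) :
    reflSign i t ∈ regularSet r := by
  refine ⟨fun k => ?_, fun k l h => ?_⟩
  · have := ht.1 k
    by_cases h : k = i <;> simp_all [reflSign]
  · have := ht.2 k l h
    by_cases h1 : k = i
    · have h2 : l ≠ i := fun hh => h (h1.trans hh.symm)
      simp only [reflSign, h1, h2, if_true, if_false]
      rw [h1] at this
      exact ⟨fun hh => this.2 (by linarith), fun hh => this.1 (by linarith)⟩
    · by_cases h2 : l = i
      · simp only [reflSign, h1, h2, if_true, if_false]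
        rw [h2] at this
        exact ⟨fun hh => this.2 (by linarith), fun hh => this.1 (by linarith)⟩
      · simpa only [reflSign, h1, h2, if_false] using this

theorem reflSignedSwap_mem_regularSet {i j : Fin r} (h : i ≠ j) {t : Fin r → ℝ}
    (ht : t ∈ regularSet r) : reflSignedSwap i j t ∈ regularSet r := by
  rw [reflSignedSwap_eq h]
  exact reflSign_mem_regularSet i (reflSign_mem_regularSet j (reflSwap_mem_regularSet i j ht))

theorem reflSwap_comm (i j : Fin r) (t : Fin r → ℝ) : reflSwap i j t = reflSwap j i t := by
  funext k; simp only [reflSwap, Equiv.swap_comm]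

theorem pairOp_apply {j k : Fin r} (f : TF r) {t : Fin r → ℝ} (ht : t ∈ regularSet r) :
    pairOp j k f t =
      -(if k < j then (coef (t k - t j) : ℂ) * (f t - f (reflSwap k j t)) else 0)
      + (if j < k then (coef (t j - t k) : ℂ) * (f t - f (reflSwap j k t)) else 0)
      + if k ≠ j then (coef (t j + t k) : ℂ) * (f t - f (reflSignedSwap j k t)) else 0 := by
  rcases lt_trichotomy j k with h | h | h
  · rw [pairOp_of_lt h, add_apply]
    change dp j k f t + dm j k f t = _
    rw [dm_apply h.ne f (ht.2 _ _ h.ne).1,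
      dp_apply h.ne f (ht.2 _ _ h.ne).2, if_neg h.not_gt, if_pos h, if_pos h.ne']
    ring
  · rw [h, pairOp_self]; simp
  · rw [pairOp_of_gt h, sub_apply]
    change dp k j f t - dm k j f t = _
    rw [dm_apply h.ne f (ht.2 _ _ h.ne).1, dp_symm,
      dp_apply h.ne' f (ht.2 _ _ h.ne').2, if_neg h.not_gt, if_pos h, if_pos h.ne]
    ring

/-- On the regular set, the Cherednik operators on test functions are given by their formula. -/
theorem cherOp_apply (a b ι : ℝ) (j : Fin r) (f : TF r) {t : Fin r → ℝ} (ht : t ∈ regularSet r) :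
    cherOp a b ι j f t = cherednik r a b ι j f t := by
  have e1 : Finset.Iio j = Finset.univ.filter (· < j) := by ext; simp
  have e2 : Finset.Ioi j = Finset.univ.filter (j < ·) := by ext; simp
  have e3 : Finset.univ.erase j = Finset.univ.filter (· ≠ j) := by ext; simp
  have hs : (∑ k, pairOp j k) f t = ∑ k, pairOp j k f t := by
    rw [sum_apply]
    exact map_sum (⟨⟨fun g : TF r => g t, rfl⟩, fun _ _ => rfl⟩ : TF r →+ ℂ) _ _
  unfold cherOp singleOp cherednik
  rw [e1, e2, e3, Finset.sum_filter, Finset.sum_filter, Finset.sum_filter]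
  change (dirOp (Pi.single j 1) f t + (2 * ι : ℂ) * dl j f t + (2 * b : ℂ) * ds j f t)
    + (a : ℂ) * (∑ k, pairOp j k) f t - (rho r a b ι j : ℂ) * f t = _
  rw [hs, dirOp_apply, dl_apply j f (ht.1 j), ds_apply j f (ht.1 j),
    Finset.sum_congr rfl fun k _ => pairOp_apply f ht, Finset.sum_add_distrib,
    Finset.sum_add_distrib, Finset.sum_neg_distrib]
  have e4 : (1 / (1 - Real.exp (-4 * t j)) : ℝ) = coef (2 * t j) := by
    rw [coef]; congr 3; ring
  rw [e4]
  simp only [coef]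
  ring

theorem cherednik_congr (a b ι : ℝ) (j : Fin r) {f g : (Fin r → ℝ) → ℂ}
    (h : Set.EqOn f g (regularSet r)) :
    Set.EqOn (cherednik r a b ι j f) (cherednik r a b ι j g) (regularSet r) := by
  intro t ht
  have h0 : f =ᶠ[nhds t] g := by
    filter_upwards [(isOpen_regularSet r).mem_nhds ht] with s hs using h hs
  unfold cherednik
  rw [h0.fderiv_eq, h ht, h (reflSign_mem_regularSet j ht)]
  rw [Finset.sum_congr rfl fun k _ => by rw [h (reflSwap_mem_regularSet k j ht)],
    Finset.sum_congr (s₁ := Finset.Ioi j) rfl fun k _ => by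
      rw [h (reflSwap_mem_regularSet j k ht)],
    Finset.sum_congr (s₁ := Finset.univ.erase j) rfl fun k hk => by
      rw [h (reflSignedSwap_mem_regularSet (Finset.ne_of_mem_erase hk).symm ht)]]

theorem sqOp_apply (a b ι : ℝ) (δ : ℂ) (j : Fin r) (f : TF r) {g : (Fin r → ℝ) → ℂ}
    (h : Set.EqOn f g (regularSet r)) :
    Set.EqOn (sqOp a b ι (δ + ((ι + b + a * ((r : ℝ) - 1) : ℝ) : ℂ)) j f)
      (opFactor r a b ι δ j g) (regularSet r) := by
  intro t ht
  have h1 : Set.EqOn (cherOp a b ι j f) (cherednik r a b ι j g) (regularSet r) := fun s hs =>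
    (cherOp_apply a b ι j f hs).trans (cherednik_congr a b ι j h hs)
  change cherOp a b ι j (cherOp a b ι j f) t - _ * f t = _
  rw [opFactor, cherOp_apply a b ι j _ ht, cherednik_congr a b ι j h1 ht, h ht]

/-- On the regular set, `𝓜_δ` on test functions is given by its formula. -/
theorem prodOp_apply (a b ι : ℝ) (δ : ℂ) (f : TF r) {t : Fin r → ℝ} (ht : t ∈ regularSet r) :
    prodOp r a b ι (δ + ((ι + b + a * ((r : ℝ) - 1) : ℝ) : ℂ)) f t = opM r a b ι δ f t := by
  have key : ∀ l : List (Fin r), Set.EqOn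
      ((l.map (sqOp a b ι (δ + ((ι + b + a * ((r : ℝ) - 1) : ℝ) : ℂ)))).prod f)
      (l.foldr (fun j g => opFactor r a b ι δ j g) f) (regularSet r) := by
    intro l
    induction l with
    | nil => exact fun _ _ => rfl
    | cons j l ih =>
      rw [List.map_cons, List.prod_cons, List.foldr_cons]
      exact sqOp_apply a b ι δ j _ ih
  exact key _ ht

end RegularPoints

/-! ### Local integrability -/

section LocallyIntegrable

variable {r : ℕ}

theorem locallyIntegrable_prod {φ : Fin r → ℝ → ℝ} (h : ∀ j, LocallyIntegrable (φ j) volume) :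
    LocallyIntegrable (fun t : Fin r → ℝ => ∏ j, φ j (t j)) volume := by
  rw [locallyIntegrable_iff]
  intro K hK
  obtain ⟨R, hR⟩ := hK.isBounded.subset_closedBall 0
  have h1 : Integrable (fun t : Fin r → ℝ => ∏ j, (Set.Icc (-R) R).indicator (φ j) (t j))
      volume := by
    refine Integrable.fintype_prod fun j => ?_
    rw [integrable_indicator_iff measurableSet_Icc]
    exact (h j).integrableOn_isCompact isCompact_Icc
  refine (h1.integrableOn (s := K)).congr_fun (fun t ht => ?_) hK.measurableSet
  refine Finset.prod_congr rfl fun j _ => ?_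
  rw [Set.indicator_of_mem]
  have h2 := hR ht
  rw [mem_closedBall_zero_iff] at h2
  exact abs_le.1 ((norm_le_pi_norm t j).trans h2)

/-- A nonzero linear form can be completed to a system of coordinates. -/
theorem locallyIntegrable_comp_linear {φ : ℝ → ℝ} (h : LocallyIntegrable φ volume)
    {l : (Fin r → ℝ) →L[ℝ] ℝ} {v : Fin r → ℝ} (hl : l v = 2) :
    LocallyIntegrable (fun t => φ (l t)) volume := by
  obtain ⟨i, hi⟩ : ∃ i, l (Pi.single i 1) ≠ 0 := by
    by_contra! hcon
    have : l v = 0 := by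
      rw [pi_eq_sum_univ' v, map_sum]
      refine Finset.sum_eq_zero fun i _ => ?_
      rw [map_smul]
      rw [hcon, smul_zero]
    rw [hl] at this
    norm_num at this
  -- the change of variables that replaces the coordinate `i` by `l t`
  let A : (Fin r → ℝ) →ₗ[ℝ] (Fin r → ℝ) :=
    LinearMap.pi fun k => if k = i then (l : (Fin r → ℝ) →ₗ[ℝ] ℝ) else LinearMap.proj k
  have hA : ∀ t k, A t k = if k = i then l t else t k := by
    intro t k
    simp only [A, LinearMap.pi_apply]
    split_ifs <;> rfl
  have hinj : Function.Injective A := by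
    rw [← LinearMap.ker_eq_bot, LinearMap.ker_eq_bot']
    intro t ht
    have h1 : ∀ k, k ≠ i → t k = 0 := by
      intro k hk
      have := congrFun ht k
      rwa [hA, if_neg hk] at this
    have h2 : t = t i • Pi.single i 1 := by
      funext k
      by_cases hk : k = i
      · subst hk; simp
      · simp [h1 k hk, hk]
    have h3 : l t = 0 := by
      have := congrFun ht i
      rwa [hA, if_pos rfl] at this
    rw [h2, map_smul, smul_eq_mul, mul_eq_zero] at h3
    rw [h2, h3.resolve_right hi, zero_smul]
  let e : (Fin r → ℝ) ≃L[ℝ] (Fin r → ℝ) :=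
    (LinearEquiv.ofInjectiveEndo A hinj).toContinuousLinearEquiv
  have he : ∀ t, e t = A t := fun t => rfl
  have hdet : LinearMap.det A ≠ 0 := by
    have : LinearMap.det A = LinearEquiv.det (LinearEquiv.ofInjectiveEndo A hinj) := by
      rw [LinearEquiv.coe_det]
      congr 1
    rw [this]
    exact Units.ne_zero _
  have hmap : Measure.map e volume = ENNReal.ofReal |(LinearMap.det A)⁻¹| • volume := by
    rw [← Real.map_linearMap_volume_pi_eq_smul_volume_pi hdet]
    rfl
  have h0 : LocallyIntegrable (fun t : Fin r → ℝ => φ (t i)) volume := by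
    have := locallyIntegrable_prod (r := r)
      (φ := fun k => if k = i then φ else fun _ => 1) (fun k => by
        by_cases hk : k = i
        · simpa [hk] using h
        · simpa [hk] using locallyIntegrable_const (1 : ℝ))
    refine this.congr (Filter.Eventually.of_forall fun t => ?_)
    simp only
    rw [Finset.prod_eq_single i]
    · simp
    · intro k _ hk; simp [hk]
    · simp
  have h4 : LocallyIntegrable (fun t : Fin r → ℝ => φ (t i))
      (Measure.map e.toHomeomorph volume) := by
    change LocallyIntegrable _ (Measure.map e volume)
    rw [hmap]
    intro x
    obtain ⟨s, hs, hs'⟩ := h0 x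
    refine ⟨s, hs, ?_⟩
    rw [IntegrableOn, Measure.restrict_smul]
    exact hs'.smul_measure ENNReal.ofReal_ne_top
  rw [locallyIntegrable_map_homeomorph] at h4
  refine h4.congr (Filter.Eventually.of_forall fun t => ?_)
  change φ (e t i) = _
  rw [he, hA, if_pos rfl]

theorem abs_le_abs_sinh (x : ℝ) : |x| ≤ |Real.sinh x| := by
  rcases le_total 0 x with h | h
  · rw [abs_of_nonneg h, abs_of_nonneg (Real.sinh_nonneg_iff.2 h)]
    exact Real.self_le_sinh_iff.2 h
  · rw [abs_of_nonpos h, abs_of_nonpos (Real.sinh_nonpos_iff.2 h), neg_le_neg_iff]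
    exact Real.sinh_le_self_iff.2 h

theorem measurable_abs_sinh_rpow (s : ℝ) : Measurable fun x : ℝ => |2 * Real.sinh x| ^ s :=
  ((Real.measurable_sinh.const_mul 2).abs).pow_const s

theorem locallyIntegrable_abs_sinh_rpow {s : ℝ} (hs : -1 < s) :
    LocallyIntegrable (fun x : ℝ => |2 * Real.sinh x| ^ s) volume := by
  rcases le_or_gt 0 s with h | h
  · refine Continuous.locallyIntegrable ?_
    exact ((continuous_const.mul Real.continuous_sinh).abs).rpow_const fun x => Or.inr h
  · refine locallyIntegrable_of_norm_le_rpow (C := 1) (α := -s) (by simp) (by simp; linarith) ?_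
      (measurable_abs_sinh_rpow s).aestronglyMeasurable
    have : ∀ᵐ x : ℝ, x ≠ 0 := by simp [ae_iff]
    filter_upwards [this] with x hx
    rw [Real.norm_of_nonneg (by positivity), neg_neg, one_mul, Real.norm_eq_abs]
    refine Real.rpow_le_rpow_of_nonpos (abs_pos.2 hx) ?_ h.le
    rw [abs_mul, abs_two]
    have := abs_le_abs_sinh x
    have := abs_nonneg x
    linarith

/-- The factor `|sinh l| ^ κ` of the density compensates the pole of `coth l`, because
`κ - 1 > -1`. -/
theorem locallyIntegrable_rpow_mul_coth {κ : ℝ} (hκ : 0 < κ) {l : (Fin r → ℝ) →L[ℝ] ℝ}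
    {v : Fin r → ℝ} (hl : l v = 2) {R : (Fin r → ℝ) → ℝ} (hR : Continuous R) :
    LocallyIntegrable (fun t => (|2 * Real.sinh (l t)| ^ κ * R t) *
      (Real.cosh (l t) / Real.sinh (l t))) volume := by
  have h1 := locallyIntegrable_comp_linear
    (locallyIntegrable_abs_sinh_rpow (s := κ - 1) (by linarith)) hl
  have h2 : Continuous fun t => 2 * Real.cosh (l t) * R t :=
    (continuous_const.mul (Real.continuous_cosh.comp l.continuous)).mul hR
  have h3 := (locallyIntegrableOn_univ.2 h1).mul_continuousOn h2.continuousOn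
    isOpen_univ.isLocallyClosed
  rw [locallyIntegrableOn_univ] at h3
  refine h3.mono ?_ (Filter.Eventually.of_forall fun t => ?_)
  · exact ((((measurable_abs_sinh_rpow κ).comp l.continuous.measurable).mul hR.measurable).mul
      ((Real.measurable_cosh.comp l.continuous.measurable).div
        (Real.measurable_sinh.comp l.continuous.measurable))).aestronglyMeasurable
  · rcases eq_or_ne (Real.sinh (l t)) 0 with h0 | h0
    · simp [h0]
      positivity
    · have h5 : 0 < |2 * Real.sinh (l t)| := abs_pos.2 (mul_ne_zero two_ne_zero h0)
      have h6 : |Real.sinh (l t)| ≠ 0 := abs_ne_zero.2 h0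
      rw [norm_mul, norm_mul, norm_mul, norm_mul, norm_mul, norm_div, Real.rpow_sub h5,
        Real.rpow_one]
      simp only [Real.norm_eq_abs, abs_div, abs_abs, abs_mul, abs_two]
      apply le_of_eq
      field_simp

end LocallyIntegrable

/-! ### The density of `dμ` -/

section Density

variable {r : ℕ}

/-- Twice the difference of the `cosh 2t_i`, the product of `2 sinh (t_i - t_k)` and
`2 sinh (t_i + t_k)`. -/
def chDiff (i k : Fin r) (t : Fin r → ℝ) : ℝ :=
  2 * Real.cosh (2 * t i) - 2 * Real.cosh (2 * t k)

theorem chDiff_eq (i k : Fin r) (t : Fin r → ℝ) :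
    chDiff i k t = (2 * Real.sinh (t i - t k)) * (2 * Real.sinh (t i + t k)) := by
  rw [chDiff, Real.cosh_two_mul, Real.cosh_two_mul, Real.sinh_sub, Real.sinh_add]
  have h1 := Real.cosh_sq (t i)
  have h2 := Real.cosh_sq (t k)
  linear_combination (2 + 4 * Real.sinh (t k) ^ 2) * h1 - (2 + 4 * Real.sinh (t i) ^ 2) * h2

theorem chDiff_symm (i k : Fin r) (t : Fin r → ℝ) : chDiff k i t = -chDiff i k t := by
  unfold chDiff; ring

theorem sinh_ne_zero {x : ℝ} (hx : x ≠ 0) : Real.sinh x ≠ 0 := by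
  rwa [ne_eq, Real.sinh_eq_zero]

theorem chDiff_ne_zero {i k : Fin r} (h : i ≠ k) {t : Fin r → ℝ} (ht : t ∈ regularSet r) :
    chDiff i k t ≠ 0 := by
  rw [chDiff_eq]
  have h1 : t i - t k ≠ 0 := sub_ne_zero.2 (ht.2 i k h).1
  have h2 : t i + t k ≠ 0 := fun hh => (ht.2 i k h).2 (eq_neg_of_add_eq_zero_left hh)
  have := sinh_ne_zero h1
  have := sinh_ne_zero h2
  positivity

/-- The logarithm of the density at regular points, as a sum over ordered pairs. Absolute values
are not needed, since `Real.log` is an even function, and the diagonal terms vanish because of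
`Real.log 0 = 0`. -/
def logDensity (r : ℕ) (a b ι : ℝ) (t : Fin r → ℝ) : ℝ :=
  (∑ i, (ι * Real.log (2 * Real.sinh (2 * t i)) + 2 * b * Real.log (2 * Real.sinh (t i)))) +
    a / 2 * ∑ i, ∑ k, Real.log (chDiff i k t)

theorem sum_Ioi_of_symm {f : Fin r → Fin r → ℝ} (h0 : ∀ i, f i i = 0) (h : ∀ i k, f i k = f k i) :
    ∑ i, ∑ k ∈ Finset.Ioi i, f i k = (∑ i, ∑ k, f i k) / 2 := by
  have e1 : ∀ i, ∑ k, f i k = ∑ k ∈ Finset.Ioi i, f i k + ∑ k ∈ Finset.Iio i, f i k := by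
    intro i
    have hd : Disjoint (Finset.Ioi i) (Finset.Iio i) := by
      rw [Finset.disjoint_left]
      intro k h1 h2
      rw [Finset.mem_Ioi] at h1
      rw [Finset.mem_Iio] at h2
      exact lt_asymm h1 h2
    rw [← Finset.sum_union hd]
    symm
    refine Finset.sum_subset (Finset.subset_univ _) fun k _ hk => ?_
    rw [Finset.mem_union, Finset.mem_Ioi, Finset.mem_Iio, not_or, not_lt, not_lt] at hk
    rw [le_antisymm hk.1 hk.2, h0]
  have e2 : ∑ i, ∑ k ∈ Finset.Iio i, f i k = ∑ i, ∑ k ∈ Finset.Ioi i, f i k := by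
    rw [Finset.sum_comm' (t' := Finset.univ) (s' := fun k => Finset.Ioi k) (by simp)]
    exact Finset.sum_congr rfl fun i _ => Finset.sum_congr rfl fun k _ => h k i
  rw [Finset.sum_congr rfl fun i _ => e1 i, Finset.sum_add_distrib, e2]
  ring

theorem density_eq_exp (a b ι : ℝ) {t : Fin r → ℝ} (ht : t ∈ regularSet r) :
    density r a b ι t = Real.exp (logDensity r a b ι t) := by
  have hpow : ∀ {x : ℝ} (s : ℝ), x ≠ 0 → |x| ^ s = Real.exp (s * Real.log x) := by
    intro x s hx
    rw [Real.rpow_def_of_pos (abs_pos.2 hx), Real.log_abs, mul_comm]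
  have h1 : ∑ i, ∑ k ∈ Finset.Ioi i, a * Real.log (chDiff i k t) =
      a / 2 * ∑ i, ∑ k, Real.log (chDiff i k t) := by
    rw [sum_Ioi_of_symm (f := fun i k => a * Real.log (chDiff i k t))
      (fun i => by simp [chDiff]) (fun i k => by rw [chDiff_symm k i, Real.log_neg_eq_log])]
    simp only [← Finset.mul_sum]
    ring
  rw [logDensity, ← h1, Real.exp_add, Real.exp_sum, Real.exp_sum]
  unfold density
  congr 1
  · refine Finset.prod_congr rfl fun i _ => ?_
    rw [Real.exp_add, hpow _ (mul_ne_zero two_ne_zero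
      (sinh_ne_zero (mul_ne_zero two_ne_zero (ht.1 i)))),
      hpow _ (mul_ne_zero two_ne_zero (sinh_ne_zero (ht.1 i)))]
  · refine Finset.prod_congr rfl fun i _ => ?_
    rw [Real.exp_sum]
    refine Finset.prod_congr rfl fun k hk => ?_
    rw [← Real.mul_rpow (abs_nonneg _) (abs_nonneg _), ← abs_mul, ← chDiff_eq,
      hpow _ (chDiff_ne_zero (Finset.mem_Ioi.1 hk).ne ht)]

theorem logDensity_reflSwap (a b ι : ℝ) (i j : Fin r) (t : Fin r → ℝ) :
    logDensity r a b ι (reflSwap i j t) = logDensity r a b ι t := by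
  unfold logDensity
  have h1 := Equiv.sum_comp (Equiv.swap i j) fun i => (ι * Real.log (2 * Real.sinh (2 * t i)) +
    2 * b * Real.log (2 * Real.sinh (t i)))
  have h2 := Equiv.sum_comp (Equiv.swap i j) fun i => ∑ k, Real.log (chDiff i k t)
  rw [← h1, ← h2]
  congr 2
  refine Finset.sum_congr rfl fun m _ => ?_
  exact Equiv.sum_comp (Equiv.swap i j) fun k => Real.log (chDiff (Equiv.swap i j m) k t)

theorem logDensity_reflSign (a b ι : ℝ) (i : Fin r) (t : Fin r → ℝ) :
    logDensity r a b ι (reflSign i t) = logDensity r a b ι t := by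
  unfold logDensity
  have h1 : ∀ k, Real.cosh (2 * reflSign i t k) = Real.cosh (2 * t k) := by
    intro k
    by_cases h : k = i <;> simp [reflSign, h]
  have h2 : ∀ k, Real.log (2 * Real.sinh (2 * reflSign i t k)) =
      Real.log (2 * Real.sinh (2 * t k)) := by
    intro k
    by_cases h : k = i <;> simp [reflSign, h, Real.log_neg_eq_log]
  have h3 : ∀ k, Real.log (2 * Real.sinh (reflSign i t k)) = Real.log (2 * Real.sinh (t k)) := by
    intro k
    by_cases h : k = i <;> simp [reflSign, h, Real.log_neg_eq_log]
  simp only [chDiff, h1, h2, h3]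

theorem logDensity_reflSignedSwap (a b ι : ℝ) {i j : Fin r} (h : i ≠ j) (t : Fin r → ℝ) :
    logDensity r a b ι (reflSignedSwap i j t) = logDensity r a b ι t := by
  rw [reflSignedSwap_eq h, logDensity_reflSign, logDensity_reflSign, logDensity_reflSwap]

theorem density_nonneg (a b ι : ℝ) (t : Fin r → ℝ) : 0 ≤ density r a b ι t := by
  unfold density
  positivity

theorem continuous_abs_sinh_rpow {s : ℝ} (hs : 0 ≤ s) :
    Continuous fun x : ℝ => |2 * Real.sinh x| ^ s :=
  ((continuous_const.mul Real.continuous_sinh).abs).rpow_const fun _ => Or.inr hs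

theorem continuous_density {a b ι : ℝ} (ha : 0 ≤ a) (hb : 0 ≤ b) (hι : 0 ≤ ι) :
    Continuous (density r a b ι) := by
  unfold density
  refine Continuous.mul (continuous_finsetProd _ fun j _ => ?_)
    (continuous_finsetProd _ fun i _ => continuous_finsetProd _ fun j _ => ?_)
  · exact ((continuous_abs_sinh_rpow hι).comp
      (by fun_prop : Continuous fun t : Fin r → ℝ => 2 * t j)).mul
      ((continuous_abs_sinh_rpow (by linarith : 0 ≤ 2 * b)).comp (continuous_apply j))
  · exact ((continuous_abs_sinh_rpow ha).comp
      (by fun_prop : Continuous fun t : Fin r → ℝ => t i - t j)).mul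
      ((continuous_abs_sinh_rpow ha).comp (by fun_prop : Continuous fun t : Fin r → ℝ => t i + t j))

/-- The density is the product of a power for a long root and a continuous function. -/
theorem density_long {a b ι : ℝ} (ha : 0 ≤ a) (hb : 0 ≤ b) (hι : 0 ≤ ι) (j : Fin r) :
    ∃ R : (Fin r → ℝ) → ℝ, Continuous R ∧
      ∀ t, density r a b ι t = |2 * Real.sinh (2 * t j)| ^ ι * R t := by
  refine ⟨fun t => |2 * Real.sinh (t j)| ^ (2 * b) *
    (∏ j ∈ Finset.univ.erase j, |2 * Real.sinh (2 * t j)| ^ ι * |2 * Real.sinh (t j)| ^ (2 * b)) *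
    ∏ i, ∏ j ∈ Finset.Ioi i,
      |2 * Real.sinh (t i - t j)| ^ a * |2 * Real.sinh (t i + t j)| ^ a, ?_, fun t => ?_⟩
  · have h1 := continuous_abs_sinh_rpow hι
    have h0 : 0 ≤ 2 * b := by linarith
    have h2 := continuous_abs_sinh_rpow h0
    have h3 := continuous_abs_sinh_rpow ha
    fun_prop
  · unfold density
    rw [← Finset.mul_prod_erase _ _ (Finset.mem_univ j)]
    ring

theorem density_short {a b ι : ℝ} (ha : 0 ≤ a) (hb : 0 ≤ b) (hι : 0 ≤ ι) (j : Fin r) :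
    ∃ R : (Fin r → ℝ) → ℝ, Continuous R ∧
      ∀ t, density r a b ι t = |2 * Real.sinh (t j)| ^ (2 * b) * R t := by
  refine ⟨fun t => |2 * Real.sinh (2 * t j)| ^ ι *
    (∏ j ∈ Finset.univ.erase j, |2 * Real.sinh (2 * t j)| ^ ι * |2 * Real.sinh (t j)| ^ (2 * b)) *
    ∏ i, ∏ j ∈ Finset.Ioi i,
      |2 * Real.sinh (t i - t j)| ^ a * |2 * Real.sinh (t i + t j)| ^ a, ?_, fun t => ?_⟩
  · have h1 := continuous_abs_sinh_rpow hι
    have h0 : 0 ≤ 2 * b := by linarith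
    have h2 := continuous_abs_sinh_rpow h0
    have h3 := continuous_abs_sinh_rpow ha
    fun_prop
  · unfold density
    rw [← Finset.mul_prod_erase _ _ (Finset.mem_univ j)]
    ring

theorem density_pair {a b ι : ℝ} (ha : 0 ≤ a) (hb : 0 ≤ b) (hι : 0 ≤ ι) {i k : Fin r}
    (hik : i < k) : ∃ R : (Fin r → ℝ) → ℝ, Continuous R ∧
      ∀ t, density r a b ι t =
        |2 * Real.sinh (t i - t k)| ^ a * |2 * Real.sinh (t i + t k)| ^ a * R t := by
  refine ⟨fun t => (∏ j, |2 * Real.sinh (2 * t j)| ^ ι * |2 * Real.sinh (t j)| ^ (2 * b)) *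
    (∏ j ∈ (Finset.Ioi i).erase k,
      |2 * Real.sinh (t i - t j)| ^ a * |2 * Real.sinh (t i + t j)| ^ a) *
    ∏ i ∈ Finset.univ.erase i, ∏ j ∈ Finset.Ioi i,
      |2 * Real.sinh (t i - t j)| ^ a * |2 * Real.sinh (t i + t j)| ^ a, ?_, fun t => ?_⟩
  · have h1 := continuous_abs_sinh_rpow hι
    have h0 : 0 ≤ 2 * b := by linarith
    have h2 := continuous_abs_sinh_rpow h0
    have h3 := continuous_abs_sinh_rpow ha
    fun_prop
  · unfold density
    rw [← Finset.mul_prod_erase _ (fun i => ∏ j ∈ Finset.Ioi i, _) (Finset.mem_univ i),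
      ← Finset.mul_prod_erase _ _ (Finset.mem_Ioi.2 hik)]
    ring

/-- The hyperbolic cotangent. -/
def coth (x : ℝ) : ℝ := Real.cosh x / Real.sinh x

theorem coth_neg (x : ℝ) : coth (-x) = -coth x := by
  simp [coth, div_neg]

/-- The sum of the terms of the logarithmic derivative that belong to `±ξ_j ± ξ_k`. -/
def pairLog (j k : Fin r) (t : Fin r → ℝ) : ℝ :=
  if k = j then 0 else coth (t j - t k) + coth (t j + t k)

/-- The logarithmic derivative of the density in the direction `j`. -/
def logDeriv (a b ι : ℝ) (j : Fin r) (t : Fin r → ℝ) : ℝ :=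
  2 * ι * coth (2 * t j) + 2 * b * coth (t j) + a * ∑ k, pairLog j k t

theorem pairLog_eq {j k : Fin r} (h : k ≠ j) {t : Fin r → ℝ} (ht : t ∈ regularSet r) :
    pairLog j k t = 4 * Real.sinh (2 * t j) / chDiff j k t := by
  have h1 : t j - t k ≠ 0 := sub_ne_zero.2 (ht.2 j k h.symm).1
  have h2 : t j + t k ≠ 0 := fun hh => (ht.2 j k h.symm).2 (eq_neg_of_add_eq_zero_left hh)
  have h3 := sinh_ne_zero h1
  have h4 := sinh_ne_zero h2
  rw [pairLog, if_neg h, chDiff_eq, coth, coth]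
  have h5 : Real.sinh (2 * t j) = Real.sinh (t j - t k) * Real.cosh (t j + t k) +
      Real.cosh (t j - t k) * Real.sinh (t j + t k) := by
    rw [← Real.sinh_add]; congr 1; ring
  rw [h5]
  field_simp
  ring

theorem hasDerivAt_logDensity (a b ι : ℝ) (j : Fin r) {t : Fin r → ℝ} (ht : t ∈ regularSet r) :
    HasDerivAt (fun s : ℝ => logDensity r a b ι (t + s • Pi.single j 1))
      (logDeriv a b ι j t) 0 := by
  have hc : ∀ i, HasDerivAt (fun s : ℝ => (t + s • (Pi.single j 1 : Fin r → ℝ)) i)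
      (if i = j then 1 else 0) 0 := by
    intro i
    simp only [Pi.add_apply, Pi.smul_apply, smul_eq_mul, Pi.single_apply]
    simpa using ((hasDerivAt_id (0 : ℝ)).mul_const (if i = j then (1 : ℝ) else 0)).const_add (t i)
  have h0 : t + (0 : ℝ) • (Pi.single j 1 : Fin r → ℝ) = t := by simp
  have hs1 : ∀ i, HasDerivAt (fun s : ℝ => Real.log (2 * Real.sinh
      ((t + s • (Pi.single j 1 : Fin r → ℝ)) i))) (if i = j then coth (t j) else 0) 0 := by
    intro i
    have hne := sinh_ne_zero (ht.1 i)
    have := (((hc i).sinh).const_mul 2).log (by rw [h0]; exact mul_ne_zero two_ne_zero hne)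
    rw [h0] at this
    convert this using 1
    split_ifs with h
    · subst h; unfold coth; field_simp
    · simp
  have hs2 : ∀ i, HasDerivAt (fun s : ℝ => Real.log (2 * Real.sinh
      (2 * (t + s • (Pi.single j 1 : Fin r → ℝ)) i)))
      (if i = j then 2 * coth (2 * t j) else 0) 0 := by
    intro i
    have hne := sinh_ne_zero (mul_ne_zero two_ne_zero (ht.1 i))
    have := ((((hc i).const_mul 2).sinh).const_mul 2).log
      (by rw [h0]; exact mul_ne_zero two_ne_zero hne)
    rw [h0] at this
    convert this using 1
    split_ifs with h
    · subst h; unfold coth; field_simp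
    · simp
  have hs3 : ∀ i k, HasDerivAt (fun s : ℝ => Real.log (chDiff i k
      (t + s • (Pi.single j 1 : Fin r → ℝ))))
      ((if i = j then pairLog j k t else 0) + if k = j then pairLog j i t else 0) 0 := by
    intro i k
    by_cases hik : i = k
    · subst hik
      simp only [chDiff, sub_self]
      refine (hasDerivAt_const (0 : ℝ) (Real.log 0)).congr_deriv ?_
      split_ifs with h
      · simp [pairLog, h]
      · simp
    · have hne := chDiff_ne_zero hik ht
      have hd : HasDerivAt (fun s : ℝ => chDiff i k (t + s • (Pi.single j 1 : Fin r → ℝ))) _ 0 :=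
        ((((hc i).const_mul 2).cosh).const_mul 2).fun_sub
          ((((hc k).const_mul 2).cosh).const_mul 2)
      have := hd.log (by rw [h0]; exact hne)
      rw [h0] at this
      refine this.congr_deriv ?_
      by_cases hi : i = j
      · subst hi
        have hk : k ≠ i := Ne.symm hik
        simp only [if_true, hk, if_false, pairLog_eq hk ht, add_zero]
        unfold chDiff
        congr 1
        ring
      · by_cases hk : k = j
        · subst hk
          simp only [if_true, hi, if_false, pairLog_eq hi ht, zero_add]
          rw [chDiff_symm, div_neg, ← neg_div]
          unfold chDiff
          congr 1
          ring
        · simp [hi, hk]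
  have h1 := HasDerivAt.fun_sum (u := Finset.univ) fun i (_ : i ∈ Finset.univ) =>
    ((hs2 i).const_mul ι).add ((hs1 i).const_mul (2 * b))
  have h2 := (HasDerivAt.fun_sum (u := Finset.univ) fun i (_ : i ∈ Finset.univ) =>
    HasDerivAt.fun_sum (u := Finset.univ) fun k (_ : k ∈ Finset.univ) => hs3 i k).const_mul (a / 2)
  have h3 := h1.add h2
  refine h3.congr_deriv ?_
  have e2 : ∑ i, ∑ k, (if i = j then pairLog j k t else 0) = ∑ k, pairLog j k t := by
    rw [Finset.sum_comm]
    exact Finset.sum_congr rfl fun i _ => by simp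
  simp only [Finset.sum_add_distrib, e2, ← Finset.mul_sum, Finset.sum_ite_eq',
    Finset.mem_univ, if_true, logDeriv]
  ring

/-- At regular points the density is differentiable along the lines parallel to the axes. -/
theorem hasLineDerivAt_density (a b ι : ℝ) (j : Fin r) {t : Fin r → ℝ} (ht : t ∈ regularSet r) :
    HasLineDerivAt ℝ (density r a b ι) (density r a b ι t * logDeriv a b ι j t) t
      (Pi.single j 1) := by
  have h1 := (hasDerivAt_logDensity a b ι j ht).exp
  simp only [zero_smul, add_zero] at h1
  rw [← density_eq_exp a b ι ht] at h1
  refine h1.congr_of_eventuallyEq ?_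
  have hc : ContinuousAt (fun s : ℝ => t + s • (Pi.single j 1 : Fin r → ℝ)) 0 := by fun_prop
  have := hc.eventually ((isOpen_regularSet r).mem_nhds (by simpa using ht))
  filter_upwards [this] with s hs using density_eq_exp a b ι hs

end Density

/-! ### Integration by parts -/

section Measure

variable {r : ℕ}

theorem volume_ker_eq_zero {l : (Fin r → ℝ) →L[ℝ] ℝ} {v : Fin r → ℝ} (h : l v = 2) :
    volume {t | l t = 0} = 0 := by
  refine Measure.addHaar_submodule volume (LinearMap.ker (l : (Fin r → ℝ) →ₗ[ℝ] ℝ)) fun hh => ?_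
  have : v ∈ LinearMap.ker (l : (Fin r → ℝ) →ₗ[ℝ] ℝ) := by rw [hh]; trivial
  rw [LinearMap.mem_ker] at this
  change l v = 0 at this
  rw [h] at this
  norm_num at this

theorem ae_ne_zero {l : (Fin r → ℝ) →L[ℝ] ℝ} {v : Fin r → ℝ} (h : l v = 2) :
    ∀ᵐ t : Fin r → ℝ, l t ≠ 0 := by
  rw [ae_iff]
  simpa using volume_ker_eq_zero h

theorem ae_mem_regularSet (r : ℕ) : ∀ᵐ t : Fin r → ℝ, t ∈ regularSet r := by
  have h1 : ∀ᵐ t : Fin r → ℝ, ∀ i, t i ≠ 0 := by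
    rw [ae_all_iff]
    intro i
    simpa using ae_ne_zero (short_coroot i)
  have h2 : ∀ᵐ t : Fin r → ℝ, ∀ i j, i ≠ j → t i ≠ t j ∧ t i ≠ -t j := by
    rw [ae_all_iff]
    intro i
    rw [ae_all_iff]
    intro j
    by_cases h : i = j
    · simp [h]
    · filter_upwards [ae_ne_zero (minus_coroot h), ae_ne_zero (plus_coroot h)] with t h3 h4 _
      simp only [sub_apply, add_apply, ContinuousLinearMap.proj_apply] at h3 h4
      exact ⟨sub_ne_zero.1 h3, fun hh => h4 (by rw [hh]; simp)⟩
  filter_upwards [h1, h2] with t h1 h2 using ⟨h1, h2⟩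

theorem ae_mu_mem_regularSet (r : ℕ) (a b ι : ℝ) : ∀ᵐ t ∂mu r a b ι, t ∈ regularSet r :=
  (withDensity_absolutelyContinuous _ _).ae_le (ae_mem_regularSet r)

theorem measurable_density (r : ℕ) (a b ι : ℝ) : Measurable (density r a b ι) := by
  unfold density
  have h1 := measurable_abs_sinh_rpow ι
  have h2 := measurable_abs_sinh_rpow (2 * b)
  have h3 := measurable_abs_sinh_rpow a
  fun_prop

theorem integrable_mu_iff {a b ι : ℝ} {h : (Fin r → ℝ) → ℂ} :
    Integrable h (mu r a b ι) ↔ Integrable (fun t => (density r a b ι t : ℂ) * h t) volume := by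
  unfold mu
  rw [integrable_withDensity_iff_integrable_smul' (measurable_density r a b ι).ennreal_ofReal
    (by simp)]
  refine integrable_congr (Filter.Eventually.of_forall fun t => ?_)
  simp only [ENNReal.toReal_ofReal (density_nonneg a b ι t), Complex.real_smul]

theorem integral_mu {a b ι : ℝ} (h : (Fin r → ℝ) → ℂ) :
    ∫ t, h t ∂mu r a b ι = ∫ t, (density r a b ι t : ℂ) * h t := by
  unfold mu
  rw [integral_withDensity_eq_integral_toReal_smul (measurable_density r a b ι).ennreal_ofReal
    (by simp)]
  refine integral_congr_ae (Filter.Eventually.of_forall fun t => ?_)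
  simp only [ENNReal.toReal_ofReal (density_nonneg a b ι t), Complex.real_smul]

theorem isLocallyFiniteMeasure_mu {a b ι : ℝ} (ha : 0 ≤ a) (hb : 0 ≤ b) (hι : 0 ≤ ι) :
    IsLocallyFiniteMeasure (mu r a b ι) :=
  IsLocallyFiniteMeasure.withDensity_ofReal (continuous_density ha hb hι)

/-- A function is integrable against test functions if its products with continuous functions of
compact support are integrable with respect to `dμ`. -/
def TestIntegrable (a b ι : ℝ) (h : (Fin r → ℝ) → ℂ) : Prop :=
  ∀ φ : (Fin r → ℝ) → ℂ, Continuous φ → HasCompactSupport φ →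
    Integrable (fun t => φ t * h t) (mu r a b ι)

theorem TestIntegrable.of_locallyIntegrable {a b ι : ℝ} {h : (Fin r → ℝ) → ℝ}
    (hh : LocallyIntegrable (fun t => density r a b ι t * h t) volume) :
    TestIntegrable a b ι fun t => (h t : ℂ) := by
  intro φ hφ hc
  rw [integrable_mu_iff]
  have h1 := hh.integrable_smul_right_of_hasCompactSupport hφ hc
  refine h1.congr (Filter.Eventually.of_forall fun t => ?_)
  simp only [Complex.real_smul]
  push_cast
  ring

theorem TestIntegrable.of_continuous {a b ι : ℝ} (ha : 0 ≤ a) (hb : 0 ≤ b) (hι : 0 ≤ ι)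
    {h : (Fin r → ℝ) → ℂ} (hh : Continuous h) : TestIntegrable a b ι h := by
  intro φ hφ hc
  have := isLocallyFiniteMeasure_mu (r := r) ha hb hι
  exact (hφ.mul hh).integrable_of_hasCompactSupport hc.mul_right

theorem testIntegrable_coth_of_density {a b ι κ : ℝ} (hκ : 0 < κ) {l : (Fin r → ℝ) →L[ℝ] ℝ}
    {v : Fin r → ℝ} (hl : l v = 2) {R : (Fin r → ℝ) → ℝ} (hR : Continuous R)
    (h : ∀ t, density r a b ι t = |2 * Real.sinh (l t)| ^ κ * R t) :
    TestIntegrable a b ι fun t => (coth (l t) : ℂ) := by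
  refine TestIntegrable.of_locallyIntegrable ?_
  refine (locallyIntegrable_rpow_mul_coth hκ hl hR).congr (Filter.Eventually.of_forall fun t => ?_)
  simp only [h, coth]

theorem testIntegrable_coth_long {a b ι : ℝ} (ha : 0 ≤ a) (hb : 0 ≤ b) (hι : 0 < ι) (j : Fin r) :
    TestIntegrable a b ι fun t => (coth (2 * t j) : ℂ) := by
  obtain ⟨R, hR, h⟩ := density_long ha hb hι.le j
  have := testIntegrable_coth_of_density hι (long_coroot j) hR (fun t => by rw [h]; simp)
  simpa using this

theorem testIntegrable_coth_short {a b ι : ℝ} (ha : 0 ≤ a) (hb : 0 < b) (hι : 0 ≤ ι) (j : Fin r) :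
    TestIntegrable a b ι fun t => (coth (t j) : ℂ) := by
  obtain ⟨R, hR, h⟩ := density_short ha hb.le hι j
  have := testIntegrable_coth_of_density (by linarith : 0 < 2 * b) (short_coroot j) hR
    (fun t => by rw [h]; simp)
  simpa using this

theorem testIntegrable_coth_pair {a b ι : ℝ} (ha : 0 < a) (hb : 0 ≤ b) (hι : 0 ≤ ι) {i k : Fin r}
    (hik : i < k) : TestIntegrable a b ι (fun t => (coth (t i - t k) : ℂ)) ∧
      TestIntegrable a b ι (fun t => (coth (t i + t k) : ℂ)) := by
  obtain ⟨R, hR, h⟩ := density_pair ha.le hb hι hik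
  have h0 : 0 ≤ a := ha.le
  have h4 : Continuous fun t => |2 * Real.sinh (t i + t k)| ^ a * R t := by fun_prop
  have h5 : Continuous fun t => |2 * Real.sinh (t i - t k)| ^ a * R t := by fun_prop
  have h6 := testIntegrable_coth_of_density ha (minus_coroot hik.ne) h4 (fun t => by
    rw [h]; simp only [sub_apply, ContinuousLinearMap.proj_apply]; ring)
  have h7 := testIntegrable_coth_of_density ha (plus_coroot hik.ne) h5 (fun t => by
    rw [h]; simp only [add_apply, ContinuousLinearMap.proj_apply]; ring)
  simp only [sub_apply, add_apply, ContinuousLinearMap.proj_apply] at h6 h7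
  exact ⟨h6, h7⟩

theorem measurePreserving_refl {l : (Fin r → ℝ) →L[ℝ] ℝ} {v : Fin r → ℝ} (h : l v = 2) :
    MeasurePreserving (involEquiv (refl l v) (refl_refl h)) volume volume := by
  refine ⟨(refl l v).continuous.measurable, ?_⟩
  have h1 : LinearMap.det (refl l v : (Fin r → ℝ) →ₗ[ℝ] (Fin r → ℝ)) *
      LinearMap.det (refl l v : (Fin r → ℝ) →ₗ[ℝ] (Fin r → ℝ)) = 1 := by
    rw [← LinearMap.det_comp]
    have : (refl l v : (Fin r → ℝ) →ₗ[ℝ] (Fin r → ℝ)) ∘ₗ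
        (refl l v : (Fin r → ℝ) →ₗ[ℝ] (Fin r → ℝ)) = LinearMap.id :=
      LinearMap.ext fun t => refl_refl h t
    rw [this, LinearMap.det_id]
  have h2 : LinearMap.det (refl l v : (Fin r → ℝ) →ₗ[ℝ] (Fin r → ℝ)) ≠ 0 := fun h0 => by
    rw [h0] at h1; norm_num at h1
  have h3 := Real.map_linearMap_volume_pi_eq_smul_volume_pi h2
  have h4 : |(LinearMap.det (refl l v : (Fin r → ℝ) →ₗ[ℝ] (Fin r → ℝ)))⁻¹| = 1 := by
    rcases mul_self_eq_one_iff.1 h1 with h5 | h5 <;> simp [h5]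
  rw [h4, ENNReal.ofReal_one, one_smul] at h3
  exact h3

/-- The reflection preserves the density at regular points. -/
def PreservesDensity (a b ι : ℝ) (l : (Fin r → ℝ) →L[ℝ] ℝ) (v : Fin r → ℝ) : Prop :=
  ∀ t ∈ regularSet r, density r a b ι (refl l v t) = density r a b ι t

theorem preservesDensity_long (a b ι : ℝ) (i : Fin r) :
    PreservesDensity a b ι ((2 : ℝ) • coord i) (Pi.single i 1) := by
  intro t ht
  rw [refl_long, density_eq_exp a b ι ht, density_eq_exp a b ι (reflSign_mem_regularSet i ht),
    logDensity_reflSign]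

theorem preservesDensity_short (a b ι : ℝ) (i : Fin r) :
    PreservesDensity a b ι (coord i) ((2 : ℝ) • Pi.single i 1) := by
  intro t ht
  rw [refl_short, density_eq_exp a b ι ht, density_eq_exp a b ι (reflSign_mem_regularSet i ht),
    logDensity_reflSign]

theorem preservesDensity_minus (a b ι : ℝ) {i j : Fin r} (h : i ≠ j) :
    PreservesDensity a b ι (coord i - coord j) (Pi.single i 1 - Pi.single j 1) := by
  intro t ht
  rw [refl_minus h, density_eq_exp a b ι ht, density_eq_exp a b ι (reflSwap_mem_regularSet i j ht),
    logDensity_reflSwap]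

theorem preservesDensity_plus (a b ι : ℝ) {i j : Fin r} (h : i ≠ j) :
    PreservesDensity a b ι (coord i + coord j) (Pi.single i 1 + Pi.single j 1) := by
  intro t ht
  rw [refl_plus h, density_eq_exp a b ι ht,
    density_eq_exp a b ι (reflSignedSwap_mem_regularSet h ht), logDensity_reflSignedSwap a b ι h]

theorem integrable_comp_refl_iff {a b ι : ℝ} {l : (Fin r → ℝ) →L[ℝ] ℝ} {v : Fin r → ℝ}
    (h : l v = 2) (hw : PreservesDensity a b ι l v) {φ : (Fin r → ℝ) → ℂ} :
    Integrable (fun t => φ (refl l v t)) (mu r a b ι) ↔ Integrable φ (mu r a b ι) := by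
  have key := (measurePreserving_refl h).integrable_comp_emb
    (involEquiv (refl l v) (refl_refl h)).toHomeomorph.measurableEmbedding
    (g := fun t => (density r a b ι t : ℂ) * φ t)
  rw [integrable_mu_iff, integrable_mu_iff, ← key]
  refine integrable_congr ?_
  filter_upwards [ae_mem_regularSet r] with t ht
  change (density r a b ι t : ℂ) * φ (refl l v t) =
    (density r a b ι (refl l v t) : ℂ) * φ (refl l v t)
  rw [hw t ht]

theorem integral_comp_refl {a b ι : ℝ} {l : (Fin r → ℝ) →L[ℝ] ℝ} {v : Fin r → ℝ}
    (h : l v = 2) (hw : PreservesDensity a b ι l v) (φ : (Fin r → ℝ) → ℂ) :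
    ∫ t, φ (refl l v t) ∂mu r a b ι = ∫ t, φ t ∂mu r a b ι := by
  have key := (measurePreserving_refl h).integral_comp
    (involEquiv (refl l v) (refl_refl h)).toHomeomorph.measurableEmbedding
    (fun t => (density r a b ι t : ℂ) * φ t)
  rw [integral_mu, integral_mu, ← key]
  refine integral_congr_ae ?_
  filter_upwards [ae_mem_regularSet r] with t ht
  change (density r a b ι t : ℂ) * φ (refl l v t) =
    (density r a b ι (refl l v t) : ℂ) * φ (refl l v t)
  rw [hw t ht]

theorem countable_line_not_regular (j : Fin r) {t : Fin r → ℝ} (ht : t ∈ regularSet r) :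
    {s : ℝ | t + s • (Pi.single j 1 : Fin r → ℝ) ∉ regularSet r}.Countable := by
  have hsub : {s : ℝ | t + s • (Pi.single j 1 : Fin r → ℝ) ∉ regularSet r} ⊆
      {-t j} ∪ ⋃ k, {t k - t j, -t k - t j} := by
    intro s hs
    by_contra hcon
    simp only [Set.mem_union, Set.mem_singleton_iff, Set.mem_iUnion, Set.mem_insert_iff, not_or,
      not_exists] at hcon
    have e1 : (t + s • (Pi.single j 1 : Fin r → ℝ)) j = t j + s := by simp
    have e2 : ∀ k, k ≠ j → (t + s • (Pi.single j 1 : Fin r → ℝ)) k = t k := fun k hk => by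
      simp [hk]
    refine hs ⟨fun i => ?_, fun i k hik => ?_⟩
    · by_cases hi : i = j
      · rw [hi, e1]
        exact fun hh => hcon.1 (by linarith)
      · rw [e2 i hi]
        exact ht.1 i
    · by_cases hi : i = j
      · have hk : k ≠ j := fun hh => hik (hi.trans hh.symm)
        rw [hi, e1, e2 k hk]
        exact ⟨fun hh => (hcon.2 k).1 (by linarith), fun hh => (hcon.2 k).2 (by linarith)⟩
      · rw [e2 i hi]
        by_cases hk : k = j
        · rw [hk, e1]
          exact ⟨fun hh => (hcon.2 i).1 (by linarith), fun hh => (hcon.2 i).2 (by linarith)⟩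
        · rw [e2 k hk]
          exact ht.2 i k hik
  refine Set.Countable.mono hsub ((Set.countable_singleton _).union
    (Set.countable_iUnion fun k => ?_))
  exact (Set.toFinite _).countable

/-- The integral of a directional derivative vanishes, also if the derivative exists only at the
regular points: by the fundamental theorem of calculus off a countable set, the average of the
derivative over a segment is a difference of two translates, which have the same integral. -/
theorem integral_lineDeriv_eq_zero (j : Fin r) {G G' : (Fin r → ℝ) → ℂ} (hG : Continuous G)
    (hc : HasCompactSupport G) (hG' : Integrable G' volume)
    (hd : ∀ t ∈ regularSet r, HasLineDerivAt ℝ G (G' t) t (Pi.single j 1)) :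
    ∫ t, G' t = 0 := by
  set e : Fin r → ℝ := Pi.single j 1 with he
  have hΦ : Measure.QuasiMeasurePreserving (fun p : ℝ × (Fin r → ℝ) => p.2 + p.1 • e)
      ((volume.restrict (Set.Ioc (0 : ℝ) 1)).prod volume) volume := by
    have hm : Measurable fun p : ℝ × (Fin r → ℝ) => p.2 + p.1 • e := by fun_prop
    refine ⟨hm, Measure.AbsolutelyContinuous.mk fun s hs h0 => ?_⟩
    rw [Measure.map_apply hm hs, Measure.measure_prod_null (hm hs)]
    refine Filter.Eventually.of_forall fun x => ?_
    change volume ((fun t => t + x • e) ⁻¹' s) = 0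
    rw [measure_preimage_add_right, h0]
  have hint : Integrable (fun p : ℝ × (Fin r → ℝ) => G' (p.2 + p.1 • e))
      ((volume.restrict (Set.Ioc (0 : ℝ) 1)).prod volume) := by
    have hm : AEStronglyMeasurable (fun p : ℝ × (Fin r → ℝ) => G' (p.2 + p.1 • e))
        ((volume.restrict (Set.Ioc (0 : ℝ) 1)).prod volume) :=
      hG'.aestronglyMeasurable.comp_quasiMeasurePreserving hΦ
    rw [integrable_prod_iff hm]
    refine ⟨Filter.Eventually.of_forall fun s => hG'.comp_add_right (s • e), ?_⟩
    have : (fun s : ℝ => ∫ t, ‖G' (t + s • e)‖) = fun _ => ∫ t, ‖G' t‖ := by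
      funext s
      exact integral_add_right_eq_self (fun t => ‖G' t‖) (s • e)
    simp only [this]
    exact integrable_const _
  have h1 : ∫ s in Set.Ioc (0 : ℝ) 1, ∫ t, G' (t + s • e) = ∫ t, G' t := by
    have : ∀ s : ℝ, ∫ t, G' (t + s • e) = ∫ t, G' t := fun s =>
      integral_add_right_eq_self G' (s • e)
    simp [this]
  have h2 : ∀ᵐ t : Fin r → ℝ, ∫ s in Set.Ioc (0 : ℝ) 1, G' (t + s • e) = G (t + e) - G t := by
    filter_upwards [ae_mem_regularSet r, hint.prod_left_ae] with t ht hi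
    have hcont : Continuous fun s : ℝ => G (t + s • e) := by fun_prop
    have := MeasureTheory.integral_eq_of_hasDerivAt_off_countable
      (fun s : ℝ => G (t + s • e)) (fun s => G' (t + s • e)) (a := 0) (b := 1)
      (countable_line_not_regular j ht) hcont.continuousOn (fun s hs => by
        have hs' : t + s • e ∈ regularSet r := by
          have := hs.2
          rwa [Set.mem_ofPred_eq, not_not] at this
        have h3 : HasDerivAt (fun x : ℝ => G (t + s • e + x • e)) (G' (t + s • e)) (s - s) := by
          rw [sub_self]; exact hd _ hs'
        have h4 := HasDerivAt.comp_sub_const s s h3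
        refine h4.congr_of_eventuallyEq (Filter.Eventually.of_forall fun x => ?_)
        simp only
        congr 1
        module) (by
        rw [intervalIntegrable_iff_integrableOn_Ioc_of_le zero_le_one]
        exact hi)
    rw [intervalIntegral.integral_of_le zero_le_one] at this
    rw [this]
    simp
  have hGi : Integrable G volume := hG.integrable_of_hasCompactSupport hc
  rw [← h1, integral_integral_swap hint, integral_congr_ae h2,
    integral_sub (hGi.comp_add_right e) hGi, integral_add_right_eq_self G e, sub_self]

end Measure

/-! ### Adjoints of the Cherednik operators -/

section Adjoint

variable {r : ℕ} {a b ι : ℝ}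

/-- The function `h` is the image of `g` under the transpose of the operator `X` on test functions
with respect to `dμ`. -/
def IsAdj (a b ι : ℝ) (X : TF r →L[ℂ] TF r) (g h : (Fin r → ℝ) → ℂ) : Prop :=
  ∀ f : TF r, Integrable (fun t => X f t * g t) (mu r a b ι) ∧
    Integrable (fun t => f t * h t) (mu r a b ι) ∧
    ∫ t, X f t * g t ∂mu r a b ι = ∫ t, f t * h t ∂mu r a b ι

theorem IsAdj.congr {X : TF r →L[ℂ] TF r} {g h h' : (Fin r → ℝ) → ℂ} (H : IsAdj a b ι X g h)
    (e : Set.EqOn h h' (regularSet r)) : IsAdj a b ι X g h' := by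
  intro f
  obtain ⟨h1, h2, h3⟩ := H f
  have h4 : (fun t => f t * h t) =ᵐ[mu r a b ι] fun t => f t * h' t := by
    filter_upwards [ae_mu_mem_regularSet r a b ι] with t ht
    rw [e ht]
  exact ⟨h1, h2.congr h4, h3.trans (integral_congr_ae h4)⟩

theorem IsAdj.add {X Y : TF r →L[ℂ] TF r} {g h k : (Fin r → ℝ) → ℂ} (H : IsAdj a b ι X g h)
    (K : IsAdj a b ι Y g k) : IsAdj a b ι (X + Y) g fun t => h t + k t := by
  intro f
  obtain ⟨h1, h2, h3⟩ := H f
  obtain ⟨k1, k2, k3⟩ := K f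
  have e1 : (fun t => (X + Y) f t * g t) = fun t => X f t * g t + Y f t * g t := by
    funext t
    change (X f t + Y f t) * g t = _
    ring
  have e2 : (fun t => f t * (h t + k t)) = fun t => f t * h t + f t * k t := by
    funext t; ring
  rw [e1, e2]
  exact ⟨h1.add k1, h2.add k2, by rw [integral_add h1 k1, integral_add h2 k2, h3, k3]⟩

/-- The hypothesis is needed for `c ≠ 0` only: the coefficient of a root of multiplicity zero need
not be locally integrable for `dμ`. -/
theorem IsAdj.smul {X : TF r →L[ℂ] TF r} {g h : (Fin r → ℝ) → ℂ} (c : ℂ)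
    (H : c ≠ 0 → IsAdj a b ι X g h) : IsAdj a b ι (c • X) g fun t => c * h t := by
  intro f
  have e1 : (fun t => (c • X) f t * g t) = fun t => c * (X f t * g t) := by
    funext t
    change (c * X f t) * g t = _
    ring
  have e2 : (fun t => f t * (c * h t)) = fun t => c * (f t * h t) := by
    funext t; ring
  rw [e1, e2]
  by_cases hc : c = 0
  · simp [hc]
  · obtain ⟨h1, h2, h3⟩ := H hc f
    exact ⟨h1.const_mul c, h2.const_mul c, by rw [integral_const_mul, integral_const_mul, h3]⟩

theorem IsAdj.const_mul {X : TF r →L[ℂ] TF r} {g h : (Fin r → ℝ) → ℂ} (H : IsAdj a b ι X g h)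
    (c : ℂ) : IsAdj a b ι X (fun t => c * g t) fun t => c * h t := by
  intro f
  obtain ⟨h1, h2, h3⟩ := H f
  simp only [mul_left_comm _ c]
  exact ⟨h1.const_mul c, h2.const_mul c, by rw [integral_const_mul, integral_const_mul, h3]⟩

theorem IsAdj.sub {X Y : TF r →L[ℂ] TF r} {g h k : (Fin r → ℝ) → ℂ} (H : IsAdj a b ι X g h)
    (K : IsAdj a b ι Y g k) : IsAdj a b ι (X - Y) g fun t => h t - k t := by
  have := H.add (IsAdj.smul (-1) fun _ => K)
  rw [neg_one_smul, ← sub_eq_add_neg] at this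
  exact this.congr fun t _ => by ring

theorem IsAdj.zero {g : (Fin r → ℝ) → ℂ} :
    IsAdj a b ι (0 : TF r →L[ℂ] TF r) g fun _ => 0 := by
  intro f
  simp

theorem IsAdj.sum {κ : Type*} (s : Finset κ) {X : κ → TF r →L[ℂ] TF r} {g : (Fin r → ℝ) → ℂ}
    {h : κ → (Fin r → ℝ) → ℂ} (H : ∀ k, IsAdj a b ι (X k) g (h k)) :
    IsAdj a b ι (∑ k ∈ s, X k) g fun t => ∑ k ∈ s, h k t := by
  classical
  induction s using Finset.induction_on with
  | empty => simpa using IsAdj.zero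
  | insert k s hk ih =>
    simp only [Finset.sum_insert hk]
    exact (H k).add ih

theorem IsAdj.comp {X Y : TF r →L[ℂ] TF r} {g h k : (Fin r → ℝ) → ℂ} (H : IsAdj a b ι X g h)
    (K : IsAdj a b ι Y h k) : IsAdj a b ι (X * Y) g k := fun f =>
  ⟨(H (Y f)).1, (K f).2.1, (H (Y f)).2.2.trans (K f).2.2⟩

theorem IsAdj.one (ha : 0 ≤ a) (hb : 0 ≤ b) (hι : 0 ≤ ι) {g : (Fin r → ℝ) → ℂ}
    (hg : Continuous g) : IsAdj a b ι (1 : TF r →L[ℂ] TF r) g g := fun f =>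
  have h := TestIntegrable.of_continuous ha hb hι hg f f.continuous f.hasCompactSupport
  ⟨h, h, rfl⟩

theorem testIntegrable_mul {h g : (Fin r → ℝ) → ℂ} (H : TestIntegrable a b ι h)
    (hg : Continuous g) : TestIntegrable a b ι fun t => g t * h t := by
  intro φ hφ hc
  refine (H (fun t => φ t * g t) (hφ.mul hg) hc.mul_right).congr
    (Filter.Eventually.of_forall fun t => ?_)
  simp only
  ring

theorem TestIntegrable.add {h k : (Fin r → ℝ) → ℂ} (H : TestIntegrable a b ι h)
    (K : TestIntegrable a b ι k) : TestIntegrable a b ι fun t => h t + k t := by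
  intro φ hφ hc
  refine ((H φ hφ hc).add (K φ hφ hc)).congr (Filter.Eventually.of_forall fun t => ?_)
  simp only [Pi.add_apply]
  ring

/-- The hypothesis is needed for `c ≠ 0` only, as in `IsAdj.smul`. -/
theorem TestIntegrable.const_mul {h : (Fin r → ℝ) → ℂ} (c : ℂ)
    (H : c ≠ 0 → TestIntegrable a b ι h) : TestIntegrable a b ι fun t => c * h t := by
  intro φ hφ hc
  by_cases h0 : c = 0
  · simp [h0]
  · refine ((H h0 φ hφ hc).const_mul c).congr (Filter.Eventually.of_forall fun t => ?_)
    simp only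
    ring

theorem TestIntegrable.sum {κ : Type*} (s : Finset κ) {h : κ → (Fin r → ℝ) → ℂ}
    (H : ∀ k, TestIntegrable a b ι (h k)) : TestIntegrable a b ι fun t => ∑ k ∈ s, h k t := by
  classical
  induction s using Finset.induction_on with
  | empty => intro φ _ _; simp
  | insert k s hk ih =>
    simp only [Finset.sum_insert hk]
    exact (H k).add ih

theorem testIntegrable_logDeriv (ha : 0 ≤ a) (hb : 0 ≤ b) (hι : 0 ≤ ι) (j : Fin r) :
    TestIntegrable a b ι fun t => (logDeriv a b ι j t : ℂ) := by
  have h1 : TestIntegrable a b ι fun t => (2 * ι : ℂ) * (coth (2 * t j) : ℂ) :=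
    TestIntegrable.const_mul _ fun h => testIntegrable_coth_long ha hb
      (lt_of_le_of_ne hι fun hh => h (by simp [← hh])) j
  have h2 : TestIntegrable a b ι fun t => (2 * b : ℂ) * (coth (t j) : ℂ) :=
    TestIntegrable.const_mul _ fun h => testIntegrable_coth_short ha
      (lt_of_le_of_ne hb fun hh => h (by simp [← hh])) hι j
  have h3 : TestIntegrable a b ι fun t => (a : ℂ) * ∑ k, (pairLog j k t : ℂ) := by
    refine TestIntegrable.const_mul _ fun h => TestIntegrable.sum _ fun k => ?_
    have ha' : 0 < a := lt_of_le_of_ne ha fun hh => h (by simp [← hh])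
    rcases lt_trichotomy j k with hk | hk | hk
    · obtain ⟨e1, e2⟩ := testIntegrable_coth_pair ha' hb hι hk
      have := e1.add e2
      simp only [pairLog, if_neg hk.ne']
      push_cast
      exact this
    · intro φ _ _; simp [pairLog, hk]
    · obtain ⟨e1, e2⟩ := testIntegrable_coth_pair ha' hb hι hk
      have := (TestIntegrable.const_mul (-1) fun _ => e1).add e2
      simp only [pairLog, if_neg hk.ne]
      have e : ∀ t : Fin r → ℝ, coth (t j - t k) = -coth (t k - t j) := fun t => by
        rw [← coth_neg, neg_sub]
      simp only [e]
      push_cast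
      simpa [add_comm] using this
  refine fun φ hφ hc => (((h1.add h2).add h3) φ hφ hc).congr
    (Filter.Eventually.of_forall fun t => ?_)
  simp only [logDeriv]
  push_cast
  ring

/-- Integration by parts for a partial derivative. The function `g` need only be continuous and
differentiable at the regular points, with a derivative that extends continuously. -/
theorem isAdj_dirOp (ha : 0 ≤ a) (hb : 0 ≤ b) (hι : 0 ≤ ι) (j : Fin r)
    {g dg : (Fin r → ℝ) → ℂ} (hg : Continuous g) (hdg : Continuous dg)
    (hd : ∀ t ∈ regularSet r, HasLineDerivAt ℝ g (dg t) t (Pi.single j 1)) :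
    IsAdj a b ι (dirOp (Pi.single j 1)) g
      fun t => -dg t - (logDeriv a b ι j t : ℂ) * g t := by
  intro f
  set X := dirOp (r := r) (Pi.single j 1) with hX
  have i1 : Integrable (fun t => X f t * g t) (mu r a b ι) :=
    TestIntegrable.of_continuous ha hb hι hg _ (X f).continuous (X f).hasCompactSupport
  have i2 : Integrable (fun t => f t * dg t) (mu r a b ι) :=
    TestIntegrable.of_continuous ha hb hι hdg _ f.continuous f.hasCompactSupport
  have i3 : Integrable (fun t => f t * (g t * (logDeriv a b ι j t : ℂ))) (mu r a b ι) :=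
    testIntegrable_mul (testIntegrable_logDeriv ha hb hι j) hg _ f.continuous f.hasCompactSupport
  have e2 : (fun t => f t * (-dg t - (logDeriv a b ι j t : ℂ) * g t)) =
      fun t => -(f t * dg t + f t * (g t * (logDeriv a b ι j t : ℂ))) := by
    funext t; ring
  refine ⟨i1, by rw [e2]; exact (i2.add i3).neg, ?_⟩
  have i4 := (i1.add i2).add i3
  have hzero := integral_lineDeriv_eq_zero j
    (G := fun t => (density r a b ι t : ℂ) * (f t * g t))
    (G' := fun t => (density r a b ι t : ℂ) *
      (X f t * g t + f t * dg t + f t * (g t * (logDeriv a b ι j t : ℂ))))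
    ((Complex.continuous_ofReal.comp (continuous_density ha hb hι)).mul (f.continuous.mul hg))
    (f.hasCompactSupport.mul_right.mul_left) (integrable_mu_iff.1 i4) (fun t ht => by
      have d1 : HasDerivAt (fun s : ℝ => (density r a b ι (t + s • Pi.single j 1) : ℂ))
          ((density r a b ι t * logDeriv a b ι j t : ℝ) : ℂ) 0 :=
        HasDerivAt.ofReal_comp (hasLineDerivAt_density a b ι j ht)
      have d2 : HasDerivAt (fun s : ℝ => f (t + s • Pi.single j 1)) (X f t) 0 := by
        rw [hX, dirOp_apply]
        exact (((contDiff_of_TF f).differentiable (by norm_num) t).hasFDerivAt).hasLineDerivAt _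
      have d3 : HasDerivAt (fun s : ℝ => g (t + s • Pi.single j 1)) (dg t) 0 := hd t ht
      have d4 := d1.mul (d2.mul d3)
      refine HasDerivAt.congr_deriv (f := fun s : ℝ => (density r a b ι (t + s • Pi.single j 1) : ℂ)
        * (f (t + s • Pi.single j 1) * g (t + s • Pi.single j 1))) d4 ?_
      simp only [Pi.mul_apply, zero_smul, add_zero]
      push_cast
      ring)
  rw [← integral_mu (fun t => X f t * g t + f t * dg t + f t * (g t * (logDeriv a b ι j t : ℂ))),
    integral_add (i1.fun_add i2) i3, integral_add i1 i2] at hzero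
  rw [e2, integral_neg, integral_add i2 i3]
  linear_combination hzero

theorem coef_eq {x : ℝ} (hx : x ≠ 0) : coef x = (1 + coth x) / 2 := by
  have := coef_eq_coth hx
  rw [coth]
  linarith

/-- The transpose of a divided difference. The two terms are integrated separately, which uses that
`coth l` is locally integrable for `dμ`. -/
theorem isAdj_dd (ha : 0 ≤ a) (hb : 0 ≤ b) (hι : 0 ≤ ι) {l : (Fin r → ℝ) →L[ℝ] ℝ}
    {v : Fin r → ℝ} (h : l v = 2) (hw : PreservesDensity a b ι l v)
    (hi : TestIntegrable a b ι fun t => (coth (l t) : ℂ)) {g : (Fin r → ℝ) → ℂ}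
    (hg : Continuous g) : IsAdj a b ι (dd l v) g
      fun t => (coef (l t) : ℂ) * g t - (1 - (coef (l t) : ℂ)) * g (refl l v t) := by
  intro f
  have hl : ∀ᵐ t ∂mu r a b ι, l t ≠ 0 :=
    (withDensity_absolutelyContinuous _ _).ae_le (ae_ne_zero h)
  have hcoef : TestIntegrable a b ι fun t => (coef (l t) : ℂ) := by
    have h1 : TestIntegrable a b ι fun t => (1 + (coth (l t) : ℂ)) :=
      (TestIntegrable.of_continuous ha hb hι continuous_const).add hi
    have h2 := TestIntegrable.const_mul (1 / 2) fun _ => h1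
    intro φ hφ hc
    refine (h2 φ hφ hc).congr ?_
    filter_upwards [hl] with t ht
    rw [coef_eq ht]
    push_cast
    ring
  have hρ : Continuous (refl l v) := (refl l v).continuous
  have i1 : Integrable (fun t => dd l v f t * g t) (mu r a b ι) :=
    TestIntegrable.of_continuous ha hb hι hg _ (dd l v f).continuous (dd l v f).hasCompactSupport
  have i2 : Integrable (fun t => f t * (g t * (coef (l t) : ℂ))) (mu r a b ι) :=
    testIntegrable_mul hcoef hg _ f.continuous f.hasCompactSupport
  have hcs : HasCompactSupport fun t => f (refl l v t) :=
    f.hasCompactSupport.comp_homeomorph (involEquiv (refl l v) (refl_refl h)).toHomeomorph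
  have i3 : Integrable (fun t => f (refl l v t) * (g t * (coef (l t) : ℂ))) (mu r a b ι) :=
    testIntegrable_mul hcoef hg _ (f.continuous.comp hρ) hcs
  have hl' : ∀ t, l (refl l v t) = -l t := map_refl h
  have e4 : (fun t => f t * (g (refl l v t) * (coef (l (refl l v t)) : ℂ))) =ᵐ[mu r a b ι]
      fun t => f t * ((1 - (coef (l t) : ℂ)) * g (refl l v t)) := by
    filter_upwards [hl] with t ht
    rw [hl', coef_neg ht]
    push_cast
    ring
  have i4' := (integrable_comp_refl_iff h hw).2 i3
  simp only [refl_refl h] at i4'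
  have i4 := i4'.congr e4
  have e3 : ∫ t, f (refl l v t) * (g t * (coef (l t) : ℂ)) ∂mu r a b ι =
      ∫ t, f t * ((1 - (coef (l t) : ℂ)) * g (refl l v t)) ∂mu r a b ι := by
    rw [← integral_congr_ae e4, ← integral_comp_refl h hw]
    simp only [refl_refl h]
  have e5 : (fun t => f t * ((coef (l t) : ℂ) * g t - (1 - (coef (l t) : ℂ)) * g (refl l v t))) =
      fun t => f t * (g t * (coef (l t) : ℂ)) -
        f t * ((1 - (coef (l t) : ℂ)) * g (refl l v t)) := by
    funext t; ring
  have e6 : (fun t => dd l v f t * g t) =ᵐ[mu r a b ι] fun t =>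
      f t * (g t * (coef (l t) : ℂ)) - f (refl l v t) * (g t * (coef (l t) : ℂ)) := by
    filter_upwards [hl] with t ht
    rw [dd_apply h f ht]
    ring
  rw [e5]
  refine ⟨i1, i2.sub i4, ?_⟩
  rw [integral_congr_ae e6, integral_sub i2 i3, integral_sub i2 i4, e3]

/-- The part of the transpose of `D_j` that belongs to the roots `±ξ_j ± ξ_k`. -/
def pairAdj (j k : Fin r) (g : (Fin r → ℝ) → ℂ) (t : Fin r → ℝ) : ℂ :=
  if j < k then
    (1 - (coef (t j - t k) : ℂ)) * (g t - g (reflSwap j k t)) +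
      (1 - (coef (t j + t k) : ℂ)) * (g t - g (reflSignedSwap j k t))
  else if k < j then
    -((coef (t j - t k) : ℂ) * (g t - g (reflSwap j k t))) +
      (1 - (coef (t j + t k) : ℂ)) * (g t - g (reflSignedSwap j k t))
  else 0

/-- The transpose of `D_j`, applied to a function `g` with derivative `dg` in the direction `j`. -/
def cherAdj (a b ι : ℝ) (j : Fin r) (g dg : (Fin r → ℝ) → ℂ) (t : Fin r → ℝ) : ℂ :=
  -dg t + 2 * ι * ((1 - (coef (2 * t j) : ℂ)) * (g t - g (reflSign j t)))
    + 2 * b * ((1 - (coef (t j) : ℂ)) * (g t - g (reflSign j t)))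
    + a * ∑ k, pairAdj j k g t - rho r a b ι j * g t

theorem reflSignedSwap_comm (i j : Fin r) (t : Fin r → ℝ) :
    reflSignedSwap i j t = reflSignedSwap j i t := by
  funext k
  simp only [reflSignedSwap]
  by_cases h1 : k = i
  · by_cases h2 : k = j
    · simp [← h1, ← h2]
    · simp [← h1, h2]
  · by_cases h2 : k = j
    · subst h2; simp [h1]
    · simp [h1, h2]

theorem coth_eq {x : ℝ} (hx : x ≠ 0) : coth x = 2 * coef x - 1 := by
  rw [coef_eq hx]; ring

theorem isAdj_pairOp (ha : 0 < a) (hb : 0 ≤ b) (hι : 0 ≤ ι) (j k : Fin r) {g : (Fin r → ℝ) → ℂ}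
    (hg : Continuous g) : IsAdj a b ι (pairOp j k) g
      fun t => pairAdj j k g t + (pairLog j k t : ℂ) * g t := by
  have key : ∀ {i k : Fin r}, i < k →
      IsAdj a b ι (dm i k) g (fun t => (coef (t i - t k) : ℂ) * g t -
        (1 - (coef (t i - t k) : ℂ)) * g (reflSwap i k t)) ∧
      IsAdj a b ι (dp i k) g (fun t => (coef (t i + t k) : ℂ) * g t -
        (1 - (coef (t i + t k) : ℂ)) * g (reflSignedSwap i k t)) := by
    intro i k h
    obtain ⟨e1, e2⟩ := testIntegrable_coth_pair ha hb hι h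
    have h1 := isAdj_dd ha.le hb hι (minus_coroot h.ne) (preservesDensity_minus a b ι h.ne)
      (by simpa using e1) hg
    have h2 := isAdj_dd ha.le hb hι (plus_coroot h.ne) (preservesDensity_plus a b ι h.ne)
      (by simpa using e2) hg
    simp only [refl_minus h.ne, refl_plus h.ne, sub_apply, add_apply,
      ContinuousLinearMap.proj_apply] at h1 h2
    exact ⟨h1, h2⟩
  rcases lt_trichotomy j k with h | h | h
  · obtain ⟨h1, h2⟩ := key h
    rw [pairOp_of_lt h]
    refine (h2.add h1).congr fun t ht => ?_
    have n1 : t j - t k ≠ 0 := sub_ne_zero.2 (ht.2 j k h.ne).1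
    have n2 : t j + t k ≠ 0 := fun hh => (ht.2 j k h.ne).2 (eq_neg_of_add_eq_zero_left hh)
    simp only [pairAdj, pairLog, if_pos h, if_neg h.ne', coth_eq n1, coth_eq n2]
    push_cast
    ring
  · subst h
    rw [pairOp_self]
    refine IsAdj.zero.congr fun t _ => ?_
    simp [pairAdj, pairLog]
  · obtain ⟨h1, h2⟩ := key h
    rw [pairOp_of_gt h]
    refine (h2.sub h1).congr fun t ht => ?_
    have n1 : t j - t k ≠ 0 := sub_ne_zero.2 (ht.2 j k h.ne').1
    have n2 : t j + t k ≠ 0 := fun hh => (ht.2 j k h.ne').2 (eq_neg_of_add_eq_zero_left hh)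
    have e := coef_neg n1
    rw [neg_sub] at e
    simp only [pairAdj, pairLog, if_neg h.not_gt, if_pos h, if_neg h.ne, coth_eq n1, coth_eq n2, e,
      reflSwap_comm k j, reflSignedSwap_comm k j, add_comm (t k)]
    push_cast
    ring

/-- Integration by parts for the Cherednik operators. -/
theorem isAdj_cherOp (ha : 0 ≤ a) (hb : 0 ≤ b) (hι : 0 ≤ ι) (j : Fin r)
    {g dg : (Fin r → ℝ) → ℂ} (hg : Continuous g) (hdg : Continuous dg)
    (hd : ∀ t ∈ regularSet r, HasLineDerivAt ℝ g (dg t) t (Pi.single j 1)) :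
    IsAdj a b ι (cherOp a b ι j) g (cherAdj a b ι j g dg) := by
  have h0 := isAdj_dirOp ha hb hι j hg hdg hd
  have h1 : IsAdj a b ι ((2 * ι : ℂ) • dl j) g _ := IsAdj.smul _ fun h =>
    have hc := testIntegrable_coth_long ha hb (lt_of_le_of_ne hι fun hh => h (by simp [← hh])) j
    isAdj_dd ha hb hι (long_coroot j) (preservesDensity_long a b ι j) (by simpa using hc) hg
  have h2 : IsAdj a b ι ((2 * b : ℂ) • ds j) g _ := IsAdj.smul _ fun h =>
    have hc := testIntegrable_coth_short ha (lt_of_le_of_ne hb fun hh => h (by simp [← hh])) hι j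
    isAdj_dd ha hb hι (short_coroot j) (preservesDensity_short a b ι j) (by simpa using hc) hg
  have h3 : IsAdj a b ι ((a : ℂ) • ∑ k, pairOp j k) g _ := IsAdj.smul _ fun h =>
    IsAdj.sum Finset.univ fun k =>
      isAdj_pairOp (lt_of_le_of_ne ha fun hh => h (by simp [← hh])) hb hι j k hg
  have h4 : IsAdj a b ι ((rho r a b ι j : ℂ) • 1) g _ := IsAdj.smul _ fun _ =>
    IsAdj.one ha hb hι hg
  refine ((((h0.add h1).add h2).add h3).sub h4).congr fun t ht => ?_
  simp only [refl_long, refl_short, smul_apply, ContinuousLinearMap.proj_apply, smul_eq_mul,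
    cherAdj, logDeriv, coth_eq (ht.1 j), coth_eq (mul_ne_zero two_ne_zero (ht.1 j)),
    Finset.sum_add_distrib, ← Finset.sum_mul]
  push_cast
  ring

/-- The transpose of a Cherednik operator on test functions is its conjugate by `t ↦ -t`. -/
theorem isAdj_cherOp_test (ha : 0 ≤ a) (hb : 0 ≤ b) (hι : 0 ≤ ι) (j : Fin r) (g : TF r) :
    IsAdj a b ι (cherOp a b ι j) g ((compOp (ContinuousLinearEquiv.neg ℝ) * cherOp a b ι j *
      compOp (ContinuousLinearEquiv.neg ℝ) : TF r →L[ℂ] TF r) g) := by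
  have hdir : ∀ t, HasLineDerivAt ℝ g (dirOp (Pi.single j 1) g t) t (Pi.single j 1) := by
    intro t
    rw [dirOp_apply]
    exact (((contDiff_of_TF g).differentiable (by norm_num) t).hasFDerivAt).hasLineDerivAt _
  refine (isAdj_cherOp ha hb hι j g.continuous (dirOp (Pi.single j 1) g).continuous
    fun t _ => hdir t).congr fun t ht => ?_
  set J : TF r →L[ℂ] TF r := compOp (ContinuousLinearEquiv.neg ℝ)
  have hJ : ∀ (f : TF r) t, J f t = f (-t) := fun f t => rfl
  have ht' : -t ∈ regularSet r := by
    refine ⟨fun i => ?_, fun i k h => ?_⟩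
    · simpa using ht.1 i
    · have := ht.2 i k h
      simp only [Pi.neg_apply, neg_inj, ne_eq]
      exact this
  have hd : fderiv ℝ (J g) (-t) (Pi.single j 1) = -dirOp (Pi.single j 1) g t := by
    have e : ⇑(J g) = g ∘ (ContinuousLinearEquiv.neg ℝ : (Fin r → ℝ) ≃L[ℝ] (Fin r → ℝ)) := rfl
    have h2 : HasFDerivAt g (fderiv ℝ g t)
        ((ContinuousLinearEquiv.neg ℝ : (Fin r → ℝ) ≃L[ℝ] (Fin r → ℝ)) (-t)) := by
      simpa using ((contDiff_of_TF g).differentiable (by norm_num) t).hasFDerivAt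
    rw [e, (h2.comp (-t)
      (ContinuousLinearEquiv.neg ℝ : (Fin r → ℝ) ≃L[ℝ] (Fin r → ℝ)).hasFDerivAt).fderiv,
      dirOp_apply]
    simp
  have e1 : reflSign j (-t) = -reflSign j t := by
    funext k; by_cases h : k = j <;> simp [reflSign, h]
  have e2 : ∀ i k, reflSwap i k (-t) = -reflSwap i k t := fun i k => rfl
  have e3 : ∀ i k, reflSignedSwap i k (-t) = -reflSignedSwap i k t := by
    intro i k; funext m
    by_cases h : m = i
    · simp [reflSignedSwap, h]
    · by_cases h' : m = k
      · subst h'; simp [reflSignedSwap, h]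
      · simp [reflSignedSwap, h, h']
  have hpair : ∀ k, pairOp j k (J g) (-t) = pairAdj j k g t := by
    intro k
    rw [pairOp_apply _ ht']
    simp only [hJ, e2, e3, neg_neg, Pi.neg_apply]
    rcases lt_trichotomy j k with h | h | h
    · have n1 : t j - t k ≠ 0 := sub_ne_zero.2 (ht.2 j k h.ne).1
      have n2 : t j + t k ≠ 0 := fun hh => (ht.2 j k h.ne).2 (eq_neg_of_add_eq_zero_left hh)
      have c1 : -t j - -t k = -(t j - t k) := by ring
      have c2 : -t j + -t k = -(t j + t k) := by ring
      simp only [pairAdj, if_pos h, if_neg h.not_gt, if_pos h.ne', c1, c2, coef_neg n1, coef_neg n2]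
      push_cast
      ring
    · simp [pairAdj, h]
    · have n2 : t j + t k ≠ 0 := fun hh => (ht.2 j k h.ne').2 (eq_neg_of_add_eq_zero_left hh)
      have c1 : -t k - -t j = t j - t k := by ring
      have c2 : -t j + -t k = -(t j + t k) := by ring
      simp only [pairAdj, if_pos h, if_neg h.not_gt, if_pos h.ne, c1, c2, coef_neg n2,
        reflSwap_comm k j]
      push_cast
      ring
  have hs : (∑ k, pairOp j k) (J g) (-t) = ∑ k, pairOp j k (J g) (-t) := by
    rw [sum_apply]
    exact map_sum (⟨⟨fun g : TF r => g (-t), rfl⟩, fun _ _ => rfl⟩ : TF r →+ ℂ) _ _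
  symm
  change cherOp a b ι j (J g) (-t) = _
  unfold cherOp singleOp
  change (dirOp (Pi.single j 1) (J g) (-t) + (2 * ι : ℂ) * dl j (J g) (-t)
    + (2 * b : ℂ) * ds j (J g) (-t))
    + (a : ℂ) * (∑ k, pairOp j k) (J g) (-t) - (rho r a b ι j : ℂ) * (J g) (-t) = _
  rw [hs, Finset.sum_congr rfl fun k _ => hpair k, dirOp_apply, hd, dl_apply j _ (ht'.1 j),
    ds_apply j _ (ht'.1 j), e1, hJ, hJ, neg_neg, neg_neg]
  have c1 : coef (2 * (-t) j) = 1 - coef (2 * t j) := by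
    rw [Pi.neg_apply, mul_neg, coef_neg (mul_ne_zero two_ne_zero (ht.1 j))]
  have c2 : coef ((-t) j) = 1 - coef (t j) := by rw [Pi.neg_apply, coef_neg (ht.1 j)]
  rw [c1, c2, cherAdj]
  push_cast
  ring

end Adjoint

/-! ### Symmetry of the product of the Cherednik operators -/

section Symmetry

variable {r : ℕ} {a b ι : ℝ}

theorem neg_mul_neg_eq_one : compOp (ContinuousLinearEquiv.neg ℝ) *
    compOp (ContinuousLinearEquiv.neg ℝ) = (1 : TF r →L[ℂ] TF r) := by
  ext f t
  change f (- -t) = f t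
  rw [neg_neg]

theorem isAdj_sqOp (ha : 0 ≤ a) (hb : 0 ≤ b) (hι : 0 ≤ ι) (c : ℂ) (j : Fin r) (g : TF r) :
    IsAdj a b ι (sqOp a b ι c j) g ((compOp (ContinuousLinearEquiv.neg ℝ) * sqOp a b ι c j *
      compOp (ContinuousLinearEquiv.neg ℝ) : TF r →L[ℂ] TF r) g) := by
  set J : TF r →L[ℂ] TF r := compOp (ContinuousLinearEquiv.neg ℝ) with hJ
  have h1 := (isAdj_cherOp_test ha hb hι j g).comp (isAdj_cherOp_test ha hb hι j _)
  have h2 : IsAdj a b ι (c ^ 2 • (1 : TF r →L[ℂ] TF r)) g _ :=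
    IsAdj.smul _ fun _ => IsAdj.one ha hb hι g.continuous
  have e : J * sqOp a b ι c j * J =
      (J * cherOp a b ι j * J) * (J * cherOp a b ι j * J) - c ^ 2 • 1 := by
    have hJJ : J * J = 1 := neg_mul_neg_eq_one
    unfold sqOp
    rw [mul_sub, sub_mul, mul_smul_comm, smul_mul_assoc, mul_one, hJJ]
    have : (J * cherOp a b ι j * J) * (J * cherOp a b ι j * J) =
        J * cherOp a b ι j * (J * J) * cherOp a b ι j * J := by simp only [mul_assoc]
    rw [this, hJJ, mul_one]
    simp only [mul_assoc]
  rw [e]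
  exact h1.sub h2

/-- The product of the `D_j² - c²` is symmetric: its transpose is its conjugate by `t ↦ -t`, with
which it commutes. -/
theorem isAdj_prodOp (ha : 0 ≤ a) (hb : 0 ≤ b) (hι : 0 ≤ ι) (c : ℂ) (g : TF r) :
    IsAdj a b ι (prodOp r a b ι c) g (prodOp r a b ι c g) := by
  set J : TF r →L[ℂ] TF r := compOp (ContinuousLinearEquiv.neg ℝ) with hJ
  have hJJ : J * J = 1 := neg_mul_neg_eq_one
  have key : ∀ (l : List (Fin r)) (g : TF r), IsAdj a b ι (l.map (sqOp a b ι c)).prod g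
      ((J * (l.reverse.map (sqOp a b ι c)).prod * J : TF r →L[ℂ] TF r) g) := by
    intro l
    induction l with
    | nil =>
      intro g
      rw [List.reverse_nil, List.map_nil, List.prod_nil, mul_one, hJJ]
      exact IsAdj.one ha hb hι g.continuous
    | cons j l ih =>
      intro g
      have h := (isAdj_sqOp ha hb hι c j g).comp (ih _)
      rw [List.map_cons, List.prod_cons, List.reverse_cons, List.map_append, List.prod_append,
        List.map_singleton, List.prod_singleton]
      have e : J * ((l.reverse.map (sqOp a b ι c)).prod * sqOp a b ι c j) * J =
          (J * (l.reverse.map (sqOp a b ι c)).prod * J) * (J * sqOp a b ι c j * J) := by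
        have : (J * (l.reverse.map (sqOp a b ι c)).prod * J) * (J * sqOp a b ι c j * J) =
            J * (l.reverse.map (sqOp a b ι c)).prod * (J * J) * sqOp a b ι c j * J := by
          simp only [mul_assoc]
        rw [this, hJJ, mul_one]
        simp only [mul_assoc]
      rw [e]
      exact h
  have h := key (List.finRange r) g
  rw [← prodOp_eq_of_perm a b ι c (List.reverse_perm _).symm,
    (show J * prodOp r a b ι c = prodOp r a b ι c * J from neg_commute_prodOp a b ι c), mul_assoc,
    hJJ, mul_one] at h
  exact h

end Symmetry

/-! ### Transposes of the Cherednik operators on products of functions of one variable -/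

section ProductFunction

variable {r : ℕ} {a b ι : ℝ}

/-- The function `t ↦ ∏_m φ_m(t_m)`. -/
def prodFun (φ : Fin r → ℝ → ℂ) (t : Fin r → ℝ) : ℂ := ∏ m, φ m (t m)

/-- The product of the `φ_m(t_m)` over the indices `m ≠ j`. -/
def prodRest (φ : Fin r → ℝ → ℂ) (j : Fin r) (t : Fin r → ℝ) : ℂ :=
  ∏ m ∈ Finset.univ.erase j, φ m (t m)

theorem continuous_prodFun {φ : Fin r → ℝ → ℂ} (h : ∀ m, Continuous (φ m)) :
    Continuous (prodFun φ) :=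
  continuous_finsetProd _ fun m _ => (h m).comp (continuous_apply m)

theorem prodFun_eq (φ : Fin r → ℝ → ℂ) (j : Fin r) (t : Fin r → ℝ) :
    prodFun φ t = φ j (t j) * prodRest φ j t :=
  (Finset.mul_prod_erase _ (fun m => φ m (t m)) (Finset.mem_univ j)).symm

/-- The transpose of `D_j` on a product of functions of one variable. Only the factor `φ j` has to
be differentiable, off the origin. -/
theorem isAdj_prodFun (ha : 0 ≤ a) (hb : 0 ≤ b) (hι : 0 ≤ ι) (j : Fin r) {φ : Fin r → ℝ → ℂ}
    (h : ∀ m, Continuous (φ m)) {d : ℝ → ℂ} (hd : Continuous d)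
    (hφ : ∀ x ≠ 0, HasDerivAt (φ j) (d x) x) :
    IsAdj a b ι (cherOp a b ι j) (prodFun φ)
      (cherAdj a b ι j (prodFun φ) fun t => d (t j) * prodRest φ j t) := by
  refine isAdj_cherOp ha hb hι j (continuous_prodFun h) ?_ fun t ht => ?_
  · exact (hd.comp (continuous_apply j)).mul
      (continuous_finsetProd _ fun m _ => (h m).comp (continuous_apply m))
  · change HasDerivAt (fun s : ℝ => prodFun φ (t + s • (Pi.single j 1 : Fin r → ℝ))) _ 0
    have e : (fun s : ℝ => prodFun φ (t + s • (Pi.single j 1 : Fin r → ℝ))) =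
        fun s => φ j (t j + s) * prodRest φ j t := by
      funext s
      rw [prodFun_eq φ j]
      congr 1
      · simp
      · refine Finset.prod_congr rfl fun m hm => ?_
        simp [Finset.ne_of_mem_erase hm]
    rw [e]
    have h1 : HasDerivAt (φ j) (d (t j)) (t j + 0) := by
      rw [add_zero]; exact hφ _ (ht.1 j)
    exact (h1.comp_const_add (t j) 0).mul_const _

theorem prodFun_reflSign (φ : Fin r → ℝ → ℂ) (j : Fin r) (t : Fin r → ℝ) :
    prodFun φ (reflSign j t) = φ j (-t j) * prodRest φ j t := by
  rw [prodFun_eq φ j]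
  congr 1
  · simp [reflSign]
  · refine Finset.prod_congr rfl fun m hm => ?_
    simp [reflSign, Finset.ne_of_mem_erase hm]

/-- The values of a product function at `t` and its reflections in the coordinates `j`, `k` have the
other factors in common. -/
theorem exists_prodFun_pair (φ : Fin r → ℝ → ℂ) {j k : Fin r} (h : k ≠ j) (t : Fin r → ℝ) :
    ∃ R : ℂ, prodFun φ t = φ j (t j) * φ k (t k) * R ∧
      prodFun φ (reflSwap j k t) = φ j (t k) * φ k (t j) * R ∧
      prodFun φ (reflSignedSwap j k t) = φ j (-t k) * φ k (-t j) * R := by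
  have key : ∀ s : Fin r → ℝ, prodFun φ s = φ j (s j) * φ k (s k) *
      ∏ m ∈ (Finset.univ.erase j).erase k, φ m (s m) := by
    intro s
    rw [prodFun_eq φ j, prodRest, ← Finset.mul_prod_erase _ (fun m => φ m (s m))
      (Finset.mem_erase.2 ⟨h, Finset.mem_univ k⟩), mul_assoc]
  refine ⟨∏ m ∈ (Finset.univ.erase j).erase k, φ m (t m), key t, ?_, ?_⟩
  · rw [key]
    congr 1
    · simp [reflSwap]
    · refine Finset.prod_congr rfl fun m hm => ?_
      have h1 := Finset.ne_of_mem_erase hm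
      have h2 := Finset.ne_of_mem_erase (Finset.mem_of_mem_erase hm)
      simp [reflSwap, Equiv.swap_apply_of_ne_of_ne h2 h1]
  · rw [key]
    congr 1
    · simp [reflSignedSwap, h]
    · refine Finset.prod_congr rfl fun m hm => ?_
      have h1 := Finset.ne_of_mem_erase hm
      have h2 := Finset.ne_of_mem_erase (Finset.mem_of_mem_erase hm)
      simp [reflSignedSwap, h1, h2]

end ProductFunction

section Addition

theorem coth_sub {x y : ℝ} (hx : x ≠ 0) (hy : y ≠ 0) (h : x - y ≠ 0) :
    (coth x - coth y) * coth (x - y) = 1 - coth x * coth y := by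
  have h1 := sinh_ne_zero hx
  have h2 := sinh_ne_zero hy
  have h3 := sinh_ne_zero h
  have e : coth x - coth y = -Real.sinh (x - y) / (Real.sinh x * Real.sinh y) := by
    unfold coth
    rw [Real.sinh_sub]
    field_simp
    ring
  rw [e, coth, coth, coth]
  field_simp
  rw [Real.cosh_sub]
  ring

theorem coth_add {x y : ℝ} (hx : x ≠ 0) (hy : y ≠ 0) (h : x + y ≠ 0) :
    (coth x + coth y) * coth (x + y) = 1 + coth x * coth y := by
  have := coth_sub hx (neg_ne_zero.2 hy) (by rwa [sub_neg_eq_add])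
  rw [sub_neg_eq_add, coth_neg] at this
  linarith

theorem coth_two_mul {x : ℝ} (hx : x ≠ 0) : 2 * coth x * coth (2 * x) = 1 + coth x ^ 2 := by
  have := coth_add hx hx (by intro h; apply hx; linarith)
  rw [show x + x = 2 * x by ring] at this
  linear_combination this

end Addition

/-! ### Powers of `|sinh|` -/

section Phase

/-- The function `|sinh x| ^ s`. -/
def sinhPow (s : ℂ) (x : ℝ) : ℂ := ((|Real.sinh x| : ℝ) : ℂ) ^ s

/-- The function `|sinh x| ^ s (1 - coth x)`, written without a denominator. -/
def sinhPowSub (s : ℂ) (x : ℝ) : ℂ :=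
  sinhPow s x - (Real.cosh x * Real.sinh x : ℝ) * sinhPow (s - 2) x

/-- The derivative of `sinhPow s`. -/
def sinhPowDeriv (s : ℂ) (x : ℝ) : ℂ := s * ((Real.cosh x * Real.sinh x : ℝ) * sinhPow (s - 2) x)

/-- The derivative of `sinhPowSub s`. -/
def sinhPowSubDeriv (s : ℂ) (x : ℝ) : ℂ :=
  (s * (Real.cosh x * Real.sinh x : ℝ) - (Real.sinh x ^ 2 : ℝ) - (s - 1) * (Real.cosh x ^ 2 : ℝ)) *
    sinhPow (s - 2) x

theorem continuous_sinhPow {s : ℂ} (hs : 0 < s.re) : Continuous (sinhPow s) :=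
  (Complex.continuous_ofReal_cpow_const hs).comp Real.continuous_sinh.abs

theorem continuous_sinhPow_sub_two {s : ℂ} (hs : 2 < s.re) : Continuous (sinhPow (s - 2)) :=
  continuous_sinhPow (by simpa using hs)

theorem continuous_ofReal_comp {f : ℝ → ℝ} (hf : Continuous f) : Continuous fun x => (f x : ℂ) :=
  Complex.continuous_ofReal.comp hf

theorem continuous_sinhPowSub {s : ℂ} (hs : 2 < s.re) : Continuous (sinhPowSub s) :=
  (continuous_sinhPow (by linarith)).sub ((continuous_ofReal_comp
    (Real.continuous_cosh.mul Real.continuous_sinh)).mul (continuous_sinhPow_sub_two hs))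

theorem continuous_sinhPowDeriv {s : ℂ} (hs : 2 < s.re) : Continuous (sinhPowDeriv s) :=
  continuous_const.mul ((continuous_ofReal_comp
    (Real.continuous_cosh.mul Real.continuous_sinh)).mul (continuous_sinhPow_sub_two hs))

theorem continuous_sinhPowSubDeriv {s : ℂ} (hs : 2 < s.re) : Continuous (sinhPowSubDeriv s) :=
  (((continuous_const.mul (continuous_ofReal_comp
    (Real.continuous_cosh.mul Real.continuous_sinh))).sub (continuous_ofReal_comp
    (Real.continuous_sinh.pow 2))).sub (continuous_const.mul (continuous_ofReal_comp
    (Real.continuous_cosh.pow 2)))).mul (continuous_sinhPow_sub_two hs)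

theorem sinhPow_neg (s : ℂ) (x : ℝ) : sinhPow s (-x) = sinhPow s x := by
  simp [sinhPow]

theorem sinhPow_eq (s : ℂ) {x : ℝ} (hx : x ≠ 0) :
    sinhPow s x = (Real.sinh x : ℂ) ^ 2 * sinhPow (s - 2) x := by
  have h : ((|Real.sinh x| : ℝ) : ℂ) ≠ 0 := by
    exact_mod_cast abs_ne_zero.2 (sinh_ne_zero hx)
  have h2 : ((|Real.sinh x| : ℝ) : ℂ) ^ (2 : ℂ) = (Real.sinh x : ℂ) ^ 2 := by
    rw [show (2 : ℂ) = ((2 : ℕ) : ℂ) by norm_num, Complex.cpow_natCast, ← Complex.ofReal_pow,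
      sq_abs, Complex.ofReal_pow]
  rw [sinhPow, sinhPow, Complex.cpow_sub _ _ h, h2]
  have h3 : (Real.sinh x : ℂ) ≠ 0 := by exact_mod_cast sinh_ne_zero hx
  field_simp

theorem hasDerivAt_sinhPow (s : ℂ) {x : ℝ} (hx : x ≠ 0) :
    HasDerivAt (sinhPow s) (s * (coth x : ℂ) * sinhPow s x) x := by
  have h1 : ∀ y : ℝ, y ≠ 0 →
      sinhPow s y = Complex.exp (s * ((Real.log (Real.sinh y) : ℝ) : ℂ)) := by
    intro y hy
    have h : ((|Real.sinh y| : ℝ) : ℂ) ≠ 0 := by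
      exact_mod_cast abs_ne_zero.2 (sinh_ne_zero hy)
    rw [sinhPow, Complex.cpow_def_of_ne_zero h, ← Complex.ofReal_log (abs_nonneg _), Real.log_abs,
      mul_comm]
  have h2 : HasDerivAt (fun y : ℝ => Real.log (Real.sinh y)) (coth x) x :=
    (Real.hasDerivAt_sinh x).log (sinh_ne_zero hx)
  have h3 := (h2.ofReal_comp.const_mul s).cexp
  have h4 : HasDerivAt (sinhPow s) _ x := h3.congr_of_eventuallyEq (by
    filter_upwards [isOpen_ne.mem_nhds hx] with y hy using h1 y hy)
  refine h4.congr_deriv ?_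
  rw [h1 x hx]
  ring

theorem sinhPow_sub_two_eq (s : ℂ) {x : ℝ} (hx : x ≠ 0) :
    sinhPow (s - 2) x = sinhPow s x * ((coth x : ℂ) ^ 2 - 1) := by
  have h1 : (coth x ^ 2 - 1) * Real.sinh x ^ 2 = 1 := by
    have := sinh_ne_zero hx
    rw [coth]
    field_simp
    rw [Real.cosh_sq]
    ring
  have h2 : ((coth x : ℂ) ^ 2 - 1) * (Real.sinh x : ℂ) ^ 2 = 1 := by exact_mod_cast h1
  rw [sinhPow_eq s hx]
  linear_combination -sinhPow (s - 2) x * h2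

theorem sinhPowSub_eq (s : ℂ) {x : ℝ} (hx : x ≠ 0) :
    sinhPowSub s x = sinhPow s x * (1 - (coth x : ℂ)) := by
  have h : (Real.cosh x * Real.sinh x : ℝ) = coth x * Real.sinh x ^ 2 := by
    have := sinh_ne_zero hx
    rw [coth]
    field_simp
  rw [sinhPowSub, h, sinhPow_eq s hx]
  push_cast
  ring

theorem sinhPowDeriv_eq (s : ℂ) {x : ℝ} (hx : x ≠ 0) :
    sinhPowDeriv s x = s * (coth x : ℂ) * sinhPow s x := by
  have h : (Real.cosh x * Real.sinh x : ℝ) = coth x * Real.sinh x ^ 2 := by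
    have := sinh_ne_zero hx
    rw [coth]
    field_simp
  rw [sinhPowDeriv, h, sinhPow_eq s hx]
  push_cast
  ring

theorem sinhPowSubDeriv_eq (s : ℂ) {x : ℝ} (hx : x ≠ 0) : sinhPowSubDeriv s x =
    sinhPow s x * (s * (coth x : ℂ) - 1 - (s - 1) * (coth x : ℂ) ^ 2) := by
  have h : (Real.cosh x * Real.sinh x : ℝ) = coth x * Real.sinh x ^ 2 := by
    have := sinh_ne_zero hx
    rw [coth]
    field_simp
  have h' : Real.cosh x ^ 2 = coth x ^ 2 * Real.sinh x ^ 2 := by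
    have := sinh_ne_zero hx
    rw [coth]
    field_simp
  rw [sinhPowSubDeriv, h, h', sinhPow_eq s hx]
  push_cast
  ring

theorem hasDerivAt_sinhPow' (s : ℂ) {x : ℝ} (hx : x ≠ 0) :
    HasDerivAt (sinhPow s) (sinhPowDeriv s x) x := by
  rw [sinhPowDeriv_eq s hx]
  exact hasDerivAt_sinhPow s hx

theorem hasDerivAt_sinhPowSub (s : ℂ) {x : ℝ} (hx : x ≠ 0) :
    HasDerivAt (sinhPowSub s) (sinhPowSubDeriv s x) x := by
  have h1 := hasDerivAt_sinhPow s hx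
  have h2 := (((Real.hasDerivAt_cosh x).mul (Real.hasDerivAt_sinh x)).ofReal_comp).mul
    (hasDerivAt_sinhPow (s - 2) hx)
  have h3 : HasDerivAt (sinhPowSub s) _ x := h1.sub h2
  refine h3.congr_deriv ?_
  have hs : (coth x : ℂ) * (Real.sinh x : ℂ) = Real.cosh x := by
    have : coth x * Real.sinh x = Real.cosh x := div_mul_cancel₀ _ (sinh_ne_zero hx)
    exact_mod_cast this
  rw [sinhPowSubDeriv, sinhPow_eq s hx]
  simp only [Pi.mul_apply]
  push_cast at hs ⊢
  rw [← hs]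
  ring

end Phase

/-! ### The action of the transposes on powers of `SH` -/

section PhaseAction

variable {r : ℕ} {a b ι : ℝ}

/-- The function `∏_{m < n} |sinh t_m| ^ δ (1 - coth t_m) ∏_{m ≥ n} |sinh t_m| ^ s`. -/
def mixedPow (δ s : ℂ) (n : ℕ) (t : Fin r → ℝ) : ℂ :=
  prodFun (fun m : Fin r => if (m : ℕ) < n then sinhPowSub δ else sinhPow s) t

theorem pair_zero_zero (δ : ℂ) (x y : ℝ) :
    sinhPow δ (-y) * sinhPow δ (-x) = sinhPow δ x * sinhPow δ y := by
  rw [sinhPow_neg, sinhPow_neg, mul_comm]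

theorem card_filter_lt (j : Fin r) : ∑ k : Fin r, (if k < j then (1 : ℂ) else 0) = (j : ℕ) := by
  rw [Finset.sum_ite, Finset.sum_const_zero, add_zero, Finset.sum_const, nsmul_eq_mul, mul_one]
  have : Finset.univ.filter (· < j) = Finset.Iio j := by ext; simp
  rw [this, Fin.card_Iio]

theorem card_filter_gt (j : Fin r) :
    ∑ k : Fin r, (if j < k then (1 : ℂ) else 0) = (r : ℂ) - 1 - (j : ℕ) := by
  rw [Finset.sum_ite, Finset.sum_const_zero, add_zero, Finset.sum_const, nsmul_eq_mul, mul_one]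
  have : Finset.univ.filter (j < ·) = Finset.Ioi j := by ext; simp
  have h := j.2
  rw [this, Fin.card_Ioi, Nat.cast_sub (by omega), Nat.cast_sub (by omega), Nat.cast_one]

/-- The first `r` factors `D_j + c` of `𝓜_δ` turn the even factors `|sinh t_j| ^ δ` into
`|sinh t_j| ^ δ (1 - coth t_j)`, one after the other. -/
theorem isAdj_mixedPow_add (ha : 0 ≤ a) (hb : 0 ≤ b) (hι : 0 ≤ ι) {δ : ℂ} (hδ : 2 < δ.re)
    (j : Fin r) : IsAdj a b ι
      (cherOp a b ι j + (δ + ((ι + b + a * ((r : ℝ) - 1) : ℝ) : ℂ)) • 1) (mixedPow δ δ j)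
      fun t => (δ + a * (j : ℕ)) * mixedPow δ δ (j + 1) t := by
  set φ : Fin r → ℝ → ℂ := fun m => if (m : ℕ) < j then sinhPowSub δ else sinhPow δ with hφ
  have hcont : ∀ m, Continuous (φ m) := by
    intro m
    simp only [hφ]
    split_ifs
    · exact continuous_sinhPowSub hδ
    · exact continuous_sinhPow (by linarith)
  have hj : φ j = sinhPow δ := by simp [hφ]
  have h1 := isAdj_prodFun ha hb hι j hcont (continuous_sinhPowDeriv hδ)
    (fun x hx => by rw [hj]; exact hasDerivAt_sinhPow' δ hx)
  have h2 := IsAdj.smul (δ + ((ι + b + a * ((r : ℝ) - 1) : ℝ) : ℂ)) fun _ =>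
    IsAdj.one (a := a) (b := b) (ι := ι) ha hb hι (continuous_prodFun hcont)
  refine (h1.add h2).congr fun t ht => ?_
  have hx := ht.1 j
  have hg : prodFun φ t = sinhPow δ (t j) * prodRest φ j t := by rw [prodFun_eq φ j, hj]
  have hsign : prodFun φ (reflSign j t) = prodFun φ t := by
    rw [prodFun_reflSign, hg, hj, sinhPow_neg]
  have hpair : ∀ k, pairAdj j k (prodFun φ) t =
      (if k < j then (1 : ℂ) else 0) * (-(coth (t j) : ℂ) * prodFun φ t) := by
    intro k
    rcases lt_trichotomy j k with h | h | h
    · obtain ⟨R, e1, e2, e3⟩ := exists_prodFun_pair φ h.ne' t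
      have hk : φ k = sinhPow δ := by
        have : ¬ (k : ℕ) < j := not_lt.2 (Fin.lt_def.1 h).le
        exact if_neg this
      rw [hj, hk] at e1 e2 e3
      rw [pairAdj, if_pos h, if_neg h.not_gt, e1, e2, e3, pair_zero_zero]
      ring
    · simp [pairAdj, h]
    · obtain ⟨R, e1, e2, e3⟩ := exists_prodFun_pair φ h.ne t
      have hk : φ k = sinhPowSub δ := by
        exact if_pos (Fin.lt_def.1 h)
      have hy := ht.1 k
      have n1 : t j - t k ≠ 0 := sub_ne_zero.2 (ht.2 j k h.ne').1
      have n2 : t j + t k ≠ 0 := fun hh => (ht.2 j k h.ne').2 (eq_neg_of_add_eq_zero_left hh)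
      have w1 : ((coth (t j) : ℂ) - coth (t k)) * coth (t j - t k) =
        1 - coth (t j) * coth (t k) := by exact_mod_cast coth_sub hx hy n1
      have w2 : ((coth (t j) : ℂ) + coth (t k)) * coth (t j + t k) =
        1 + coth (t j) * coth (t k) := by exact_mod_cast coth_add hx hy n2
      rw [hj, hk, sinhPowSub_eq δ hy] at e1
      rw [hj, hk, sinhPowSub_eq δ hx] at e2
      rw [hj, hk, sinhPowSub_eq δ (neg_ne_zero.2 hx), sinhPow_neg, sinhPow_neg, coth_neg] at e3
      rw [pairAdj, if_neg h.not_gt, if_pos h, if_pos h, e1, e2, e3, coef_eq n1, coef_eq n2]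
      push_cast
      linear_combination (-(1 / 2 : ℂ) * sinhPow δ (t j) * sinhPow δ (t k) * R) * w1 +
        (1 / 2 : ℂ) * sinhPow δ (t j) * sinhPow δ (t k) * R * w2
  have hnext : mixedPow δ δ (j + 1) t = prodFun φ t * (1 - (coth (t j) : ℂ)) := by
    rw [mixedPow, prodFun_eq _ j, hg, if_pos (Nat.lt_succ_self _), sinhPowSub_eq δ hx]
    have : prodRest (fun m : Fin r => if (m : ℕ) < j + 1 then sinhPowSub δ else sinhPow δ) j t =
        prodRest φ j t := by
      refine Finset.prod_congr rfl fun m hm => ?_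
      have hmj : (m : ℕ) ≠ j := fun hh => Finset.ne_of_mem_erase hm (Fin.ext hh)
      have : (m : ℕ) < j + 1 ↔ (m : ℕ) < j := by omega
      simp only [hφ, this]
    rw [this]
    ring
  rw [hnext]
  simp only [cherAdj]
  rw [hsign, Finset.sum_congr rfl fun k _ => hpair k, ← Finset.sum_mul, card_filter_lt,
    sinhPowDeriv_eq δ hx, rho]
  push_cast
  linear_combination δ * (coth (t j) : ℂ) * hg

/-- The last `r` factors `D_j - c` of `𝓜_δ` turn the factors `|sinh t_j| ^ δ (1 - coth t_j)` into
`|sinh t_j| ^ (δ - 2)`, in the opposite order. -/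
theorem isAdj_mixedPow_sub (ha : 0 ≤ a) (hb : 0 ≤ b) (hι : 0 ≤ ι) {δ : ℂ} (hδ : 2 < δ.re)
    (j : Fin r) : IsAdj a b ι
      (cherOp a b ι j - (δ + ((ι + b + a * ((r : ℝ) - 1) : ℝ) : ℂ)) • 1)
      (mixedPow δ (δ - 2) (j + 1))
      fun t => (δ - 1 + ι + 2 * b + a * ((r : ℂ) - 1 - (j : ℕ))) * mixedPow δ (δ - 2) j t := by
  set φ : Fin r → ℝ → ℂ := fun m => if (m : ℕ) < j + 1 then sinhPowSub δ else sinhPow (δ - 2)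
    with hφ
  have hcont : ∀ m, Continuous (φ m) := by
    intro m
    simp only [hφ]
    split_ifs
    · exact continuous_sinhPowSub hδ
    · exact continuous_sinhPow_sub_two hδ
  have hj : φ j = sinhPowSub δ := by simp [hφ]
  have h1 := isAdj_prodFun ha hb hι j hcont (continuous_sinhPowSubDeriv hδ)
    (fun x hx => by rw [hj]; exact hasDerivAt_sinhPowSub δ hx)
  have h2 := IsAdj.smul (δ + ((ι + b + a * ((r : ℝ) - 1) : ℝ) : ℂ)) fun _ =>
    IsAdj.one (a := a) (b := b) (ι := ι) ha hb hι (continuous_prodFun hcont)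
  refine (h1.sub h2).congr fun t ht => ?_
  have hx := ht.1 j
  have hg : prodFun φ t = sinhPow δ (t j) * (1 - (coth (t j) : ℂ)) * prodRest φ j t := by
    rw [prodFun_eq φ j, hj, sinhPowSub_eq δ hx]
  have hsign : prodFun φ (reflSign j t) =
      sinhPow δ (t j) * (1 + (coth (t j) : ℂ)) * prodRest φ j t := by
    rw [prodFun_reflSign, hj, sinhPowSub_eq δ (neg_ne_zero.2 hx), sinhPow_neg, coth_neg]
    push_cast
    ring
  have hpair : ∀ k, pairAdj j k (prodFun φ) t =
      (if k < j then (1 : ℂ) else 0) * prodFun φ t +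
      (if j < k then (1 : ℂ) else 0) * ((1 - (coth (t j) : ℂ)) * prodFun φ t) := by
    intro k
    rcases eq_or_ne j k with h | h
    · simp [pairAdj, h]
    have hy := ht.1 k
    have n1 : t j - t k ≠ 0 := sub_ne_zero.2 (ht.2 j k h).1
    have n2 : t j + t k ≠ 0 := fun hh => (ht.2 j k h).2 (eq_neg_of_add_eq_zero_left hh)
    have w1 : ((coth (t j) : ℂ) - coth (t k)) * coth (t j - t k) =
      1 - coth (t j) * coth (t k) := by exact_mod_cast coth_sub hx hy n1
    have w2 : ((coth (t j) : ℂ) + coth (t k)) * coth (t j + t k) =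
      1 + coth (t j) * coth (t k) := by exact_mod_cast coth_add hx hy n2
    obtain ⟨R, e1, e2, e3⟩ := exists_prodFun_pair φ h.symm t
    rcases lt_or_gt_of_ne h with h | h
    · have hk : φ k = sinhPow (δ - 2) := by
        have : ¬ (k : ℕ) < j + 1 := by rw [Fin.lt_def] at h; omega
        exact if_neg this
      rw [hj, hk, sinhPowSub_eq δ hx, sinhPow_sub_two_eq δ hy] at e1
      rw [hj, hk, sinhPowSub_eq δ hy, sinhPow_sub_two_eq δ hx] at e2
      rw [hj, hk, sinhPowSub_eq δ (neg_ne_zero.2 hy), sinhPow_neg δ, sinhPow_neg, coth_neg,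
        sinhPow_sub_two_eq δ hx] at e3
      rw [pairAdj, if_pos h, if_neg h.not_gt, if_pos h, e1, e2, e3, coef_eq n1, coef_eq n2]
      push_cast
      generalize (coth (t j) : ℂ) = u at w1 w2 ⊢
      generalize (coth (t k) : ℂ) = v at w1 w2 ⊢
      linear_combination (-(1 / 2 : ℂ) * sinhPow δ (t j) * sinhPow δ (t k) * R *
        (1 - u) * (1 - v)) * w1 - (1 / 2 : ℂ) * sinhPow δ (t j) * sinhPow δ (t k) * R *
        (1 - u) * (1 + v) * w2
    · have hk : φ k = sinhPowSub δ := by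
        have : (k : ℕ) < j + 1 := by rw [Fin.lt_def] at h; omega
        exact if_pos this
      rw [hj, hk, sinhPowSub_eq δ hx, sinhPowSub_eq δ hy] at e1
      rw [hj, hk, sinhPowSub_eq δ hx, sinhPowSub_eq δ hy] at e2
      rw [hj, hk, sinhPowSub_eq δ (neg_ne_zero.2 hx), sinhPowSub_eq δ (neg_ne_zero.2 hy),
        sinhPow_neg δ, sinhPow_neg, coth_neg, coth_neg] at e3
      rw [pairAdj, if_neg h.not_gt, if_pos h, if_pos h, if_neg h.not_gt, e1, e2, e3, coef_eq n1,
        coef_eq n2]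
      push_cast
      generalize (coth (t j) : ℂ) = u at w1 w2 ⊢
      generalize (coth (t k) : ℂ) = v at w1 w2 ⊢
      linear_combination sinhPow δ (t j) * sinhPow δ (t k) * R * w2
  have hnext : mixedPow δ (δ - 2) j t =
      sinhPow δ (t j) * ((coth (t j) : ℂ) ^ 2 - 1) * prodRest φ j t := by
    rw [mixedPow, prodFun_eq _ j, if_neg (lt_irrefl _), sinhPow_sub_two_eq δ hx]
    have : prodRest (fun m : Fin r => if (m : ℕ) < j then sinhPowSub δ else sinhPow (δ - 2)) j t =
        prodRest φ j t := by
      refine Finset.prod_congr rfl fun m hm => ?_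
      have hmj : (m : ℕ) ≠ j := fun hh => Finset.ne_of_mem_erase hm (Fin.ext hh)
      have : (m : ℕ) < j + 1 ↔ (m : ℕ) < j := by omega
      simp only [hφ, this]
    rw [this]
  have w : 2 * (coth (t j) : ℂ) * coth (2 * t j) = 1 + (coth (t j) : ℂ) ^ 2 := by
    exact_mod_cast coth_two_mul hx
  rw [hnext]
  simp only [cherAdj]
  rw [hsign, Finset.sum_congr rfl fun k _ => hpair k, Finset.sum_add_distrib, ← Finset.sum_mul,
    ← Finset.sum_mul, card_filter_lt, card_filter_gt,
    sinhPowSubDeriv_eq δ hx, rho, hg, coef_eq hx, coef_eq (mul_ne_zero two_ne_zero hx)]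
  push_cast
  generalize (coth (t j) : ℂ) = u at w ⊢
  linear_combination (ι : ℂ) * sinhPow δ (t j) * prodRest φ j t * w

end PhaseAction

/-! ### The functional equation for large `Re δ` -/

section Chain

variable {r : ℕ}

/-- The operator `D_n`, with the index a natural number; it is `0` for `n ≥ r`. -/
def natCher (r : ℕ) (a b ι : ℝ) (n : ℕ) : TF r →L[ℂ] TF r :=
  if h : n < r then cherOp a b ι ⟨n, h⟩ else 0

theorem commute_natCher (a b ι : ℝ) (m n : ℕ) :
    Commute (natCher r a b ι m) (natCher r a b ι n) := by
  unfold natCher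
  split_ifs
  · exact commute_cherOp a b ι _ _
  · exact Commute.zero_right _
  · exact Commute.zero_left _
  · exact Commute.zero_left _

/-- The product `(D_0 + c) ⋯ (D_{n-1} + c)`. -/
def addProd (r : ℕ) (a b ι : ℝ) (c : ℂ) : ℕ → (TF r →L[ℂ] TF r)
  | 0 => 1
  | n + 1 => addProd r a b ι c n * (natCher r a b ι n + c • 1)

/-- The product `(D_{n-1} - c) ⋯ (D_0 - c)`. -/
def subProd (r : ℕ) (a b ι : ℝ) (c : ℂ) : ℕ → (TF r →L[ℂ] TF r)
  | 0 => 1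
  | n + 1 => (natCher r a b ι n - c • 1) * subProd r a b ι c n

theorem commute_subProd (a b ι : ℝ) (c : ℂ) (m n : ℕ) :
    Commute (natCher r a b ι m) (subProd r a b ι c n) := by
  induction n with
  | zero => exact Commute.one_right _
  | succ n ih =>
    exact ((commute_natCher a b ι m n).sub_right ((Commute.one_right _).smul_right _)).mul_right ih

theorem addProd_mul_subProd (a b ι : ℝ) (c : ℂ) (n : ℕ) :
    addProd r a b ι c n * subProd r a b ι c n =
      ((List.range n).map fun m => natCher r a b ι m * natCher r a b ι m - c ^ 2 • 1).prod := by
  induction n with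
  | zero => simp [addProd, subProd]
  | succ n ih =>
    rw [List.range_succ, List.map_append, List.prod_append, List.map_singleton,
      List.prod_singleton, ← ih]
    have h1 := commute_subProd (r := r) a b ι c n n
    have h2 : Commute (natCher r a b ι n * natCher r a b ι n - c ^ 2 • 1)
        (subProd r a b ι c n) :=
      (h1.mul_left h1).sub_left ((Commute.one_left _).smul_left _)
    have h3 : (natCher r a b ι n + c • 1) * (natCher r a b ι n - c • 1) =
        natCher r a b ι n * natCher r a b ι n - c ^ 2 • 1 := by
      simp only [add_mul, mul_sub, smul_mul_assoc, mul_smul_comm, one_mul, mul_one]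
      module
    rw [addProd, subProd, mul_assoc, ← mul_assoc (_ + _), h3, h2.eq, mul_assoc]

/-- As the Cherednik operators commute, `𝓜_δ` is
`(D_0 + c) ⋯ (D_{r-1} + c) (D_{r-1} - c) ⋯ (D_0 - c)`. -/
theorem prodOp_eq_addProd_mul_subProd (a b ι : ℝ) (c : ℂ) :
    prodOp r a b ι c = addProd r a b ι c r * subProd r a b ι c r := by
  rw [addProd_mul_subProd, prodOp, ← List.map_coe_finRange_eq_range, List.map_map]
  congr 1
  refine List.map_congr_left fun j _ => ?_
  simp only [Function.comp_apply, natCher, j.2, dif_pos, Fin.eta, sqOp]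

variable {a b ι : ℝ}

/-- The image of `|SH| ^ δ` under the transposes of the first `n` factors `D_j + c`. -/
theorem isAdj_addProd (ha : 0 ≤ a) (hb : 0 ≤ b) (hι : 0 ≤ ι) {δ : ℂ} (hδ : 2 < δ.re) (n : ℕ)
    (hn : n ≤ r) : IsAdj a b ι
      (addProd r a b ι (δ + ((ι + b + a * ((r : ℝ) - 1) : ℝ) : ℂ)) n) (mixedPow δ δ 0)
      fun t => (∏ j ∈ Finset.range n, (δ + a * (j : ℕ))) * mixedPow δ δ n t := by
  induction n with
  | zero =>
    have hc : Continuous (mixedPow (r := r) δ δ 0) := continuous_prodFun fun m => by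
      simpa using continuous_sinhPow (s := δ) (by linarith)
    exact (IsAdj.one ha hb hι hc).congr fun t _ => by simp
  | succ n ih =>
    have hn' : n < r := hn
    have h1 := isAdj_mixedPow_add (r := r) ha hb hι hδ ⟨n, hn'⟩
    have h2 := (ih hn'.le).comp (h1.const_mul (∏ j ∈ Finset.range n, (δ + a * (j : ℕ))))
    rw [addProd, natCher, dif_pos hn']
    refine h2.congr fun t _ => ?_
    rw [Finset.prod_range_succ]
    ring

/-- The transposes of the last `n` factors `D_j - c` turn `mixedPow δ (δ - 2) n` into
`|SH| ^ (δ - 2)`. -/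
theorem isAdj_subProd (ha : 0 ≤ a) (hb : 0 ≤ b) (hι : 0 ≤ ι) {δ : ℂ} (hδ : 2 < δ.re) (n : ℕ)
    (hn : n ≤ r) : IsAdj a b ι
      (subProd r a b ι (δ + ((ι + b + a * ((r : ℝ) - 1) : ℝ) : ℂ)) n) (mixedPow δ (δ - 2) n)
      fun t => (∏ j ∈ Finset.range n, (δ - 1 + ι + 2 * b + a * ((r : ℂ) - 1 - (j : ℕ)))) *
        mixedPow δ (δ - 2) 0 t := by
  induction n with
  | zero =>
    have hc : Continuous (mixedPow (r := r) δ (δ - 2) 0) := continuous_prodFun fun m => by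
      simpa using continuous_sinhPow_sub_two hδ
    exact (IsAdj.one ha hb hι hc).congr fun t _ => by simp
  | succ n ih =>
    have hn' : n < r := hn
    have h1 := isAdj_mixedPow_sub (r := r) ha hb hι hδ ⟨n, hn'⟩
    have h2 := h1.comp ((ih hn'.le).const_mul (δ - 1 + ι + 2 * b + a * ((r : ℂ) - 1 - (n : ℕ))))
    rw [subProd, natCher, dif_pos hn']
    refine h2.congr fun t _ => ?_
    rw [Finset.prod_range_succ]
    ring

theorem mixedPow_zero (δ s : ℂ) (t : Fin r → ℝ) : mixedPow δ s 0 t = ((|SH t| : ℝ) : ℂ) ^ s := by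
  have key : ∀ u : Finset (Fin r), ∏ m ∈ u, sinhPow s (t m) =
      ((|∏ m ∈ u, Real.sinh (t m)| : ℝ) : ℂ) ^ s := by
    intro u
    induction u using Finset.induction_on with
    | empty => simp
    | insert m u hm ih =>
      rw [Finset.prod_insert hm, Finset.prod_insert hm, ih, abs_mul, Complex.ofReal_mul,
        Complex.mul_cpow_ofReal_nonneg (abs_nonneg _) (abs_nonneg _), sinhPow]
  have := key Finset.univ
  simpa [mixedPow, prodFun, SH] using this

/-- The factor in `𝓜_δ |SH| ^ δ = bFactor δ * |SH| ^ (δ - 2)`. -/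
def bFactor (r : ℕ) (a b ι : ℝ) (δ : ℂ) : ℂ :=
  (∏ j ∈ Finset.range r, (δ + a * (j : ℕ))) *
    ∏ j ∈ Finset.range r, (δ - 1 + ι + 2 * b + a * ((r : ℂ) - 1 - (j : ℕ)))

/-- The functional equation before normalization, for exponents so large that all the functions in
the chain from `|SH| ^ δ` to `|SH| ^ (δ - 2)` are continuous. -/
theorem integral_prodOp (ha : 0 ≤ a) (hb : 0 ≤ b) (hι : 0 ≤ ι) {δ : ℂ} (hδ : 2 < δ.re)
    (f : TF r) :
    ∫ t, ((|SH t| : ℝ) : ℂ) ^ δ *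
        prodOp r a b ι (δ + ((ι + b + a * ((r : ℝ) - 1) : ℝ) : ℂ)) f t ∂mu r a b ι =
      bFactor r a b ι δ * ∫ t, ((|SH t| : ℝ) : ℂ) ^ (δ - 2) * f t ∂mu r a b ι := by
  have h1 := isAdj_addProd (r := r) ha hb hι hδ r le_rfl
  have h2 := (isAdj_subProd (r := r) ha hb hι hδ r le_rfl).const_mul
    (∏ j ∈ Finset.range r, (δ + a * (j : ℕ)))
  -- the two halves of the chain meet where all factors are `|sinh| ^ δ (1 - coth)`
  have e : mixedPow (r := r) δ (δ - 2) r = mixedPow δ δ r := by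
    funext t
    unfold mixedPow prodFun
    exact Finset.prod_congr rfl fun m _ => by simp only [m.2, if_true]
  rw [e] at h2
  have h3 := ((h1.comp h2) f).2.2
  rw [← prodOp_eq_addProd_mul_subProd] at h3
  simp only [mixedPow_zero] at h3
  simp only [mul_comm (_ ^ δ)]
  rw [h3, ← integral_const_mul]
  refine integral_congr_ae (Filter.Eventually.of_forall fun t => ?_)
  simp only [bFactor]
  ring

/-- The recursion `Γ(s + 1) = s Γ(s)`, in a form that holds at the poles as well. -/
theorem inv_gindikinGamma (a : ℝ) (s : ℂ) : (gindikinGamma r a s)⁻¹ =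
    (∏ j : Fin r, (s - (a : ℂ) / 2 * ((j : ℕ) : ℂ))) * (gindikinGamma r a (s + 1))⁻¹ := by
  unfold gindikinGamma
  rw [← Finset.prod_inv_distrib, ← Finset.prod_inv_distrib, ← Finset.prod_mul_distrib]
  refine Finset.prod_congr rfl fun j _ => ?_
  rw [Complex.one_div_Gamma_eq_self_mul_one_div_Gamma_add_one]
  congr 3
  ring

/-- The recursion of the normalizing factor. -/
theorem bFactor_mul_inv_zNorm (a b ι : ℝ) (δ : ℂ) :
    bFactor r a b ι δ * (zNorm r a b ι δ)⁻¹ = 2 ^ (2 * r) * (zNorm r a b ι (δ - 2))⁻¹ := by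
  unfold zNorm
  have e1 : δ / 2 + (a : ℂ) / 2 * ((r : ℂ) - 1) + 1 =
    ((δ - 2) / 2 + (a : ℂ) / 2 * ((r : ℂ) - 1) + 1) + 1 := by ring
  have e2 : (δ - 1 + ι + 2 * b) / 2 + (a : ℂ) / 2 * ((r : ℂ) - 1) + 1 =
    ((δ - 2 - 1 + ι + 2 * b) / 2 + (a : ℂ) / 2 * ((r : ℂ) - 1) + 1) + 1 := by ring
  rw [mul_inv, mul_inv, e1, e2, inv_gindikinGamma a ((δ - 2) / 2 + (a : ℂ) / 2 * ((r : ℂ) - 1) + 1),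
    inv_gindikinGamma a ((δ - 2 - 1 + ι + 2 * b) / 2 + (a : ℂ) / 2 * ((r : ℂ) - 1) + 1)]
  have h1 : ∏ j ∈ Finset.range r, (δ + a * (j : ℕ)) = 2 ^ r * ∏ j : Fin r,
      ((δ - 2) / 2 + (a : ℂ) / 2 * ((r : ℂ) - 1) + 1 - (a : ℂ) / 2 * ((j : ℕ) : ℂ)) := by
    rw [← Finset.prod_range_reflect, Finset.prod_range (fun j => δ + a * ((r - 1 - j : ℕ) : ℂ)),
      ← Fin.prod_const, ← Finset.prod_mul_distrib]
    refine Finset.prod_congr rfl fun j _ => ?_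
    have := j.2
    rw [Nat.cast_sub (by omega), Nat.cast_sub (by omega)]
    push_cast
    ring
  have h2 : ∏ j ∈ Finset.range r, (δ - 1 + ι + 2 * b + a * ((r : ℂ) - 1 - (j : ℕ))) =
      2 ^ r * ∏ j : Fin r, ((δ - 2 - 1 + ι + 2 * b) / 2 + (a : ℂ) / 2 * ((r : ℂ) - 1) + 1 -
        (a : ℂ) / 2 * ((j : ℕ) : ℂ)) := by
    rw [Finset.prod_range, ← Fin.prod_const, ← Finset.prod_mul_distrib]
    refine Finset.prod_congr rfl fun j _ => ?_
    ring
  rw [bFactor, h1, h2, two_mul r, pow_add]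
  ring

theorem differentiable_inv_zNorm (r : ℕ) (a b ι : ℝ) :
    Differentiable ℂ fun δ => (zNorm r a b ι δ)⁻¹ := by
  have key : ∀ f : ℂ → ℂ, Differentiable ℂ f →
      Differentiable ℂ fun δ => (gindikinGamma r a (f δ))⁻¹ := by
    intro f hf
    unfold gindikinGamma
    simp only [← Finset.prod_inv_distrib]
    refine Differentiable.fun_finsetProd fun j _ => ?_
    exact Complex.differentiable_one_div_Gamma.comp (hf.sub_const _)
  unfold zNorm
  simp only [mul_inv]
  exact (key _ (by fun_prop)).mul (key _ (by fun_prop))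

end Chain

/-! ### The zeta distribution in the half plane of convergence -/

section Convergence

variable {r : ℕ} {a b ι : ℝ}

/-- In the coordinate `t_j` the function is of size `|sinh t_j| ^ (s + ι + 2b)` near the origin;
this is where the half plane of convergence comes from. -/
theorem locallyIntegrable_abs_SH (ha : 0 ≤ a) (hι : 0 ≤ ι) {s : ℝ}
    (hs : -1 - ι - 2 * b < s) :
    LocallyIntegrable (fun t : Fin r → ℝ => |SH t| ^ s * density r a b ι t) volume := by
  have h1 : LocallyIntegrable (fun x : ℝ => |Real.sinh x| ^ s *
      (|2 * Real.sinh (2 * x)| ^ ι * |2 * Real.sinh x| ^ (2 * b))) volume := by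
    have h2 := locallyIntegrable_abs_sinh_rpow (s := s + ι + 2 * b) (by linarith)
    have h3 : Continuous fun x : ℝ => (2 : ℝ) ^ (-s) * (2 * Real.cosh x) ^ ι :=
      continuous_const.mul ((continuous_const.mul Real.continuous_cosh).rpow_const
        fun _ => Or.inr hι)
    have h4 := (locallyIntegrableOn_univ.2 h2).mul_continuousOn h3.continuousOn
      isOpen_univ.isLocallyClosed
    rw [locallyIntegrableOn_univ] at h4
    refine h4.congr ?_
    have : ∀ᵐ x : ℝ, x ≠ 0 := by simp [ae_iff]
    filter_upwards [this] with x hx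
    have p1 : 0 < |Real.sinh x| := abs_pos.2 (sinh_ne_zero hx)
    have p2 : 0 < |2 * Real.sinh x| := abs_pos.2 (mul_ne_zero two_ne_zero (sinh_ne_zero hx))
    have e1 : |2 * Real.sinh (2 * x)| = |2 * Real.sinh x| * (2 * Real.cosh x) := by
      rw [Real.sinh_two_mul, ← abs_of_pos (show 0 < 2 * Real.cosh x by positivity), ← abs_mul]
      congr 1
      ring
    have e2 : |Real.sinh x| ^ s = 2 ^ (-s) * |2 * Real.sinh x| ^ s := by
      rw [abs_mul, abs_two, Real.mul_rpow zero_le_two p1.le, ← mul_assoc,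
        ← Real.rpow_add zero_lt_two, neg_add_cancel, Real.rpow_zero, one_mul]
    rw [e1, Real.mul_rpow p2.le (by positivity), e2, Real.rpow_add p2, Real.rpow_add p2]
    ring
  have h5 := locallyIntegrable_prod (r := r) fun _ => h1
  have h6 : Continuous fun t : Fin r → ℝ => ∏ i, ∏ j ∈ Finset.Ioi i,
      |2 * Real.sinh (t i - t j)| ^ a * |2 * Real.sinh (t i + t j)| ^ a := by
    have h3 := continuous_abs_sinh_rpow ha
    fun_prop
  have h7 := (locallyIntegrableOn_univ.2 h5).mul_continuousOn h6.continuousOn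
    isOpen_univ.isLocallyClosed
  rw [locallyIntegrableOn_univ] at h7
  refine h7.congr (Filter.Eventually.of_forall fun t => ?_)
  simp only [SH, density, Finset.abs_prod]
  rw [← Real.finsetProd_rpow _ _ fun j _ => abs_nonneg _, Finset.prod_mul_distrib, mul_assoc]

theorem SH_ne_zero {t : Fin r → ℝ} (ht : t ∈ regularSet r) : SH t ≠ 0 :=
  Finset.prod_ne_zero_iff.2 fun j _ => sinh_ne_zero (ht.1 j)

theorem measurable_SH : Measurable (SH (r := r)) := by
  unfold SH
  fun_prop

theorem norm_SH_cpow {t : Fin r → ℝ} (ht : t ∈ regularSet r) (δ : ℂ) :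
    ‖((|SH t| : ℝ) : ℂ) ^ δ‖ = |SH t| ^ δ.re :=
  Complex.norm_cpow_eq_rpow_re_of_pos (abs_pos.2 (SH_ne_zero ht)) δ

theorem measurable_SH_cpow (δ : ℂ) : Measurable fun t : Fin r → ℝ => ((|SH t| : ℝ) : ℂ) ^ δ :=
  (Complex.measurable_ofReal.comp measurable_SH.abs).pow_const δ

theorem locallyIntegrable_SH_cpow (ha : 0 ≤ a) (hι : 0 ≤ ι) {δ : ℂ}
    (hδ : -1 - ι - 2 * b < δ.re) :
    LocallyIntegrable (fun t : Fin r → ℝ => ((|SH t| : ℝ) : ℂ) ^ δ * (density r a b ι t : ℂ))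
      volume := by
  refine (locallyIntegrable_abs_SH (r := r) ha hι hδ).mono ?_ ?_
  · exact ((measurable_SH_cpow δ).mul
      (Complex.measurable_ofReal.comp (measurable_density r a b ι))).aestronglyMeasurable
  · filter_upwards [ae_mem_regularSet r] with t ht
    rw [norm_mul, norm_mul, norm_SH_cpow ht, Complex.norm_real, Real.norm_of_nonneg
      (Real.rpow_nonneg (abs_nonneg _) _)]

/-- The distribution `f ↦ ∫ |SH| ^ δ f dμ`. -/
def powDist (r : ℕ) (a b ι : ℝ) (δ : ℂ) : TF r →L[ℂ] ℂ :=
  TestFunction.integralAgainstBilinCLM (ContinuousLinearMap.mul ℂ ℂ) volume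
    fun t => ((|SH t| : ℝ) : ℂ) ^ δ * (density r a b ι t : ℂ)

theorem powDist_apply (ha : 0 ≤ a) (hι : 0 ≤ ι) {δ : ℂ}
    (hδ : -1 - ι - 2 * b < δ.re) (f : TF r) :
    Integrable (fun t => ((|SH t| : ℝ) : ℂ) ^ δ * f t) (mu r a b ι) ∧
      powDist r a b ι δ f = ∫ t, ((|SH t| : ℝ) : ℂ) ^ δ * f t ∂mu r a b ι := by
  have h := (locallyIntegrable_SH_cpow (r := r) ha hι hδ).locallyIntegrableOn
    ((⊤ : Opens (Fin r → ℝ)) : Set (Fin r → ℝ))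
  have h1 := f.integrable_bilin (ContinuousLinearMap.mul ℂ ℂ) h
  rw [integrable_mu_iff, integral_mu, powDist,
    TestFunction.integralAgainstBilinCLM_eq_integral h]
  have e : (fun t => (density r a b ι t : ℂ) * (((|SH t| : ℝ) : ℂ) ^ δ * f t)) =
      fun t => ContinuousLinearMap.mul ℂ ℂ (f t) (((|SH t| : ℝ) : ℂ) ^ δ *
        (density r a b ι t : ℂ)) := by
    funext t
    rw [ContinuousLinearMap.mul_apply']
    ring
  rw [e]
  exact ⟨h1, rfl⟩

theorem abs_log_le {x ε : ℝ} (hx : 0 < x) (hε : 0 < ε) :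
    |Real.log x| ≤ (x ^ ε + x ^ (-ε)) / ε := by
  have h1 := Real.log_le_rpow_div hx.le hε
  have h2 := Real.log_le_rpow_div (inv_pos.2 hx).le hε
  rw [Real.log_inv, Real.inv_rpow hx.le, ← Real.rpow_neg hx.le] at h2
  have h3 : 0 < x ^ ε / ε := by positivity
  have h4 : 0 < x ^ (-ε) / ε := by positivity
  rw [add_div, abs_le]
  constructor <;> linarith

theorem rpow_le_add {x s p q : ℝ} (hx : 0 < x) (h1 : p ≤ s) (h2 : s ≤ q) :
    x ^ s ≤ x ^ p + x ^ q := by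
  have := Real.rpow_pos_of_pos hx p
  have := Real.rpow_pos_of_pos hx q
  rcases le_total x 1 with h | h
  · have := Real.rpow_le_rpow_of_exponent_ge hx h h1
    linarith
  · have := Real.rpow_le_rpow_of_exponent_le h h2
    linarith

/-- Differentiation under the integral sign. The logarithm is dominated by `|SH| ^ (±ε)`, and all
the powers in an `ε`-neighbourhood of `δ` by those with exponents `Re δ ± 2ε`. -/
theorem differentiableAt_powDist (ha : 0 ≤ a) (hι : 0 ≤ ι) {δ : ℂ}
    (hδ : -1 - ι - 2 * b < δ.re) (f : TF r) :
    DifferentiableAt ℂ (fun δ => powDist r a b ι δ f) δ := by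
  set B : ℝ := -1 - ι - 2 * b with hB
  obtain ⟨ε, hε, hε2⟩ : ∃ ε : ℝ, 0 < ε ∧ B < δ.re - 2 * ε :=
    ⟨(δ.re - B) / 4, by linarith, by linarith⟩
  have hball : ∀ z ∈ Metric.ball δ ε, δ.re - ε < z.re ∧ z.re < δ.re + ε := by
    intro z hz
    have h1 := (Complex.abs_re_le_norm (z - δ)).trans_lt (mem_ball_iff_norm.1 hz)
    rw [Complex.sub_re, abs_lt] at h1
    constructor <;> linarith
  have hint : ∀ s : ℝ, B < s → Integrable (fun t => |SH t| ^ s * ‖f t‖) (mu r a b ι) := by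
    intro s hs
    have h1 := (powDist_apply (δ := (s : ℂ)) ha hι (by simpa using hs) f).1.norm
    refine h1.congr ?_
    filter_upwards [ae_mu_mem_regularSet r a b ι] with t ht
    rw [norm_mul, norm_SH_cpow ht, Complex.ofReal_re]
  have hm : ∀ z : ℂ, AEStronglyMeasurable (fun t => ((|SH t| : ℝ) : ℂ) ^ z * f t)
      (mu r a b ι) := fun z =>
    ((measurable_SH_cpow z).mul f.continuous.measurable).aestronglyMeasurable
  have key := hasDerivAt_integral_of_dominated_loc_of_deriv_le (μ := mu r a b ι) (x₀ := δ)
    (F := fun z t => ((|SH t| : ℝ) : ℂ) ^ z * f t)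
    (F' := fun z t => ((|SH t| : ℝ) : ℂ) ^ z * (Real.log |SH t| : ℝ) * f t)
    (bound := fun t => (2 / ε) * (|SH t| ^ (δ.re - 2 * ε) * ‖f t‖ +
      |SH t| ^ (δ.re + 2 * ε) * ‖f t‖))
    (Metric.ball_mem_nhds δ hε) (Filter.Eventually.of_forall hm)
    (powDist_apply ha hι hδ f).1
    ((((measurable_SH_cpow δ).mul (Complex.measurable_ofReal.comp
      (Real.measurable_log.comp measurable_SH.abs))).mul
        f.continuous.measurable).aestronglyMeasurable) ?_
    (((hint _ hε2).add (hint _ (by linarith))).const_mul _) ?_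
  · refine (key.2.differentiableAt).congr_of_eventuallyEq ?_
    have ho : IsOpen {z : ℂ | B < z.re} := isOpen_lt continuous_const Complex.continuous_re
    filter_upwards [ho.mem_nhds hδ] with z hz using (powDist_apply ha hι hz f).2
  · filter_upwards [ae_mu_mem_regularSet r a b ι] with t ht z hz
    have hp : 0 < |SH t| := abs_pos.2 (SH_ne_zero ht)
    obtain ⟨h1, h2⟩ := hball z hz
    rw [norm_mul, norm_mul, norm_SH_cpow ht, Complex.norm_real, Real.norm_eq_abs, ← add_mul,
      ← mul_assoc]
    refine mul_le_mul_of_nonneg_right ?_ (norm_nonneg _)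
    have h3 := abs_log_le hp hε
    have h4 := rpow_le_add (s := z.re + ε) hp (p := δ.re - 2 * ε) (q := δ.re + 2 * ε)
      (by linarith) (by linarith)
    have h5 := rpow_le_add (s := z.re - ε) hp (p := δ.re - 2 * ε) (q := δ.re + 2 * ε)
      (by linarith) (by linarith)
    calc |SH t| ^ z.re * abs (Real.log |SH t|)
        ≤ |SH t| ^ z.re * ((|SH t| ^ ε + |SH t| ^ (-ε)) / ε) :=
          mul_le_mul_of_nonneg_left h3 (Real.rpow_nonneg hp.le _)
      _ = (|SH t| ^ (z.re + ε) + |SH t| ^ (z.re - ε)) / ε := by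
          rw [Real.rpow_add hp, sub_eq_add_neg, Real.rpow_add hp]; ring
      _ ≤ ((|SH t| ^ (δ.re - 2 * ε) + |SH t| ^ (δ.re + 2 * ε)) +
            (|SH t| ^ (δ.re - 2 * ε) + |SH t| ^ (δ.re + 2 * ε))) / ε := by gcongr
      _ = 2 / ε * (|SH t| ^ (δ.re - 2 * ε) + |SH t| ^ (δ.re + 2 * ε)) := by ring
  · filter_upwards [ae_mu_mem_regularSet r a b ι] with t ht z _
    have hp : ((|SH t| : ℝ) : ℂ) ≠ 0 := by exact_mod_cast (abs_pos.2 (SH_ne_zero ht)).ne'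
    have h1 := ((hasDerivAt_id z).const_cpow (c := ((|SH t| : ℝ) : ℂ)) (Or.inl hp)).mul_const (f t)
    rw [mul_one, ← Complex.ofReal_log (abs_nonneg _)] at h1
    exact h1

end Convergence

/-! ### Analytic continuation -/

section Continuation

variable {r : ℕ} {a b ι : ℝ}

/-- The operator `𝓜_δ` on test functions. -/
def opMTest (r : ℕ) (a b ι : ℝ) (δ : ℂ) : TF r →L[ℂ] TF r :=
  prodOp r a b ι (δ + ((ι + b + a * ((r : ℝ) - 1) : ℝ) : ℂ))

/-- The image of a test function under `𝓜_δ` is a polynomial in `δ + ρ_1`. -/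
theorem exists_prodOp_eq_sum (a b ι : ℝ) (f : TF r) :
    ∃ (n : ℕ) (g : ℕ → TF r), ∀ c : ℂ,
      prodOp r a b ι c f = ∑ k ∈ Finset.range n, c ^ k • g k := by
  have key : ∀ l : List (Fin r), ∃ (n : ℕ) (g : ℕ → TF r), ∀ c : ℂ,
      (l.map (sqOp a b ι c)).prod f = ∑ k ∈ Finset.range n, c ^ k • g k := by
    intro l
    induction l with
    | nil => exact ⟨1, fun _ => f, fun c => by simp⟩
    | cons j l ih =>
      obtain ⟨n, g, h⟩ := ih
      refine ⟨n + 2, fun k => (if k < n then cherOp a b ι j (cherOp a b ι j (g k)) else 0) -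
        if 2 ≤ k then g (k - 2) else 0, fun c => ?_⟩
      have e1 : ∑ k ∈ Finset.range (n + 2), c ^ k •
          (if k < n then cherOp a b ι j (cherOp a b ι j (g k)) else 0) =
          ∑ k ∈ Finset.range n, c ^ k • cherOp a b ι j (cherOp a b ι j (g k)) := by
        rw [Finset.sum_range_add]
        simp only [add_lt_iff_neg_left, not_lt_zero, if_false, smul_zero, Finset.sum_const_zero,
          add_zero]
        exact Finset.sum_congr rfl fun k hk => by rw [if_pos (Finset.mem_range.1 hk)]
      have e2 : ∑ k ∈ Finset.range (n + 2), c ^ k • (if 2 ≤ k then g (k - 2) else 0) =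
          ∑ k ∈ Finset.range n, c ^ 2 • c ^ k • g k := by
        rw [add_comm n 2, Finset.sum_range_add]
        simp [Finset.sum_range_succ, pow_add, mul_smul]
      rw [List.map_cons, List.prod_cons, mul_apply_eq_comp, h]
      simp only [smul_sub, Finset.sum_sub_distrib, e1, e2]
      change cherOp a b ι j (cherOp a b ι j (∑ k ∈ Finset.range n, c ^ k • g k)) -
        c ^ 2 • (∑ k ∈ Finset.range n, c ^ k • g k) = _
      rw [map_sum, map_sum, Finset.smul_sum]
      simp only [map_smul]
  exact key _

/-- If the `T δ` are distributions and `δ ↦ T δ f` is differentiable for all `f`, then so is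
`δ ↦ T δ (𝓜_δ f)`. -/
theorem differentiableAt_comp_opMTest {T : ℂ → (TF r →L[ℂ] ℂ)} {δ : ℂ}
    (h : ∀ f, DifferentiableAt ℂ (fun z => T z f) δ) (f : TF r) :
    DifferentiableAt ℂ (fun z => T z (opMTest r a b ι z f)) δ := by
  obtain ⟨n, g, hg⟩ := exists_prodOp_eq_sum a b ι f
  have e : (fun z => T z (opMTest r a b ι z f)) = fun z => ∑ k ∈ Finset.range n,
      (z + ((ι + b + a * ((r : ℝ) - 1) : ℝ) : ℂ)) ^ k * T z (g k) := by
    funext z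
    rw [opMTest, hg, map_sum]
    simp only [map_smul, smul_eq_mul]
  rw [e]
  refine DifferentiableAt.fun_sum fun k _ => ?_
  exact ((differentiableAt_id.add_const _).pow k).mul (h (g k))

/-- The functional equation in the half plane where both sides converge. -/
theorem powDist_opMTest (ha : 0 ≤ a) (hb : 0 ≤ b) (hι : 0 ≤ ι) {δ : ℂ}
    (hδ : -1 - ι - 2 * b + 2 < δ.re) (f : TF r) :
    powDist r a b ι δ (opMTest r a b ι δ f) = bFactor r a b ι δ * powDist r a b ι (δ - 2) f := by
  set U : Set ℂ := {z | -1 - ι - 2 * b + 2 < z.re} with hU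
  have ho : IsOpen U := isOpen_lt continuous_const Complex.continuous_re
  have hc : IsPreconnected U := (convex_halfSpace_re_gt _).isPreconnected
  have h1 : DifferentiableOn ℂ (fun z => powDist r a b ι z (opMTest r a b ι z f)) U := by
    intro z hz
    have hz' : -1 - ι - 2 * b + 2 < z.re := hz
    exact (differentiableAt_comp_opMTest (fun g => differentiableAt_powDist ha hι
      (by linarith) g) f).differentiableWithinAt
  have h2 : DifferentiableOn ℂ (fun z => bFactor r a b ι z * powDist r a b ι (z - 2) f) U := by
    intro z hz
    have hz' : -1 - ι - 2 * b + 2 < z.re := hz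
    have h3 : DifferentiableAt ℂ (fun z => powDist r a b ι z f) (z - 2) :=
      differentiableAt_powDist ha hι (by simp; linarith) f
    have h4 : DifferentiableAt ℂ (fun z => powDist r a b ι (z - 2) f) z :=
      h3.comp z (differentiableAt_id.sub_const 2)
    have h5 : Differentiable ℂ (bFactor r a b ι) := by
      unfold bFactor
      refine Differentiable.mul ?_ ?_ <;>
      · refine Differentiable.fun_finsetProd fun j _ => ?_
        fun_prop
    exact ((h5 z).mul h4).differentiableWithinAt
  have h0 : (3 : ℂ) ∈ U := by
    change -1 - ι - 2 * b + 2 < (3 : ℂ).re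
    have : (3 : ℂ).re = 3 := by norm_num
    rw [this]; linarith
  -- both sides are analytic in the half plane and agree near `3`
  refine (h1.analyticOnNhd ho).eqOn_of_preconnected_of_eventuallyEq (h2.analyticOnNhd ho) hc h0
    ?_ hδ
  have ho' : IsOpen {z : ℂ | 2 < z.re} := isOpen_lt continuous_const Complex.continuous_re
  filter_upwards [ho'.mem_nhds (show (3 : ℂ) ∈ {z : ℂ | 2 < z.re} by
    change 2 < (3 : ℂ).re; norm_num)] with z hz
  have hz' : 2 < z.re := hz
  rw [(powDist_apply ha hι (by linarith) _).2,
    (powDist_apply ha hι (by simp; linarith) _).2]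
  exact integral_prodOp ha hb hι hz' f

/-- The `n`-th extension of the zeta distribution, to `Re δ > -1 - ι - 2b - 2n`: the functional
equation is used `n` times. -/
def zetaExt (r : ℕ) (a b ι : ℝ) : ℕ → ℂ → (TF r →L[ℂ] ℂ)
  | 0, δ => (zNorm r a b ι δ)⁻¹ • powDist r a b ι δ
  | n + 1, δ => ((2 : ℂ) ^ (2 * r))⁻¹ • (zetaExt r a b ι n (δ + 2)).comp (opMTest r a b ι (δ + 2))

theorem differentiableAt_zetaExt (ha : 0 ≤ a) (hι : 0 ≤ ι) (n : ℕ) :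
    ∀ {δ : ℂ}, -1 - ι - 2 * b - 2 * n < δ.re → ∀ f : TF r,
      DifferentiableAt ℂ (fun z => zetaExt r a b ι n z f) δ := by
  induction n with
  | zero =>
    intro δ hδ f
    exact (differentiable_inv_zNorm r a b ι δ).mul
      (differentiableAt_powDist ha hι (by simpa using hδ) f)
  | succ n ih =>
    intro δ hδ f
    have h1 : DifferentiableAt ℂ (fun z => zetaExt r a b ι n z (opMTest r a b ι z f)) (δ + 2) :=
      differentiableAt_comp_opMTest (fun g => ih (by push_cast at hδ; simp; linarith) g) f
    have h2 : DifferentiableAt ℂ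
        (fun z => zetaExt r a b ι n (z + 2) (opMTest r a b ι (z + 2) f)) δ :=
      h1.comp δ (differentiableAt_id.add_const 2)
    exact h2.const_mul _

/-- Successive extensions agree where both are defined. -/
theorem zetaExt_succ (ha : 0 ≤ a) (hb : 0 ≤ b) (hι : 0 ≤ ι) (n : ℕ) :
    ∀ {δ : ℂ}, -1 - ι - 2 * b - 2 * n < δ.re →
      zetaExt r a b ι (n + 1) δ = zetaExt r a b ι n δ := by
  induction n with
  | zero =>
    intro δ hδ
    ext f
    change ((2 : ℂ) ^ (2 * r))⁻¹ * ((zNorm r a b ι (δ + 2))⁻¹ *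
      powDist r a b ι (δ + 2) (opMTest r a b ι (δ + 2) f)) =
      (zNorm r a b ι δ)⁻¹ * powDist r a b ι δ f
    have h1 := powDist_opMTest (r := r) (δ := δ + 2) ha hb hι
      (by simp at hδ ⊢; linarith) f
    have h2 := bFactor_mul_inv_zNorm (r := r) a b ι (δ + 2)
    rw [add_sub_cancel_right] at h1 h2
    have h3 : (2 : ℂ) ^ (2 * r) ≠ 0 := pow_ne_zero _ two_ne_zero
    rw [h1, inv_mul_eq_iff_eq_mul₀ h3]
    linear_combination powDist r a b ι δ f * h2
  | succ n ih =>
    intro δ hδ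
    have h1 := ih (δ := δ + 2) (by push_cast at hδ; simp; linarith)
    rw [zetaExt, h1, ← zetaExt]

theorem zetaExt_eq_of_le (ha : 0 ≤ a) (hb : 0 ≤ b) (hι : 0 ≤ ι) {m n : ℕ} (h : m ≤ n) {δ : ℂ}
    (hδ : -1 - ι - 2 * b - 2 * m < δ.re) : zetaExt r a b ι n δ = zetaExt r a b ι m δ := by
  induction n, h using Nat.le_induction with
  | base => rfl
  | succ n hmn ih =>
    rw [zetaExt_succ ha hb hι n, ih]
    have : (m : ℝ) ≤ n := by exact_mod_cast hmn
    linarith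

/-- The number of extension steps needed to reach the point `δ`. -/
def extSteps (δ : ℂ) : ℕ := ⌈|δ.re|⌉₊

theorem lt_re_of_extSteps (hb : 0 ≤ b) (hι : 0 ≤ ι) (δ : ℂ) :
    -1 - ι - 2 * b - 2 * extSteps δ < δ.re := by
  have h1 : |δ.re| ≤ extSteps δ := Nat.le_ceil _
  have h2 := neg_abs_le δ.re
  have h3 := abs_nonneg δ.re
  linarith

/-- The zeta distribution `ζ_δ` on all test functions. Any larger number of extension steps gives
the same distribution, see `zetaDist_eq`. -/
def zetaDist (r : ℕ) (a b ι : ℝ) (δ : ℂ) : TF r →L[ℂ] ℂ := zetaExt r a b ι (extSteps δ) δ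

theorem zetaDist_eq (ha : 0 ≤ a) (hb : 0 ≤ b) (hι : 0 ≤ ι) {n : ℕ} {δ : ℂ}
    (hδ : -1 - ι - 2 * b - 2 * n < δ.re) : zetaDist r a b ι δ = zetaExt r a b ι n δ := by
  rcases le_total n (extSteps δ) with h | h
  · exact zetaExt_eq_of_le ha hb hι h hδ
  · exact (zetaExt_eq_of_le ha hb hι h (lt_re_of_extSteps hb hι δ)).symm

theorem differentiable_zetaDist (ha : 0 ≤ a) (hb : 0 ≤ b) (hι : 0 ≤ ι) (f : TF r) :
    Differentiable ℂ fun δ => zetaDist r a b ι δ f := by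
  intro δ
  have hδ := lt_re_of_extSteps hb hι δ
  refine (differentiableAt_zetaExt ha hι (extSteps δ) hδ f).congr_of_eventuallyEq ?_
  have ho : IsOpen {z : ℂ | -1 - ι - 2 * b - 2 * extSteps δ < z.re} :=
    isOpen_lt continuous_const Complex.continuous_re
  filter_upwards [ho.mem_nhds hδ] with z hz
  rw [zetaDist_eq ha hb hι hz]

/-- The functional equation. -/
theorem zetaDist_opMTest (ha : 0 ≤ a) (hb : 0 ≤ b) (hι : 0 ≤ ι) (δ : ℂ) (f : TF r) :
    zetaDist r a b ι δ (opMTest r a b ι δ f) = 2 ^ (2 * r) * zetaDist r a b ι (δ - 2) f := by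
  have hδ := lt_re_of_extSteps hb hι δ
  have h1 : zetaDist r a b ι (δ - 2) = zetaExt r a b ι (extSteps δ + 1) (δ - 2) :=
    zetaDist_eq ha hb hι (by push_cast; simp; linarith)
  have h2 : (2 : ℂ) ^ (2 * r) ≠ 0 := pow_ne_zero _ two_ne_zero
  rw [h1, zetaExt, sub_add_cancel]
  change _ = 2 ^ (2 * r) * (((2 : ℂ) ^ (2 * r))⁻¹ *
    zetaExt r a b ι (extSteps δ) δ (opMTest r a b ι δ f))
  rw [mul_inv_cancel_left₀ h2]
  rfl

end Continuation

end SinhZeta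

end

theorem theorem3p4 (r : ℕ) (hr : 1 ≤ r) (a b ι : ℝ) (ha : 0 ≤ a) (hb : 0 ≤ b) (hι : 0 ≤ ι) :
    ∃ M : ℂ → (SinhZeta.invariantTestFunctions r a b ι →L[ℂ]
        SinhZeta.invariantTestFunctions r a b ι),
      -- the operators `𝓜_δ` act on invariant test functions
      (∀ (δ : ℂ) (f : SinhZeta.invariantTestFunctions r a b ι), ∀ t ∈ SinhZeta.regularSet r,
        (M δ f).1 t = SinhZeta.opM r a b ι δ f.1 t) ∧
      -- they are symmetric with respect to `dμ`, so `𝓜_δ u = u ∘ 𝓜_δ` for a distribution `u`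
      (∀ (δ : ℂ) (f g : SinhZeta.invariantTestFunctions r a b ι),
        ∫ t, (M δ f).1 t * g.1 t ∂(SinhZeta.mu r a b ι) =
          ∫ t, f.1 t * (M δ g).1 t ∂(SinhZeta.mu r a b ι)) ∧
      ∃ ζ : ℂ → (SinhZeta.invariantTestFunctions r a b ι →L[ℂ] ℂ),
        -- in the half plane of convergence, `ζ_δ` is given by the integral
        (∀ δ : ℂ, -1 - ι - 2 * b < δ.re → ∀ f : SinhZeta.invariantTestFunctions r a b ι,
          Integrable (fun t => ((|SinhZeta.SH t| : ℝ) : ℂ) ^ δ * f.1 t) (SinhZeta.mu r a b ι) ∧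
          ζ δ f = (SinhZeta.zNorm r a b ι δ)⁻¹ *
            ∫ t, ((|SinhZeta.SH t| : ℝ) : ℂ) ^ δ * f.1 t ∂(SinhZeta.mu r a b ι)) ∧
        -- `ζ_δ` is an entire function of `δ`
        (∀ f : SinhZeta.invariantTestFunctions r a b ι, Differentiable ℂ fun δ => ζ δ f) ∧
        -- the functional equation
        (∀ δ : ℂ, (ζ δ).comp (M δ) = (2 : ℂ) ^ (2 * r) • ζ (δ - 2)) := by
  refine ⟨fun δ => SinhZeta.invOp r a b ι (δ + ((ι + b + a * ((r : ℝ) - 1) : ℝ) : ℂ)),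
    fun δ f t ht => SinhZeta.prodOp_apply a b ι δ f.1 ht,
    fun δ f g => (SinhZeta.isAdj_prodOp ha hb hι _ g.1 f.1).2.2,
    fun δ => (SinhZeta.zetaDist r a b ι δ).comp
      (SinhZeta.invariantTestFunctions r a b ι).subtypeL, fun δ hδ f => ?_,
    fun f => SinhZeta.differentiable_zetaDist ha hb hι f.1, fun δ => ?_⟩
  · obtain ⟨h1, h2⟩ := SinhZeta.powDist_apply ha hι hδ f.1
    refine ⟨h1, ?_⟩
    change SinhZeta.zetaDist r a b ι δ f.1 = _
    rw [SinhZeta.zetaDist_eq ha hb hι (n := 0) (by simpa using hδ), ← h2]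
    rfl
  · ext f
    exact SinhZeta.zetaDist_opMTest ha hb hι δ f.1
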